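/- Throughout, $a_1,a_2,b_1,b_2$ are nonzero real constants and $a_3\in\mathbb R$. Consider for $\psi=u+iv$ (complex) and $w$ (real), functions of $(t,x,y,z)\in\mathbb R^4$, the modified Davey–Stewartson system $$\text{(MDS)}\quad i\psi_t+\psi_{xx}+a_1\psi_{yy}+\psi_{zz}=a_2|\psi|^2\psi+\psi w+ia_3\psi,\qquad w_{xx}+b_1w_{yy}+w_{zz}=b_2\big[(|\psi|^2)_{xx}+(|\psi|^2)_{zz}\big]$$ and the $(3+1)$-dimensional Davey–Stewartson system $$\text{(31DS)}\quad i\psi_t+\psi_{xx}+a_1\psi_{yy}+\psi_{zz}=a_2|\psi|^2\psi+\psi w,\qquad w_{xx}+b_1w_{yy}+w_{zz}=b_2(|\psi|^2)_{yy}.$$ Write each as a real system $\Delta_1=\Delta_2=\Delta_3=0$ for $(u,v,w)$. For an open set $U$ of the space $\mathbb R^7$ of the variables $(t,x,y,z,u,v,w)$, the symmetry algebra over $U$ consists of the $C^\infty$ vector fields $V$ on $U$ whose second prolongation satisfies $\mathrm{Pr}^{(2)}V(\Delta_i)=0$ ($i=1,2,3$) at every second-order jet over $U$ with $\Delta_1=\Delta_2=\Delta_3=0$;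 its bracket is the commutator. Let $I_U\subset\mathbb R$ denote the set of the values of $t$ on $U$. Let $$\mathcal X_1=\partial_t,\quad \mathcal X_2=2t\partial_t+x\partial_x+y\partial_y+z\partial_z-u\partial_u-v\partial_v-2w\partial_w,\quad \mathcal X_3=z\partial_x-x\partial_z,$$ and, for $a_3\ne0$ and $q=x^2+y^2/a_1+z^2$, $$\tilde{\mathcal X}_2=e^{4a_3t}\Big\{\tfrac1{2a_3}\partial_t+x\partial_x+y\partial_y+z\partial_z-[u+a_3qv]\partial_u+[-v+a_3qu]\partial_v-[2w+4a_3^2q]\partial_w\Big\};$$ for smooth functions $g,h,k,m$ on $I_U$ let $$\mathcal Y(g)=g\partial_x-\tfrac x2\big[g'(v\partial_u-u\partial_v)+g''\partial_w\big],\quad \mathcal Z(h)=h\partial_y-\tfrac y{2a_1}\big[h'(v\partial_u-u\partial_v)+h''\partial_w\big],$$ $$\mathcal Q(k)=k\partial_z-\tfrac z2\big[k'(v\partial_u-u\partial_v)+k''\partial_w\big],\quad \mathcal W(m)=m(v\partial_u-u\partial_v)+m'\partial_w .$$ **(a) Structure.** Let $U\subset\mathbb R^7$ be open, convex and nonempty.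 The symmetry algebra over $U$ of each of the three systems - (MDS) with $a_3=0$ (algebra $L_1$), - (MDS) with $a_3\neq0$ and $b_1=-2a_1$ (algebra $L_2$), - (31DS), is an infinite-dimensional Lie algebra, and it is the semi-direct sum $S\ltimes N$ of a three-dimensional solvable subalgebra $S$ and an ideal $N$. Here $S$ is spanned by $\mathcal X_1,\mathcal X_2,\mathcal X_3$ in the first and third case and by $\mathcal X_1,\tilde{\mathcal X}_2,\mathcal X_3$ in the second, and in all cases $N=\{\mathcal Y(g)+\mathcal Z(h)+\mathcal Q(k)+\mathcal W(m): g,h,k,m\in C^\infty(I_U)\}$ is the non-Abelian algebra of Kac–Moody type with the relations $$[\mathcal Y(g_1),\mathcal Y(g_2)]=\mathcal W\big(\tfrac12(g_1'g_2-g_1g_2')\big),\quad [\mathcal Z(h_1),\mathcal Z(h_2)]=\mathcal W\big(\tfrac1{2a_1}(h_1'h_2-h_1h_2')\big),\quad [\mathcal Q(k_1),\mathcal Q(k_2)]=\mathcal W\big(\tfrac12(k_1'k_2-k_1k_2')\big),$$ all other brackets between $\mathcal Y,\mathcal Z,\mathcal Q,\mathcal W$ being zero. **(b) Isomorphism.**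 The three algebras are isomorphic Lie algebras over corresponding time intervals. Precisely: consider (MDS) with $a_3=0$, (MDS) with $a_3\ne0$ and $b_1=-2a_1$, and (31DS), with the same $a_1$ but with otherwise arbitrary nonzero constants, which may differ from one system to the next. Let $U,U',U''$ be nonempty convex open sets such that $I_{U''}=I_U$ and $I_U=\{T_1e^{-4a_3t}+T_0: t\in I_{U'}\}$ for some real $T_0$ and $T_1\neq0$ (any two bounded open intervals $I_U,I_{U'}$ are related in this way). Then $L_1$ over $U$, $L_2$ over $U'$ and the symmetry algebra of (31DS) over $U''$ are isomorphic. **(c) Transformability.** Let $a_3\neq0$. Consider smooth point transformations over an open set $O\subset\mathbb R^4$, $$X,Y,Z=X,Y,Z(x,y,z,t),\quad T=T(t),\ \dot T>0,\qquad \psi=R\,e^{i\theta}\,\Psi(X,Y,Z,T),\quad w=P\,W(X,Y,Z,T)+S,$$ with real functions $R,\theta,P,S$ of $(x,y,z,t)$, $R$ and $P$ nowhere zero, and $(t,x,y,z)\mapsto(T,X,Y,Z)$ injective on $O$ with invertible derivative. Say that $a_3$ can be transformed away over $O$ if for some such transformation, for all smooth $\Psi,W$ and at every point of $O$, the functions $(\psi,w)$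 satisfy (MDS) if and only if $(\Psi,W)$ satisfy, at the image point, (MDS) with the same $a_1,a_2,b_1,b_2$ and with $a_3=0$. If $b_1=-2a_1$, then $a_3$ can be transformed away over all of $\mathbb R^4$; conversely, if $a_3$ can be transformed away over some nonempty open set $O$, then $b_1=-2a_1$. -/

import Mathlib

open scoped ContDiff

noncomputable section

namespace DaveyStewartson

/-! ### Space-time, the space of independent and dependent variables, vector fields -/

/-- Independent variables: index `0, 1, 2, 3` is `t, x, y, z`. -/
abbrev Base := Fin 4 → ℝ

/-- Dependent variables: index `0, 1, 2` is `u, v, w`, where `ψ = u + i v`. -/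
abbrev Fib := Fin 3 → ℝ

/-- The seven-dimensional space of the variables `(t, x, y, z, u, v, w)`. -/
abbrev Pt := Base × Fib

/-- The smooth vector fields on the open set `U`.  A field `V` assigns to a point `p` the pair
`((σ₁, σ₂, σ₃, σ₄), (φ₁, φ₂, φ₃))` of its coefficients.  In order that two fields are equal exactly
when they agree on `U`, a field is represented by the function that vanishes outside `U`. -/
def VField (U : TopologicalSpace.Opens Pt) : Submodule ℝ (Pt → Pt) where
  carrier := {V | ContDiffOn ℝ ∞ V (U : Set Pt) ∧ ∀ p, p ∉ U → V p = 0}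
  add_mem' := by
    rintro V W ⟨hV, hV'⟩ ⟨hW, hW'⟩
    exact ⟨hV.add hW, fun p hp => by simp [hV' p hp, hW' p hp]⟩
  zero_mem' := ⟨contDiffOn_const, fun _ _ => rfl⟩
  smul_mem' := by
    rintro c V ⟨hV, hV'⟩
    exact ⟨hV.const_smul c, fun p hp => by simp [hV' p hp]⟩

variable {U : TopologicalSpace.Opens Pt}

theorem VField.contDiffAt (V : VField U) {p : Pt} (hp : p ∈ U) : ContDiffAt ℝ ∞ V.1 p :=
  V.2.1.contDiffAt (U.isOpen.mem_nhds hp)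

theorem VField.ext_on {V W : VField U} (h : ∀ p ∈ U, V.1 p = W.1 p) : V = W := by
  refine Subtype.ext (funext fun p => ?_)
  by_cases hp : p ∈ U
  · exact h p hp
  · rw [V.2.2 p hp, W.2.2 p hp]

open Classical in
/-- The commutator of vector fields, `[V, W] = (DW) V - (DV) W` on `U`. -/
instance : Bracket (VField U) (VField U) where
  bracket V W := ⟨fun p => if p ∈ U then VectorField.lieBracket ℝ V.1 W.1 p else 0, by
    constructor
    · have h : ContDiffOn ℝ ∞ (VectorField.lieBracket ℝ V.1 W.1) (U : Set Pt) := fun p hp =>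
        (ContDiffAt.lieBracket_vectorField (n := ∞) (VField.contDiffAt V hp) (VField.contDiffAt W hp)
          (by simp)).contDiffWithinAt
      exact h.congr fun p hp => if_pos hp
    · intro p hp
      exact if_neg hp⟩

theorem VField.bracket_apply (V W : VField U) {p : Pt} (hp : p ∈ U) :
    (⁅V, W⁆ : VField U).1 p = VectorField.lieBracket ℝ V.1 W.1 p :=
  if_pos hp

theorem VField.bracket_eventuallyEq (V W : VField U) {p : Pt} (hp : p ∈ U) :
    (⁅V, W⁆ : VField U).1 =ᶠ[nhds p] VectorField.lieBracket ℝ V.1 W.1 := by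
  filter_upwards [U.isOpen.mem_nhds hp] with q hq
  exact VField.bracket_apply V W hq

theorem VField.diffAt (V : VField U) {p : Pt} (hp : p ∈ U) : DifferentiableAt ℝ V.1 p :=
  (VField.contDiffAt V hp).differentiableAt (by simp)

instance : LieRing (VField U) where
  add_lie V₁ V₂ W := VField.ext_on fun p hp => by
    change _ = (⁅V₁, W⁆ : VField U).1 p + (⁅V₂, W⁆ : VField U).1 p
    rw [VField.bracket_apply _ _ hp, VField.bracket_apply _ _ hp, VField.bracket_apply _ _ hp]
    exact VectorField.lieBracket_add_left (VField.diffAt V₁ hp) (VField.diffAt V₂ hp)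
  lie_add V W₁ W₂ := VField.ext_on fun p hp => by
    change _ = (⁅V, W₁⁆ : VField U).1 p + (⁅V, W₂⁆ : VField U).1 p
    rw [VField.bracket_apply _ _ hp, VField.bracket_apply _ _ hp, VField.bracket_apply _ _ hp]
    exact VectorField.lieBracket_add_right (VField.diffAt W₁ hp) (VField.diffAt W₂ hp)
  lie_self V := VField.ext_on fun p hp => by
    rw [VField.bracket_apply _ _ hp, VectorField.lieBracket_self]
    rfl
  leibniz_lie V W X := VField.ext_on fun p hp => by
    change _ = (⁅⁅V, W⁆, X⁆ : VField U).1 p + (⁅W, ⁅V, X⁆⁆ : VField U).1 p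
    rw [VField.bracket_apply _ _ hp, VField.bracket_apply _ _ hp, VField.bracket_apply _ _ hp,
      Filter.EventuallyEq.lieBracket_vectorField_eq Filter.EventuallyEq.rfl
        (VField.bracket_eventuallyEq W X hp),
      Filter.EventuallyEq.lieBracket_vectorField_eq (VField.bracket_eventuallyEq V W hp)
        Filter.EventuallyEq.rfl,
      Filter.EventuallyEq.lieBracket_vectorField_eq Filter.EventuallyEq.rfl
        (VField.bracket_eventuallyEq V X hp)]
    exact VectorField.leibniz_identity_lieBracket (n := ∞) (by simpa using ENat.LEInfty.out) (VField.contDiffAt V hp)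
      (VField.contDiffAt W hp) (VField.contDiffAt X hp)

instance : LieAlgebra ℝ (VField U) where
  lie_smul c V W := VField.ext_on fun p hp => by
    change _ = c • (⁅V, W⁆ : VField U).1 p
    rw [VField.bracket_apply _ _ hp, VField.bracket_apply _ _ hp]
    exact VectorField.lieBracket_const_smul_right (VField.diffAt W hp)

/-! ### Jets, total derivatives, second prolongation -/

/-- First-order jets: a point together with `u^α_i = ∂u^α/∂x^i` (entry `α i`). -/
abbrev Jet1 := Pt × (Fin 3 → Fin 4 → ℝ)

/-- Second-order jets: a first-order jet together with `u^α_{ij}` (entry `α i j`).  Only the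
symmetric ones, `u^α_{ij} = u^α_{ji}`, are jets of functions. -/
abbrev Jet2 := Jet1 × (Fin 3 → Fin 4 → Fin 4 → ℝ)

/-- The total derivative `D_i f` of a function `f` of the variables of order zero. -/
def totalD0 (i : Fin 4) (f : Pt → ℝ) (j : Jet1) : ℝ :=
  fderiv ℝ f j.1 (Pi.single i 1, fun α => j.2 α i)

/-- The total derivative `D_i f` of a function `f` on the first-order jets. -/
def totalD1 (i : Fin 4) (f : Jet1 → ℝ) (j : Jet2) : ℝ :=
  fderiv ℝ f j.1 ((Pi.single i 1, fun α => j.1.2 α i), fun α k => j.2 α k i)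

/-- `φ_α^i = D_i φ_α - ∑_k (D_i σ_k) u^α_k`. -/
def prol1 (V : Pt → Pt) (α : Fin 3) (i : Fin 4) (j : Jet1) : ℝ :=
  totalD0 i (fun p => (V p).2 α) j - ∑ k, totalD0 i (fun p => (V p).1 k) j * j.2 α k

/-- `φ_α^{ik} = D_k φ_α^i - ∑_l (D_k σ_l) u^α_{il}`. -/
def prol2 (V : Pt → Pt) (α : Fin 3) (i k : Fin 4) (j : Jet2) : ℝ :=
  totalD1 k (prol1 V α i) j - ∑ l, totalD0 k (fun p => (V p).1 l) j.1 * j.2 α i l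

/-- The second prolongation of `V`, a vector field on the second-order jets. -/
def pr2 (V : Pt → Pt) (j : Jet2) : Jet2 :=
  ((V j.1.1, fun α i => prol1 V α i j.1), fun α i k => prol2 V α i k j)

/-- A system of three second-order equations `Δ₁ = Δ₂ = Δ₃ = 0`. -/
abbrev PDESystem := Fin 3 → Jet2 → ℝ

/-- `V` is a symmetry generator on `U` of the system `Δ`: its second prolongation annihilates every
`Δ_i` at all second-order jets over `U` at which `Δ₁ = Δ₂ = Δ₃ = 0`. -/
def IsSymmetryGenerator (Δ : PDESystem) (V : VField U) : Prop :=
  ∀ j : Jet2, j.1.1 ∈ U → (∀ α i k, j.2 α i k = j.2 α k i) → (∀ i, Δ i j = 0) →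
    ∀ i, fderiv ℝ (Δ i) j (pr2 V.1 j) = 0

/-- The Lie algebra generated by the symmetry generators on `U` of the system `Δ`. -/
def symmetryAlgebra (Δ : PDESystem) (U : TopologicalSpace.Opens Pt) : LieSubalgebra ℝ (VField U) :=
  LieSubalgebra.lieSpan ℝ (VField U) {V | IsSymmetryGenerator Δ V}

/-! ### The two systems, in real form -/

/-- The value at a jet of `(u^α)_{xx} + c (u^α)_{yy} + (u^α)_{zz}`. -/
def lap (c : ℝ) (α : Fin 3) (j : Jet2) : ℝ := j.2 α 1 1 + c * j.2 α 2 2 + j.2 α 3 3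

/-- The value at a jet of `(u² + v²)_{ii}`. -/
def rho2 (i : Fin 4) (j : Jet2) : ℝ :=
  2 * (j.1.2 0 i ^ 2 + j.1.1.2 0 * j.2 0 i i + j.1.2 1 i ^ 2 + j.1.1.2 1 * j.2 1 i i)

/-- Imaginary and real part of the equation
`i ψ_t + ψ_xx + a₁ ψ_yy + ψ_zz = a₂ |ψ|² ψ + ψ w + i a₃ ψ` for `ψ = u + i v`:
`u_t + v_xx + a₁ v_yy + v_zz - a₂ v (u² + v²) - v w - a₃ u`. -/
def schrodingerIm (a₁ a₂ a₃ : ℝ) (j : Jet2) : ℝ :=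
  let u := j.1.1.2 0
  let v := j.1.1.2 1
  let w := j.1.1.2 2
  j.1.2 0 0 + lap a₁ 1 j - a₂ * v * (u ^ 2 + v ^ 2) - v * w - a₃ * u

/-- `u_xx + a₁ u_yy + u_zz - v_t - a₂ u (u² + v²) - u w + a₃ v`. -/
def schrodingerRe (a₁ a₂ a₃ : ℝ) (j : Jet2) : ℝ :=
  let u := j.1.1.2 0
  let v := j.1.1.2 1
  let w := j.1.1.2 2
  lap a₁ 0 j - j.1.2 1 0 - a₂ * u * (u ^ 2 + v ^ 2) - u * w + a₃ * v

/-- The modified Davey--Stewartson system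
`i ψ_t + ψ_xx + a₁ ψ_yy + ψ_zz = a₂ |ψ|² ψ + ψ w + i a₃ ψ`,
`w_xx + b₁ w_yy + w_zz = b₂ ((|ψ|²)_xx + (|ψ|²)_zz)`. -/
def mdsSystem (a₁ a₂ a₃ b₁ b₂ : ℝ) : PDESystem :=
  ![schrodingerIm a₁ a₂ a₃, schrodingerRe a₁ a₂ a₃,
    fun j => lap b₁ 2 j - b₂ * rho2 1 j - b₂ * rho2 3 j]

/-- The (3+1)-dimensional Davey--Stewartson system
`i ψ_t + ψ_xx + a₁ ψ_yy + ψ_zz = a₂ |ψ|² ψ + ψ w`,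
`w_xx + b₁ w_yy + w_zz = b₂ (|ψ|²)_yy`. -/
def dsSystem (a₁ a₂ b₁ b₂ : ℝ) : PDESystem :=
  ![schrodingerIm a₁ a₂ 0, schrodingerRe a₁ a₂ 0, fun j => lap b₁ 2 j - b₂ * rho2 2 j]

/-! ### The explicit vector fields -/

/-- `∂_t`. -/
def fieldX1 : Pt → Pt := fun _ => (![1, 0, 0, 0], 0)

/-- `2t ∂_t + x ∂_x + y ∂_y + z ∂_z - u ∂_u - v ∂_v - 2w ∂_w`. -/
def fieldX2 : Pt → Pt := fun p =>
  (![2 * p.1 0, p.1 1, p.1 2, p.1 3], ![-p.2 0, -p.2 1, -2 * p.2 2])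

/-- With `q = x² + y²/a₁ + z²`, the field `e^{4 a₃ t} ( (1/(2a₃)) ∂_t + x ∂_x + y ∂_y + z ∂_z
- (u + a₃ q v) ∂_u + (-v + a₃ q u) ∂_v - (2w + 4 a₃² q) ∂_w )`. -/
def fieldX2' (a₁ a₃ : ℝ) : Pt → Pt := fun p =>
  let q := p.1 1 ^ 2 + p.1 2 ^ 2 / a₁ + p.1 3 ^ 2
  Real.exp (4 * a₃ * p.1 0) •
    (![1 / (2 * a₃), p.1 1, p.1 2, p.1 3],
     ![-(p.2 0 + a₃ * q * p.2 1), -p.2 1 + a₃ * q * p.2 0, -(2 * p.2 2 + 4 * a₃ ^ 2 * q)])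

/-- `z ∂_x - x ∂_z`. -/
def fieldX3 : Pt → Pt := fun p => (![0, p.1 3, 0, -p.1 1], 0)

/-- `𝒴(g) = g ∂_x - (x/2) (g' (v ∂_u - u ∂_v) + g'' ∂_w)`. -/
def fieldY (g : ℝ → ℝ) : Pt → Pt := fun p =>
  (![0, g (p.1 0), 0, 0],
   (-(p.1 1 / 2)) • ![deriv g (p.1 0) * p.2 1, -(deriv g (p.1 0) * p.2 0),
     deriv (deriv g) (p.1 0)])

/-- `𝒵(h) = h ∂_y - (y/(2a₁)) (h' (v ∂_u - u ∂_v) + h'' ∂_w)`. -/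
def fieldZ (a₁ : ℝ) (h : ℝ → ℝ) : Pt → Pt := fun p =>
  (![0, 0, h (p.1 0), 0],
   (-(p.1 2 / (2 * a₁))) • ![deriv h (p.1 0) * p.2 1, -(deriv h (p.1 0) * p.2 0),
     deriv (deriv h) (p.1 0)])

/-- `𝒬(k) = k ∂_z - (z/2) (k' (v ∂_u - u ∂_v) + k'' ∂_w)`. -/
def fieldQ (k : ℝ → ℝ) : Pt → Pt := fun p =>
  (![0, 0, 0, k (p.1 0)],
   (-(p.1 3 / 2)) • ![deriv k (p.1 0) * p.2 1, -(deriv k (p.1 0) * p.2 0),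
     deriv (deriv k) (p.1 0)])

/-- `𝒲(m) = m (v ∂_u - u ∂_v) + m' ∂_w`. -/
def fieldW (m : ℝ → ℝ) : Pt → Pt := fun p =>
  (0, ![m (p.1 0) * p.2 1, -(m (p.1 0) * p.2 0), deriv m (p.1 0)])

/-- The set of times `t` of the points of `U`. -/
def times (U : TopologicalSpace.Opens Pt) : Set ℝ := (fun p : Pt => p.1 0) '' (U : Set Pt)

/-- `V` lies in the span of the three fields `A`, `B`, `C` on `U`. -/
def InSpan (A B C : Pt → Pt) (V : VField U) : Prop :=
  ∃ c₁ c₂ c₃ : ℝ, ∀ p ∈ U, V.1 p = c₁ • A p + c₂ • B p + c₃ • C p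

/-- `V = 𝒴(g) + 𝒵(h) + 𝒬(k) + 𝒲(m)` on `U` for some smooth functions `g, h, k, m` of the time. -/
def InKacMoody (a₁ : ℝ) (V : VField U) : Prop :=
  ∃ g h k m : ℝ → ℝ, ContDiffOn ℝ ∞ g (times U) ∧ ContDiffOn ℝ ∞ h (times U) ∧
    ContDiffOn ℝ ∞ k (times U) ∧ ContDiffOn ℝ ∞ m (times U) ∧
    ∀ p ∈ U, V.1 p = fieldY g p + fieldZ a₁ h p + fieldQ k p + fieldW m p

/-- The commutation relations of the algebra `{𝒴(g), 𝒵(h), 𝒬(k), 𝒲(m)}` over `U`. -/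
def KacMoodyRelations (a₁ : ℝ) (U : TopologicalSpace.Opens Pt) : Prop :=
  ∀ f g : ℝ → ℝ, ContDiffOn ℝ ∞ f (times U) → ContDiffOn ℝ ∞ g (times U) → ∀ p ∈ U,
    VectorField.lieBracket ℝ (fieldY f) (fieldY g) p =
      fieldW (fun t => 1 / 2 * (deriv f t * g t - f t * deriv g t)) p ∧
    VectorField.lieBracket ℝ (fieldZ a₁ f) (fieldZ a₁ g) p =
      fieldW (fun t => 1 / (2 * a₁) * (deriv f t * g t - f t * deriv g t)) p ∧
    VectorField.lieBracket ℝ (fieldQ f) (fieldQ g) p =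
      fieldW (fun t => 1 / 2 * (deriv f t * g t - f t * deriv g t)) p ∧
    VectorField.lieBracket ℝ (fieldY f) (fieldZ a₁ g) p = 0 ∧
    VectorField.lieBracket ℝ (fieldY f) (fieldQ g) p = 0 ∧
    VectorField.lieBracket ℝ (fieldZ a₁ f) (fieldQ g) p = 0 ∧
    VectorField.lieBracket ℝ (fieldY f) (fieldW g) p = 0 ∧
    VectorField.lieBracket ℝ (fieldZ a₁ f) (fieldW g) p = 0 ∧
    VectorField.lieBracket ℝ (fieldQ f) (fieldW g) p = 0 ∧
    VectorField.lieBracket ℝ (fieldW f) (fieldW g) p = 0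

/-- The symmetry generators of the system `Δ` on `U` form an infinite-dimensional Lie algebra that
is the semi-direct sum of the three-dimensional solvable subalgebra spanned by `A`, `B`, `C` and of
the ideal of all `𝒴(g) + 𝒵(h) + 𝒬(k) + 𝒲(m)`, a non-Abelian algebra of Kac--Moody type. -/
def HasSemidirectStructure (Δ : PDESystem) (U : TopologicalSpace.Opens Pt) (a₁ : ℝ)
    (A B C : Pt → Pt) : Prop :=
  (∀ V : VField U, V ∈ symmetryAlgebra Δ U ↔ IsSymmetryGenerator Δ V) ∧
  ¬ FiniteDimensional ℝ (symmetryAlgebra Δ U) ∧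
  ∃ (S : LieSubalgebra ℝ (symmetryAlgebra Δ U)) (N : LieIdeal ℝ (symmetryAlgebra Δ U)),
    (∀ V : symmetryAlgebra Δ U, V ∈ S ↔ InSpan A B C V.1) ∧
    (∀ V : symmetryAlgebra Δ U, V ∈ N ↔ InKacMoody a₁ V.1) ∧
    (∀ V : VField U, InSpan A B C V → V ∈ symmetryAlgebra Δ U) ∧
    (∀ V : VField U, InKacMoody a₁ V → V ∈ symmetryAlgebra Δ U) ∧
    IsCompl S.toSubmodule N.toSubmodule ∧
    Module.finrank ℝ S = 3 ∧ LieAlgebra.IsSolvable S ∧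
    ¬ IsLieAbelian N ∧ KacMoodyRelations a₁ U

/-! ### Point transformations -/

/-- The partial derivative with respect to the `i`-th independent variable. -/
def pd {F : Type*} [NormedAddCommGroup F] [NormedSpace ℝ F] (i : Fin 4) (f : Base → F) :
    Base → F :=
  fun p => fderiv ℝ f p (Pi.single i 1)

/-- `ψ, w` satisfy at the point `p` the modified Davey--Stewartson system. -/
def SatisfiesMDS (a₁ a₂ a₃ b₁ b₂ : ℝ) (ψ : Base → ℂ) (w : Base → ℝ) (p : Base) : Prop :=
  Complex.I * pd 0 ψ p + pd 1 (pd 1 ψ) p + (a₁ : ℂ) * pd 2 (pd 2 ψ) p + pd 3 (pd 3 ψ) p =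
      (a₂ : ℂ) * ((‖ψ p‖ ^ 2 : ℝ) : ℂ) * ψ p + ψ p * (w p : ℂ) + Complex.I * (a₃ : ℂ) * ψ p ∧
  pd 1 (pd 1 w) p + b₁ * pd 2 (pd 2 w) p + pd 3 (pd 3 w) p =
      b₂ * (pd 1 (pd 1 fun q => ‖ψ q‖ ^ 2) p + pd 3 (pd 3 fun q => ‖ψ q‖ ^ 2) p)

/-- The data of a transformation `X = X(t,x,y,z)`, `Y = Y(t,x,y,z)`, `Z = Z(t,x,y,z)`, `T = T(t)`,
`ψ = R e^{iθ} Ψ(T,X,Y,Z)`, `w = P W(T,X,Y,Z) + S`, with real `R, θ, P, S`. -/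
structure Transformation where
  X : Base → ℝ
  Y : Base → ℝ
  Z : Base → ℝ
  T : ℝ → ℝ
  R : Base → ℝ
  θ : Base → ℝ
  P : Base → ℝ
  S : Base → ℝ

namespace Transformation

/-- The new independent variables `(T, X, Y, Z)` at a point. -/
def newVars (τ : Transformation) (p : Base) : Base := ![τ.T (p 0), τ.X p, τ.Y p, τ.Z p]

/-- `ψ = R e^{iθ} Ψ(T,X,Y,Z)`. -/
def psi (τ : Transformation) (Ψ : Base → ℂ) (p : Base) : ℂ :=
  (τ.R p : ℂ) * Complex.exp (Complex.I * (τ.θ p : ℂ)) * Ψ (τ.newVars p)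

/-- `w = P W(T,X,Y,Z) + S`. -/
def w (τ : Transformation) (W : Base → ℝ) (p : Base) : ℝ := τ.P p * W (τ.newVars p) + τ.S p

/-- The transformation is a smooth invertible change of variables over `O` which preserves the
direction of time. -/
structure IsRegularOn (τ : Transformation) (O : Set Base) : Prop where
  smooth_X : ContDiffOn ℝ ∞ τ.X O
  smooth_Y : ContDiffOn ℝ ∞ τ.Y O
  smooth_Z : ContDiffOn ℝ ∞ τ.Z O
  smooth_T : ContDiffOn ℝ ∞ τ.T ((fun p : Base => p 0) '' O)
  smooth_R : ContDiffOn ℝ ∞ τ.R O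
  smooth_θ : ContDiffOn ℝ ∞ τ.θ O
  smooth_P : ContDiffOn ℝ ∞ τ.P O
  smooth_S : ContDiffOn ℝ ∞ τ.S O
  time_direction : ∀ p ∈ O, 0 < deriv τ.T (p 0)
  R_ne_zero : ∀ p ∈ O, τ.R p ≠ 0
  P_ne_zero : ∀ p ∈ O, τ.P p ≠ 0
  injOn : Set.InjOn τ.newVars O
  bijective_fderiv : ∀ p ∈ O, Function.Bijective (fderiv ℝ τ.newVars p)

end Transformation

/-- Over `O`, the modified Davey--Stewartson system for `(ψ, w)` is turned, by a point transformation
of the above form, into the system with the same `a₁, a₂, b₁, b₂` and with `a₃ = 0` for `(Ψ, W)`. -/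
def RemovableOn (a₁ a₂ a₃ b₁ b₂ : ℝ) (O : Set Base) : Prop :=
  ∃ τ : Transformation, τ.IsRegularOn O ∧
    ∀ (Ψ : Base → ℂ) (W : Base → ℝ), ContDiff ℝ ∞ Ψ → ContDiff ℝ ∞ W → ∀ p ∈ O,
      (SatisfiesMDS a₁ a₂ a₃ b₁ b₂ (τ.psi Ψ) (τ.w W) p ↔
        SatisfiesMDS a₁ a₂ 0 b₁ b₂ Ψ W (τ.newVars p))

end DaveyStewartson

end

open DaveyStewartson

/-!
# Symmetry algebras of the modified Davey--Stewartson system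

All the systems are instances of `genSystem`. The symmetry condition is tested on two kinds of jets:
jets with arbitrary mixed second-order entries (`offDiagonal_equations`) and jets concentrated in
one spatial direction (`line_equations`). They yield the determining equations `Determined`: the
coefficients of the base directions do not depend on `u, v, w`, the field acts on `ψ` by
multiplication with `A - iB`, and `A`, `B` and the base coefficients satisfy linear differential
equations. These equations are also sufficient (`isSymmetryGenerator_iff`). On a convex set they
integrate: the generators are the fields `genField` with a constant `c` and functions `τ, g, h, k,
m` of the time, where `τ'' = 4 a₃ τ'` (`Determined.exists_genField`). There is one further
condition, `(2 a₁ + b₁) τ''' = 0`, and it holds automatically when `a₃ = 0` and when `b₁ = -2 a₁`;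
hence in the three cases the algebra is the same family of fields (`classified_genSystem`).

The commutator of two such fields is again such a field, with the parameters `Params.br`
(`lieBracket_field`): `τ` behaves as a vector field on the line, `g, h, k` are densities of
weight `-1/2`, `m` is a function, and the rotation acts on the pair `g, k`.  Since `τ'' = 4 a₃ τ'`
has the two-dimensional space of solutions `α + β b`, with `b = 2 t` or
`b = e^{4 a₃ t} / (2 a₃)`, the parameters `α, β, c` span a solvable complement of the ideal `τ = 0`,
`c = 0` (`Classified.hasSemidirectStructure`).  The substitution `s = T₁ e^{-4 a₃ t} + T₀` in the
parameters takes `τ'' = 0` into `τ'' = 4 a₃ τ'` and preserves `Params.br`, whence the isomorphism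
(`TimeChange.nonempty_lieEquiv`).

For the removal of `a₃`, a point transformation acts on second-order jets, and every jet is that of
a quadratic function (`Transformation.jetEquations_iff`).  The jets of `0`, of constants, of
coordinates and of quadratic forms show that `R² = P = T'`, that the new variables have orthogonal
spatial gradients of length `√T'` and are transported along the gradient of the phase `θ`, and that
`S` is minus the Hamilton--Jacobi expression `θ_t + θ_x² + a₁ θ_y² + θ_z²`.  Consequently the spatial
Hessian of `θ` is `a₃ diag(1, 1/a₁, 1)` (`Transformation.Removes.hessian_phase`), and
`S_xx + b₁ S_yy + S_zz = 0`, which is the condition on the jet of `0`, reads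
`-2 a₃² (2 + b₁ / a₁) = 0` (`Transformation.Removes.b_eq`).  Conversely, for `b₁ = -2 a₁` the
transformation `removing` with these data works (`removableOn_univ`).
-/

noncomputable section

namespace DaveyStewartson

/-! ### Directional derivatives -/

section Directional

variable {E F : Type*} [NormedAddCommGroup E] [NormedSpace ℝ E] [NormedAddCommGroup F]
  [NormedSpace ℝ F]

/-- The derivative of `f` in the direction of the fixed vector `v`, as a function of the point. -/
def dd (v : E) (f : E → F) (p : E) : F := fderiv ℝ f p v

theorem smoothOn_differentiableAt {f : E → F} {O : Set E} (hO : IsOpen O) (hf : ContDiffOn ℝ ∞ f O)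
    {p : E} (hp : p ∈ O) : DifferentiableAt ℝ f p :=
  (hf.contDiffAt (hO.mem_nhds hp)).differentiableAt (by simp)

theorem dd_smoothOn {f : E → F} {O : Set E} (hO : IsOpen O) (hf : ContDiffOn ℝ ∞ f O) (v : E) :
    ContDiffOn ℝ ∞ (dd v f) O :=
  (hf.fderiv_of_isOpen hO (by simp)).clm_apply contDiffOn_const

theorem dd_congr {f g : E → F} {O : Set E} (hO : IsOpen O) (h : ∀ p ∈ O, f p = g p) (v : E) :
    ∀ p ∈ O, dd v f p = dd v g p := fun p hp => by
  have : f =ᶠ[nhds p] g := by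
    filter_upwards [hO.mem_nhds hp] with q hq using h q hq
  rw [dd, dd, this.fderiv_eq]

theorem dd_comm {f : E → F} {O : Set E} (hO : IsOpen O) (hf : ContDiffOn ℝ ∞ f O) (v w : E) :
    ∀ p ∈ O, dd v (dd w f) p = dd w (dd v f) p := fun p hp => by
  have hd : DifferentiableAt ℝ (fderiv ℝ f) p :=
    ((hf.fderiv_of_isOpen hO (m := ∞) (by simp)).contDiffAt (hO.mem_nhds hp)).differentiableAt
      (by simp)
  have key : ∀ v w : E, dd v (dd w f) p = fderiv ℝ (fderiv ℝ f) p v w := fun v w => by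
    have h1 : dd w f = fun q => fderiv ℝ f q w := rfl
    rw [h1, dd, fderiv_clm_apply hd (differentiableAt_const _)]
    simp
  rw [key, key]
  have hs : IsSymmSndFDerivAt ℝ f p :=
    (hf.contDiffAt (hO.mem_nhds hp)).isSymmSndFDerivAt (by
      simp only [minSmoothness_of_isRCLikeNormedField]
      exact ENat.LEInfty.out)
  exact hs.eq v w

@[simp] theorem dd_const (v : E) (c : F) (p : E) : dd v (fun _ => c) p = 0 := by
  simp [dd]

theorem dd_add {v : E} {f g : E → F} {p : E} (hf : DifferentiableAt ℝ f p)
    (hg : DifferentiableAt ℝ g p) : dd v (fun q => f q + g q) p = dd v f p + dd v g p := by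
  simp only [dd, fderiv_fun_add hf hg, add_apply]

theorem dd_sub {v : E} {f g : E → F} {p : E} (hf : DifferentiableAt ℝ f p)
    (hg : DifferentiableAt ℝ g p) : dd v (fun q => f q - g q) p = dd v f p - dd v g p := by
  simp only [dd, fderiv_fun_sub hf hg, sub_apply]

theorem dd_neg {v : E} {f : E → F} {p : E} : dd v (fun q => - f q) p = - dd v f p := by
  simp only [dd, fderiv_fun_neg, neg_apply]

theorem dd_sum {ι : Type*} {s : Finset ι} {v : E} {f : ι → E → F} {p : E}
    (hf : ∀ i ∈ s, DifferentiableAt ℝ (f i) p) :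
    dd v (fun q => ∑ i ∈ s, f i q) p = ∑ i ∈ s, dd v (f i) p := by
  simp only [dd, fderiv_fun_sum hf, sum_apply]

theorem dd_mul {𝔸 : Type*} [NormedCommRing 𝔸] [NormedAlgebra ℝ 𝔸] {v : E} {f g : E → 𝔸} {p : E}
    (hf : DifferentiableAt ℝ f p) (hg : DifferentiableAt ℝ g p) :
    dd v (fun q => f q * g q) p = dd v f p * g p + f p * dd v g p := by
  simp only [dd, fderiv_fun_mul hf hg, add_apply, smul_apply, smul_eq_mul]
  ring

theorem dd_const_mul {𝔸 : Type*} [NormedCommRing 𝔸] [NormedAlgebra ℝ 𝔸] {v : E} {g : E → 𝔸} {p : E}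
    (c : 𝔸) (hg : DifferentiableAt ℝ g p) :
    dd v (fun q => c * g q) p = c * dd v g p := by
  rw [dd_mul (differentiableAt_const _) hg]; simp

/-- The directional derivative is the derivative along the line. -/
theorem dd_eq_of_hasDerivAt {v : E} {f : E → F} {p : E} {d : F} (hf : DifferentiableAt ℝ f p)
    (h : HasDerivAt (fun s : ℝ => f (p + s • v)) d 0) : dd v f p = d := by
  rw [dd, ← hf.lineDeriv_eq_fderiv]
  exact h.deriv

end Directional

/-! ### Total derivatives and prolongations in coordinates -/

/-- The coordinate direction of the `i`-th independent variable. -/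
def eB (i : Fin 4) : Pt := (Pi.single i 1, 0)

/-- The coordinate direction of the `α`-th dependent variable. -/
def eF (α : Fin 3) : Pt := (0, Pi.single α 1)

theorem totalD0_eq (i : Fin 4) (f : Pt → ℝ) (j : Jet1) :
    totalD0 i f j = dd (eB i) f j.1 + ∑ α, j.2 α i * dd (eF α) f j.1 := by
  have h : ((Pi.single i 1, fun α => j.2 α i) : Pt) = eB i + ∑ α, j.2 α i • eF α := by
    refine Prod.ext ?_ ?_
    · simp [eB, eF, Prod.fst_sum]
    · funext β
      fin_cases β <;> simp [eB, eF, Fin.sum_univ_three]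
  rw [totalD0, h, map_add, map_sum]
  simp [dd]

/-- The second total derivative `D_k D_i f` of a function of the variables of order zero. -/
def totalD2 (i k : Fin 4) (f : Pt → ℝ) (j : Jet2) : ℝ :=
  totalD0 k (dd (eB i) f) j.1 +
    ∑ β, (j.2 β i k * dd (eF β) f j.1.1 + j.1.2 β i * totalD0 k (dd (eF β) f) j.1)

theorem totalD1_comp_fst (k : Fin 4) (f : Pt → ℝ) (j : Jet2) (hf : DifferentiableAt ℝ f j.1.1) :
    totalD1 k (fun J => f J.1) j = totalD0 k f j.1 := by
  rw [totalD1, totalD0]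
  have := (hf.hasFDerivAt.comp j.1 (hasFDerivAt_fst (𝕜 := ℝ) (E := Pt)
    (F := Fin 3 → Fin 4 → ℝ) (p := j.1))).fderiv
  simp only [Function.comp_def] at this
  rw [this]
  rfl

theorem totalD1_coord (k : Fin 4) (α : Fin 3) (i : Fin 4) (j : Jet2) :
    totalD1 k (fun J => J.2 α i) j = j.2 α i k := by
  have h : HasFDerivAt (fun J : Jet1 => J.2 α i)
      ((ContinuousLinearMap.proj i).comp ((ContinuousLinearMap.proj α).comp
        (ContinuousLinearMap.snd ℝ Pt (Fin 3 → Fin 4 → ℝ)))) j.1 :=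
    ContinuousLinearMap.hasFDerivAt
      ((ContinuousLinearMap.proj (R := ℝ) (φ := fun _ : Fin 4 => ℝ) i).comp
        ((ContinuousLinearMap.proj (R := ℝ) (φ := fun _ : Fin 3 => Fin 4 → ℝ) α).comp
          (ContinuousLinearMap.snd ℝ Pt (Fin 3 → Fin 4 → ℝ))))
  rw [totalD1, h.fderiv]
  rfl

theorem totalD1_totalD0 (i k : Fin 4) {f : Pt → ℝ} {O : Set Pt} (hO : IsOpen O)
    (hf : ContDiffOn ℝ ∞ f O) (j : Jet2) (hj : j.1.1 ∈ O) :
    totalD1 k (totalD0 i f) j = totalD2 i k f j ∧ DifferentiableAt ℝ (totalD0 i f) j.1 := by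
  have hc : ∀ g : Pt → ℝ, DifferentiableAt ℝ g j.1.1 →
      DifferentiableAt ℝ (fun J : Jet1 => g J.1) j.1 := fun g hg =>
    hg.comp j.1 differentiableAt_fst
  have hd : ∀ v, DifferentiableAt ℝ (dd v f) j.1.1 := fun v =>
    smoothOn_differentiableAt hO (dd_smoothOn hO hf v) hj
  have hu : ∀ α i, DifferentiableAt ℝ (fun J : Jet1 => J.2 α i) j.1 := fun α i => by fun_prop
  have h : totalD0 i f = fun J : Jet1 => dd (eB i) f J.1 + ∑ α, J.2 α i * dd (eF α) f J.1 :=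
    funext fun J => totalD0_eq i f J
  have hs : DifferentiableAt ℝ (fun J : Jet1 => ∑ α, J.2 α i * dd (eF α) f J.1) j.1 :=
    DifferentiableAt.fun_sum fun α _ => (hu α i).mul (hc _ (hd _))
  constructor
  · rw [h]
    change dd _ _ _ = _
    rw [dd_add (hc _ (hd _)) hs, dd_sum fun α _ => (hu α i).fun_mul (hc _ (hd _)), totalD2]
    refine congrArg₂ (· + ·) (totalD1_comp_fst k _ j (hd _)) (Finset.sum_congr rfl fun β _ => ?_)
    rw [dd_mul (hu β i) (hc _ (hd _))]
    exact congrArg₂ (· + ·) (congrArg (· * _) (totalD1_coord k β i j))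
      (congrArg (_ * ·) (totalD1_comp_fst k _ j (hd _)))
  · rw [h]
    exact (hc _ (hd _)).add hs

/-- The coefficient of `∂/∂u^α_{ik}` of the second prolongation, in terms of total derivatives. -/
theorem prol2_eq {V : Pt → Pt} {O : Set Pt} (hO : IsOpen O) (hV : ContDiffOn ℝ ∞ V O) (α : Fin 3)
    (i k : Fin 4) (j : Jet2) (hj : j.1.1 ∈ O) :
    prol2 V α i k j = totalD2 i k (fun p => (V p).2 α) j
      - ∑ l, (totalD2 i k (fun p => (V p).1 l) j * j.1.2 α l
        + totalD0 i (fun p => (V p).1 l) j.1 * j.2 α l k)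
      - ∑ l, totalD0 k (fun p => (V p).1 l) j.1 * j.2 α i l := by
  have h2 : ∀ α, ContDiffOn ℝ ∞ (fun p => (V p).2 α) O := fun α =>
    contDiffOn_pi.1 (contDiff_snd.comp_contDiffOn hV) α
  have h1 : ∀ l, ContDiffOn ℝ ∞ (fun p => (V p).1 l) O := fun l =>
    contDiffOn_pi.1 (contDiff_fst.comp_contDiffOn hV) l
  have hu : ∀ α i, DifferentiableAt ℝ (fun J : Jet1 => J.2 α i) j.1 := fun α i => by fun_prop
  rw [prol2]
  congr 1
  have hd := (totalD1_totalD0 i k hO (h2 α) j hj)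
  have hd' := fun l => (totalD1_totalD0 i k hO (h1 l) j hj)
  have h : prol1 V α i = fun J => totalD0 i (fun p => (V p).2 α) J
      - ∑ l, totalD0 i (fun p => (V p).1 l) J * J.2 α l := rfl
  rw [h]
  change dd _ _ _ = _
  rw [dd_sub hd.2 (DifferentiableAt.fun_sum fun l _ => (hd' l).2.fun_mul (hu α l)),
    dd_sum fun l _ => (hd' l).2.fun_mul (hu α l)]
  refine congrArg₂ (· - ·) hd.1 (Finset.sum_congr rfl fun l _ => ?_)
  rw [dd_mul (hd' l).2 (hu α l)]
  exact congrArg₂ (· + ·) (congrArg (· * _) (hd' l).1) (congrArg (_ * ·) (totalD1_coord k α l j))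

/-! ### The two systems as instances of one -/

/-- The system whose first two equations are the Schrödinger equation of the Davey--Stewartson
systems and whose third equation is
`w_xx + b₁ w_yy + w_zz = r₁ ((|ψ|²)_xx + (|ψ|²)_zz) + r₂ (|ψ|²)_yy`. -/
def genSystem (a₁ a₂ a₃ b₁ r₁ r₂ : ℝ) : PDESystem :=
  ![schrodingerIm a₁ a₂ a₃, schrodingerRe a₁ a₂ a₃,
    fun j => lap b₁ 2 j - r₁ * rho2 1 j - r₂ * rho2 2 j - r₁ * rho2 3 j]

theorem mdsSystem_eq (a₁ a₂ a₃ b₁ b₂ : ℝ) :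
    mdsSystem a₁ a₂ a₃ b₁ b₂ = genSystem a₁ a₂ a₃ b₁ b₂ 0 := by
  simp [mdsSystem, genSystem]

theorem dsSystem_eq (a₁ a₂ b₁ b₂ : ℝ) :
    dsSystem a₁ a₂ b₁ b₂ = genSystem a₁ a₂ 0 b₁ 0 b₂ := by
  simp [dsSystem, genSystem]

theorem schrodingerIm_deriv (a₁ a₂ a₃ : ℝ) (j k : Jet2) :
    fderiv ℝ (schrodingerIm a₁ a₂ a₃) j k = k.1.2 0 0 + lap a₁ 1 k
      - a₂ * (k.1.1.2 1 * (j.1.1.2 0 ^ 2 + j.1.1.2 1 ^ 2)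
        + 2 * j.1.1.2 1 * (j.1.1.2 0 * k.1.1.2 0 + j.1.1.2 1 * k.1.1.2 1))
      - (k.1.1.2 1 * j.1.1.2 2 + j.1.1.2 1 * k.1.1.2 2) - a₃ * k.1.1.2 0 := by
  refine dd_eq_of_hasDerivAt (by unfold schrodingerIm lap; fun_prop) ?_
  have e : (fun s : ℝ => schrodingerIm a₁ a₂ a₃ (j + s • k)) = fun s : ℝ =>
      (j.1.2 0 0 + s * k.1.2 0 0) + ((j.2 1 1 1 + s * k.2 1 1 1) + a₁ * (j.2 1 2 2 + s * k.2 1 2 2)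
        + (j.2 1 3 3 + s * k.2 1 3 3)) - a₂ * (j.1.1.2 1 + s * k.1.1.2 1) *
        ((j.1.1.2 0 + s * k.1.1.2 0) ^ 2 + (j.1.1.2 1 + s * k.1.1.2 1) ^ 2)
        - (j.1.1.2 1 + s * k.1.1.2 1) * (j.1.1.2 2 + s * k.1.1.2 2)
        - a₃ * (j.1.1.2 0 + s * k.1.1.2 0) := by
    funext s; simp [schrodingerIm, lap]
  rw [e]
  have L : ∀ a b : ℝ, HasDerivAt (fun s : ℝ => a + s * b) b 0 := fun a b => by
    simpa using ((hasDerivAt_id (0 : ℝ)).mul_const b).const_add a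
  refine (((((L _ _).add (((L _ _).add ((L _ _).const_mul a₁)).add (L _ _))).sub
    (((L _ _).const_mul a₂).mul (((L _ _).pow 2).add ((L _ _).pow 2)))).sub
    ((L _ _).mul (L _ _))).sub ((L _ _).const_mul a₃)).congr_deriv ?_
  simp [lap]; ring

theorem schrodingerRe_deriv (a₁ a₂ a₃ : ℝ) (j k : Jet2) :
    fderiv ℝ (schrodingerRe a₁ a₂ a₃) j k = lap a₁ 0 k - k.1.2 1 0
      - a₂ * (k.1.1.2 0 * (j.1.1.2 0 ^ 2 + j.1.1.2 1 ^ 2)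
        + 2 * j.1.1.2 0 * (j.1.1.2 0 * k.1.1.2 0 + j.1.1.2 1 * k.1.1.2 1))
      - (k.1.1.2 0 * j.1.1.2 2 + j.1.1.2 0 * k.1.1.2 2) + a₃ * k.1.1.2 1 := by
  refine dd_eq_of_hasDerivAt (by unfold schrodingerRe lap; fun_prop) ?_
  have e : (fun s : ℝ => schrodingerRe a₁ a₂ a₃ (j + s • k)) = fun s : ℝ =>
      ((j.2 0 1 1 + s * k.2 0 1 1) + a₁ * (j.2 0 2 2 + s * k.2 0 2 2)
        + (j.2 0 3 3 + s * k.2 0 3 3)) - (j.1.2 1 0 + s * k.1.2 1 0)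
        - a₂ * (j.1.1.2 0 + s * k.1.1.2 0) *
        ((j.1.1.2 0 + s * k.1.1.2 0) ^ 2 + (j.1.1.2 1 + s * k.1.1.2 1) ^ 2)
        - (j.1.1.2 0 + s * k.1.1.2 0) * (j.1.1.2 2 + s * k.1.1.2 2)
        + a₃ * (j.1.1.2 1 + s * k.1.1.2 1) := by
    funext s; simp [schrodingerRe, lap]
  rw [e]
  have L : ∀ a b : ℝ, HasDerivAt (fun s : ℝ => a + s * b) b 0 := fun a b => by
    simpa using ((hasDerivAt_id (0 : ℝ)).mul_const b).const_add a
  refine ((((((L _ _).add ((L _ _).const_mul a₁)).add (L _ _)).sub (L _ _)).sub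
    (((L _ _).const_mul a₂).mul (((L _ _).pow 2).add ((L _ _).pow 2)))).sub
    ((L _ _).mul (L _ _))).add ((L _ _).const_mul a₃) |>.congr_deriv ?_
  simp [lap]; ring

theorem rho2_deriv (i : Fin 4) (j k : Jet2) :
    DifferentiableAt ℝ (rho2 i) j ∧
    fderiv ℝ (rho2 i) j k = 2 * (2 * j.1.2 0 i * k.1.2 0 i + k.1.1.2 0 * j.2 0 i i
      + j.1.1.2 0 * k.2 0 i i + 2 * j.1.2 1 i * k.1.2 1 i + k.1.1.2 1 * j.2 1 i i
      + j.1.1.2 1 * k.2 1 i i) := by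
  have hd : DifferentiableAt ℝ (rho2 i) j := by unfold rho2; fun_prop
  refine ⟨hd, dd_eq_of_hasDerivAt hd ?_⟩
  have e : (fun s : ℝ => rho2 i (j + s • k)) = fun s : ℝ =>
      2 * ((j.1.2 0 i + s * k.1.2 0 i) ^ 2 + (j.1.1.2 0 + s * k.1.1.2 0) *
        (j.2 0 i i + s * k.2 0 i i) + (j.1.2 1 i + s * k.1.2 1 i) ^ 2
        + (j.1.1.2 1 + s * k.1.1.2 1) * (j.2 1 i i + s * k.2 1 i i)) := by
    funext s; simp [rho2]
  rw [e]
  have L : ∀ a b : ℝ, HasDerivAt (fun s : ℝ => a + s * b) b 0 := fun a b => by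
    simpa using ((hasDerivAt_id (0 : ℝ)).mul_const b).const_add a
  refine (((((L _ _).pow 2).add ((L _ _).mul (L _ _))).add ((L _ _).pow 2)).add
    ((L _ _).mul (L _ _))).const_mul 2 |>.congr_deriv ?_
  simp; ring

theorem thirdEquation_deriv (b₁ r₁ r₂ : ℝ) (j k : Jet2) :
    fderiv ℝ (fun j => lap b₁ 2 j - r₁ * rho2 1 j - r₂ * rho2 2 j - r₁ * rho2 3 j) j k =
      lap b₁ 2 k - r₁ * fderiv ℝ (rho2 1) j k - r₂ * fderiv ℝ (rho2 2) j k
        - r₁ * fderiv ℝ (rho2 3) j k := by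
  have hr := fun i => (rho2_deriv i j k).1
  have hl : HasFDerivAt (lap b₁ 2) (fderiv ℝ (lap b₁ 2) j) j :=
    DifferentiableAt.hasFDerivAt (by unfold lap; fun_prop)
  have hl' : fderiv ℝ (lap b₁ 2) j k = lap b₁ 2 k := by
    refine dd_eq_of_hasDerivAt (by unfold lap; fun_prop) ?_
    have e : (fun s : ℝ => lap b₁ 2 (j + s • k)) = fun s : ℝ => lap b₁ 2 j + s * lap b₁ 2 k := by
      funext s; simp [lap]; ring
    rw [e]
    simpa using ((hasDerivAt_id (0 : ℝ)).mul_const (lap b₁ 2 k)).const_add (lap b₁ 2 j)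
  rw [(((hl.fun_sub ((hr 1).hasFDerivAt.const_mul r₁)).fun_sub
    ((hr 2).hasFDerivAt.const_mul r₂)).fun_sub ((hr 3).hasFDerivAt.const_mul r₁)).fderiv]
  simp [hl']

/-! ### Consequences of the symmetry condition: shape of the coefficients of the base directions -/

/-- The coefficient of a vector field along the `l`-th independent variable. -/
def sg (V : Pt → Pt) (l : Fin 4) (p : Pt) : ℝ := (V p).1 l

/-- The coefficient of a vector field along the `α`-th dependent variable. -/
def ph (V : Pt → Pt) (α : Fin 3) (p : Pt) : ℝ := (V p).2 α

theorem sg_smooth {V : Pt → Pt} {O : Set Pt} (hV : ContDiffOn ℝ ∞ V O) (l : Fin 4) :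
    ContDiffOn ℝ ∞ (sg V l) O :=
  contDiffOn_pi.1 (contDiff_fst.comp_contDiffOn hV) l

theorem ph_smooth {V : Pt → Pt} {O : Set Pt} (hV : ContDiffOn ℝ ∞ V O) (α : Fin 3) :
    ContDiffOn ℝ ∞ (ph V α) O :=
  contDiffOn_pi.1 (contDiff_snd.comp_contDiffOn hV) α

theorem prol2_diag {V : Pt → Pt} {O : Set Pt} (hO : IsOpen O) (hV : ContDiffOn ℝ ∞ V O) (α : Fin 3)
    (i : Fin 4) (j : Jet2) (hj : j.1.1 ∈ O) (hs : ∀ α i k, j.2 α i k = j.2 α k i) :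
    prol2 V α i i j = totalD2 i i (ph V α) j
      - ∑ l, (totalD2 i i (sg V l) j * j.1.2 α l
        + 2 * (totalD0 i (sg V l) j.1 * j.2 α i l)) := by
  rw [prol2_eq hO hV α i i j hj, sub_sub, ← Finset.sum_add_distrib]
  refine congrArg₂ (· - ·) rfl (Finset.sum_congr rfl fun l _ => ?_)
  rw [hs α l i]
  change totalD2 i i (sg V l) j * _ + totalD0 i (sg V l) j.1 * _ +
    totalD0 i (sg V l) j.1 * _ = _
  ring

/-- The symmetry condition, written out for the three equations of `genSystem`. -/
theorem symmetry_equations {a₁ a₂ a₃ b₁ r₁ r₂ : ℝ} (V : Pt → Pt) (j : Jet2)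
    (h : ∀ i, fderiv ℝ (genSystem a₁ a₂ a₃ b₁ r₁ r₂ i) j (pr2 V j) = 0) :
    (prol1 V 0 0 j.1 + (prol2 V 1 1 1 j + a₁ * prol2 V 1 2 2 j + prol2 V 1 3 3 j)
      - a₂ * (ph V 1 j.1.1 * (j.1.1.2 0 ^ 2 + j.1.1.2 1 ^ 2)
        + 2 * j.1.1.2 1 * (j.1.1.2 0 * ph V 0 j.1.1 + j.1.1.2 1 * ph V 1 j.1.1))
      - (ph V 1 j.1.1 * j.1.1.2 2 + j.1.1.2 1 * ph V 2 j.1.1) - a₃ * ph V 0 j.1.1 = 0) ∧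
    ((prol2 V 0 1 1 j + a₁ * prol2 V 0 2 2 j + prol2 V 0 3 3 j) - prol1 V 1 0 j.1
      - a₂ * (ph V 0 j.1.1 * (j.1.1.2 0 ^ 2 + j.1.1.2 1 ^ 2)
        + 2 * j.1.1.2 0 * (j.1.1.2 0 * ph V 0 j.1.1 + j.1.1.2 1 * ph V 1 j.1.1))
      - (ph V 0 j.1.1 * j.1.1.2 2 + j.1.1.2 0 * ph V 2 j.1.1) + a₃ * ph V 1 j.1.1 = 0) ∧
    ((prol2 V 2 1 1 j + b₁ * prol2 V 2 2 2 j + prol2 V 2 3 3 j)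
      - r₁ * (2 * (2 * j.1.2 0 1 * prol1 V 0 1 j.1 + ph V 0 j.1.1 * j.2 0 1 1
        + j.1.1.2 0 * prol2 V 0 1 1 j + 2 * j.1.2 1 1 * prol1 V 1 1 j.1 + ph V 1 j.1.1 * j.2 1 1 1
        + j.1.1.2 1 * prol2 V 1 1 1 j))
      - r₂ * (2 * (2 * j.1.2 0 2 * prol1 V 0 2 j.1 + ph V 0 j.1.1 * j.2 0 2 2
        + j.1.1.2 0 * prol2 V 0 2 2 j + 2 * j.1.2 1 2 * prol1 V 1 2 j.1 + ph V 1 j.1.1 * j.2 1 2 2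
        + j.1.1.2 1 * prol2 V 1 2 2 j))
      - r₁ * (2 * (2 * j.1.2 0 3 * prol1 V 0 3 j.1 + ph V 0 j.1.1 * j.2 0 3 3
        + j.1.1.2 0 * prol2 V 0 3 3 j + 2 * j.1.2 1 3 * prol1 V 1 3 j.1 + ph V 1 j.1.1 * j.2 1 3 3
        + j.1.1.2 1 * prol2 V 1 3 3 j)) = 0) := by
  refine ⟨?_, ?_, ?_⟩
  · rw [← h 0]
    exact (schrodingerIm_deriv a₁ a₂ a₃ j (pr2 V j)).symm
  · rw [← h 1]
    exact (schrodingerRe_deriv a₁ a₂ a₃ j (pr2 V j)).symm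
  · rw [← h 2]
    refine Eq.trans ?_ (thirdEquation_deriv b₁ r₁ r₂ j (pr2 V j)).symm
    rw [(rho2_deriv 1 _ _).2, (rho2_deriv 2 _ _).2, (rho2_deriv 3 _ _).2]
    rfl

/-- Converse of `symmetry_equations`. -/
theorem symmetry_of_equations {a₁ a₂ a₃ b₁ r₁ r₂ : ℝ} (V : Pt → Pt) (j : Jet2)
    (h1 : prol1 V 0 0 j.1 + (prol2 V 1 1 1 j + a₁ * prol2 V 1 2 2 j + prol2 V 1 3 3 j)
      - a₂ * (ph V 1 j.1.1 * (j.1.1.2 0 ^ 2 + j.1.1.2 1 ^ 2)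
        + 2 * j.1.1.2 1 * (j.1.1.2 0 * ph V 0 j.1.1 + j.1.1.2 1 * ph V 1 j.1.1))
      - (ph V 1 j.1.1 * j.1.1.2 2 + j.1.1.2 1 * ph V 2 j.1.1) - a₃ * ph V 0 j.1.1 = 0)
    (h2 : (prol2 V 0 1 1 j + a₁ * prol2 V 0 2 2 j + prol2 V 0 3 3 j) - prol1 V 1 0 j.1
      - a₂ * (ph V 0 j.1.1 * (j.1.1.2 0 ^ 2 + j.1.1.2 1 ^ 2)
        + 2 * j.1.1.2 0 * (j.1.1.2 0 * ph V 0 j.1.1 + j.1.1.2 1 * ph V 1 j.1.1))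
      - (ph V 0 j.1.1 * j.1.1.2 2 + j.1.1.2 0 * ph V 2 j.1.1) + a₃ * ph V 1 j.1.1 = 0)
    (h3 : (prol2 V 2 1 1 j + b₁ * prol2 V 2 2 2 j + prol2 V 2 3 3 j)
      - r₁ * (2 * (2 * j.1.2 0 1 * prol1 V 0 1 j.1 + ph V 0 j.1.1 * j.2 0 1 1
        + j.1.1.2 0 * prol2 V 0 1 1 j + 2 * j.1.2 1 1 * prol1 V 1 1 j.1 + ph V 1 j.1.1 * j.2 1 1 1
        + j.1.1.2 1 * prol2 V 1 1 1 j))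
      - r₂ * (2 * (2 * j.1.2 0 2 * prol1 V 0 2 j.1 + ph V 0 j.1.1 * j.2 0 2 2
        + j.1.1.2 0 * prol2 V 0 2 2 j + 2 * j.1.2 1 2 * prol1 V 1 2 j.1 + ph V 1 j.1.1 * j.2 1 2 2
        + j.1.1.2 1 * prol2 V 1 2 2 j))
      - r₁ * (2 * (2 * j.1.2 0 3 * prol1 V 0 3 j.1 + ph V 0 j.1.1 * j.2 0 3 3
        + j.1.1.2 0 * prol2 V 0 3 3 j + 2 * j.1.2 1 3 * prol1 V 1 3 j.1 + ph V 1 j.1.1 * j.2 1 3 3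
        + j.1.1.2 1 * prol2 V 1 3 3 j)) = 0) :
    ∀ i, fderiv ℝ (genSystem a₁ a₂ a₃ b₁ r₁ r₂ i) j (pr2 V j) = 0 := by
  intro i
  fin_cases i
  · exact (schrodingerIm_deriv a₁ a₂ a₃ j (pr2 V j)).trans h1
  · exact (schrodingerRe_deriv a₁ a₂ a₃ j (pr2 V j)).trans h2
  · refine (thirdEquation_deriv b₁ r₁ r₂ j (pr2 V j)).trans (Eq.trans ?_ h3)
    rw [(rho2_deriv 1 _ _).2, (rho2_deriv 2 _ _).2, (rho2_deriv 3 _ _).2]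
    rfl

/-- Over every point, the spatial first-order entries of a jet on the solution variety are
arbitrary. -/
theorem exists_jet_on_variety (a₁ a₂ a₃ b₁ r₁ r₂ : ℝ) (p : Pt) (a : Fin 3 → Fin 4 → ℝ) :
    ∃ j : Jet2, j.1.1 = p ∧ (∀ α l, l ≠ 0 → j.1.2 α l = a α l) ∧
      (∀ α i k, j.2 α i k = j.2 α k i) ∧ ∀ i, genSystem a₁ a₂ a₃ b₁ r₁ r₂ i j = 0 := by
  refine ⟨((p, fun α l => if l = 0 then
      ![a₂ * p.2 1 * (p.2 0 ^ 2 + p.2 1 ^ 2) + p.2 1 * p.2 2 + a₃ * p.2 0,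
        - a₂ * p.2 0 * (p.2 0 ^ 2 + p.2 1 ^ 2) - p.2 0 * p.2 2 + a₃ * p.2 1, 0] α else a α l),
    fun α l m => if α = 2 ∧ l = 1 ∧ m = 1 then
      2 * (r₁ * (a 0 1 ^ 2 + a 1 1 ^ 2) + r₂ * (a 0 2 ^ 2 + a 1 2 ^ 2)
        + r₁ * (a 0 3 ^ 2 + a 1 3 ^ 2)) else 0), rfl, ?_, ?_, ?_⟩
  · intro α l hl
    simp [hl]
  · intro α i k
    simp only [and_comm (a := i = 1)]
  · intro i
    fin_cases i
    · simp [genSystem, schrodingerIm, lap]; ring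
    · simp [genSystem, schrodingerRe, lap]; ring
    · simp [genSystem, rho2, lap]; ring

theorem prol2_add_offDiagonal {V : Pt → Pt} {O : Set Pt} (hO : IsOpen O) (hV : ContDiffOn ℝ ∞ V O)
    (α : Fin 3) (i : Fin 4) (j : Jet2) (hj : j.1.1 ∈ O) (hs : ∀ α i k, j.2 α i k = j.2 α k i)
    (κ : Fin 3 → Fin 4 → Fin 4 → ℝ) (hκ : ∀ α i k, κ α i k = κ α k i) (hκ0 : ∀ α i, κ α i i = 0) :
    prol2 V α i i (j.1, j.2 + κ) =
      prol2 V α i i j - 2 * ∑ l, totalD0 i (sg V l) j.1 * κ α i l := by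
  rw [prol2_diag hO hV α i (j.1, j.2 + κ) hj (fun α i k => by simp [hs α i k, hκ α i k]),
    prol2_diag hO hV α i j hj hs]
  have h2 : ∀ f : Pt → ℝ, totalD2 i i f (j.1, j.2 + κ) = totalD2 i i f j := fun f => by
    simp [totalD2, hκ0]
  simp only [h2, Pi.add_apply]
  rw [Finset.mul_sum, sub_sub, ← Finset.sum_add_distrib]
  refine congrArg₂ (· - ·) rfl (Finset.sum_congr rfl fun l _ => ?_)
  ring

variable {U : TopologicalSpace.Opens Pt} {a₁ a₂ a₃ b₁ r₁ r₂ : ℝ}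

/-- The part of the symmetry condition which is linear in the mixed second-order entries.  The
equations of the system do not contain these entries, so that adding them keeps a jet on the solution
variety. -/
theorem offDiagonal_equations (V : VField U)
    (hV : IsSymmetryGenerator (genSystem a₁ a₂ a₃ b₁ r₁ r₂) V) {p : Pt} (hp : p ∈ U)
    (a : Fin 3 → Fin 4 → ℝ)
    (κ : Fin 3 → Fin 4 → Fin 4 → ℝ) (hκ : ∀ α i k, κ α i k = κ α k i) (hκ0 : ∀ α i, κ α i i = 0) :
    (∑ l, totalD0 1 (sg V.1 l) (p, a) * κ 1 1 l + a₁ * ∑ l, totalD0 2 (sg V.1 l) (p, a) * κ 1 2 l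
      + ∑ l, totalD0 3 (sg V.1 l) (p, a) * κ 1 3 l = 0) ∧
    (∑ l, totalD0 1 (sg V.1 l) (p, a) * κ 2 1 l + b₁ * ∑ l, totalD0 2 (sg V.1 l) (p, a) * κ 2 2 l
      + ∑ l, totalD0 3 (sg V.1 l) (p, a) * κ 2 3 l
      - r₁ * (2 * (p.2 0 * ∑ l, totalD0 1 (sg V.1 l) (p, a) * κ 0 1 l
        + p.2 1 * ∑ l, totalD0 1 (sg V.1 l) (p, a) * κ 1 1 l))
      - r₂ * (2 * (p.2 0 * ∑ l, totalD0 2 (sg V.1 l) (p, a) * κ 0 2 l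
        + p.2 1 * ∑ l, totalD0 2 (sg V.1 l) (p, a) * κ 1 2 l))
      - r₁ * (2 * (p.2 0 * ∑ l, totalD0 3 (sg V.1 l) (p, a) * κ 0 3 l
        + p.2 1 * ∑ l, totalD0 3 (sg V.1 l) (p, a) * κ 1 3 l)) = 0) := by
  obtain ⟨j, rfl, ha, hs, hj⟩ := exists_jet_on_variety a₁ a₂ a₃ b₁ r₁ r₂ p a
  have hD : ∀ i : Fin 4, i ≠ 0 → ∀ f, totalD0 i f (j.1.1, a) = totalD0 i f j.1 := by
    intro i hi f
    simp only [totalD0_eq, ha _ i hi]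
  simp only [hD 1 (by decide), hD 2 (by decide), hD 3 (by decide)]
  have hj' : ∀ i, genSystem a₁ a₂ a₃ b₁ r₁ r₂ i (j.1, j.2 + κ) = 0 := by
    intro i
    rw [← hj i]
    fin_cases i <;>
      simp [genSystem, schrodingerIm, schrodingerRe, rho2, lap, hκ0]
  -- the difference of the conditions on the two jets is linear in `κ`
  have e := symmetry_equations V.1 j (hV j hp hs hj)
  have e' := symmetry_equations V.1 (j.1, j.2 + κ)
    (hV (j.1, j.2 + κ) hp (fun α i k => by simp [hs α i k, hκ α i k]) hj')
  simp only [prol2_add_offDiagonal U.isOpen V.2.1 _ _ j hp hs κ hκ hκ0, Pi.add_apply, hκ0,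
    add_zero] at e'
  constructor
  · linear_combination (e.1 - e'.1) / 2
  · linear_combination (e.2.2 - e'.2.2) / 2

/-- The symmetric array of second-order entries whose only nonzero entries are those of `u^α_{ik}`
and `u^α_{ki}`. -/
def mixedEntry (α : Fin 3) (i k : Fin 4) : Fin 3 → Fin 4 → Fin 4 → ℝ :=
  fun β m n => if β = α ∧ ((m = i ∧ n = k) ∨ (m = k ∧ n = i)) then 1 else 0

theorem mixedEntry_symm (α : Fin 3) (i k : Fin 4) (β : Fin 3) (m n : Fin 4) :
    mixedEntry α i k β m n = mixedEntry α i k β n m := by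
  unfold mixedEntry
  refine if_congr ?_ rfl rfl
  tauto

theorem mixedEntry_diag (α : Fin 3) {i k : Fin 4} (h : i ≠ k) (β : Fin 3) (m : Fin 4) :
    mixedEntry α i k β m m = 0 := by
  unfold mixedEntry
  refine if_neg ?_
  rintro ⟨_, ⟨h1, h2⟩ | ⟨h1, h2⟩⟩
  · exact h (h1.symm.trans h2)
  · exact h (h2.symm.trans h1)

/-- The total derivatives of the base coefficients satisfy the equations of conformal Killing fields
of the spatial metric off the diagonal, and `σ_t` is annihilated by the spatial ones. -/
theorem totalD0_sg (ha₁ : a₁ ≠ 0) (V : VField U)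
    (hV : IsSymmetryGenerator (genSystem a₁ a₂ a₃ b₁ r₁ r₂) V) {p : Pt} (hp : p ∈ U)
    (a : Fin 3 → Fin 4 → ℝ) :
    (totalD0 1 (sg V.1 0) (p, a) = 0 ∧ totalD0 2 (sg V.1 0) (p, a) = 0 ∧
      totalD0 3 (sg V.1 0) (p, a) = 0) ∧
    totalD0 1 (sg V.1 2) (p, a) + a₁ * totalD0 2 (sg V.1 1) (p, a) = 0 ∧
    totalD0 1 (sg V.1 3) (p, a) + totalD0 3 (sg V.1 1) (p, a) = 0 ∧
    a₁ * totalD0 2 (sg V.1 3) (p, a) + totalD0 3 (sg V.1 2) (p, a) = 0 := by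
  have key := fun {i k : Fin 4} (h : i ≠ k) => (offDiagonal_equations V hV hp a (mixedEntry 1 i k)
    (mixedEntry_symm 1 i k) (mixedEntry_diag 1 h)).1
  have h10 := key (i := 1) (k := 0) (by decide)
  have h20 := key (i := 2) (k := 0) (by decide)
  have h30 := key (i := 3) (k := 0) (by decide)
  have h12 := key (i := 1) (k := 2) (by decide)
  have h13 := key (i := 1) (k := 3) (by decide)
  have h23 := key (i := 2) (k := 3) (by decide)
  simp [mixedEntry, ha₁] at h10 h20 h30 h12 h13 h23
  exact ⟨⟨h10, h20, h30⟩, h12, h13, h23⟩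

theorem totalD0_zero (i : Fin 4) (f : Pt → ℝ) (p : Pt) :
    totalD0 i f (p, 0) = dd (eB i) f p := by
  simp [totalD0_eq]

theorem totalD0_single (i k : Fin 4) (β : Fin 3) (f : Pt → ℝ) (p : Pt) :
    totalD0 i f (p, fun α l => if α = β ∧ l = k then 1 else 0) =
      dd (eB i) f p + if i = k then dd (eF β) f p else 0 := by
  rw [totalD0_eq]
  by_cases h : i = k <;> simp [h]

/-- The coefficients of the base directions do not depend on `u, v, w`, and `σ_t` only depends
on `t`. -/
theorem sg_independent (ha₁ : a₁ ≠ 0) (V : VField U)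
    (hV : IsSymmetryGenerator (genSystem a₁ a₂ a₃ b₁ r₁ r₂) V) :
    (∀ l α, ∀ p ∈ U, dd (eF α) (sg V.1 l) p = 0) ∧
    (∀ i, i ≠ 0 → ∀ p ∈ U, dd (eB i) (sg V.1 0) p = 0) ∧
    (∀ p ∈ U, dd (eB 1) (sg V.1 2) p + a₁ * dd (eB 2) (sg V.1 1) p = 0) ∧
    (∀ p ∈ U, dd (eB 1) (sg V.1 3) p + dd (eB 3) (sg V.1 1) p = 0) ∧
    (∀ p ∈ U, a₁ * dd (eB 2) (sg V.1 3) p + dd (eB 3) (sg V.1 2) p = 0) := by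
  -- total derivatives are affine in the first-order entries, whose coefficients vanish separately
  have h0 := fun {p : Pt} (hp : p ∈ U) => totalD0_sg ha₁ V hV hp 0
  have h1 := fun {p : Pt} (hp : p ∈ U) (β : Fin 3) (k : Fin 4) =>
    totalD0_sg ha₁ V hV hp (fun α l => if α = β ∧ l = k then 1 else 0)
  simp only [totalD0_zero] at h0
  simp only [totalD0_single] at h1
  refine ⟨fun l α p hp => ?_, fun i hi p hp => ?_, fun p hp => (h0 hp).2.1,
    fun p hp => (h0 hp).2.2.1, fun p hp => (h0 hp).2.2.2⟩
  · obtain ⟨⟨z1, z2, z3⟩, z4, z5, z6⟩ := h0 hp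
    obtain ⟨⟨x1, -, -⟩, x4, x5, -⟩ := h1 hp α 1
    obtain ⟨-, y4, -, -⟩ := h1 hp α 2
    simp at x1 x4 x5 y4
    fin_cases l
    · change dd (eF α) (sg V.1 0) p = 0
      linarith
    · change dd (eF α) (sg V.1 1) p = 0
      refine (mul_eq_zero.1 (?_ : a₁ * _ = 0)).resolve_left ha₁
      linear_combination y4 - z4
    · change dd (eF α) (sg V.1 2) p = 0
      linear_combination x4 - z4
    · change dd (eF α) (sg V.1 3) p = 0
      linear_combination x5 - z5
  · obtain ⟨⟨z1, z2, z3⟩, -⟩ := h0 hp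
    fin_cases i
    · exact absurd rfl hi
    · exact z1
    · exact z2
    · exact z3

/-- A continuous function on `U` that vanishes where `u ≠ 0` vanishes identically. -/
theorem eq_zero_of_eq_zero_off_axis {f : Pt → ℝ} (hf : ContinuousOn f (U : Set Pt))
    (h : ∀ p ∈ U, p.2 0 ≠ 0 → f p = 0) : ∀ p ∈ U, f p = 0 := by
  intro p hp
  by_cases hu : p.2 0 = 0
  · have hc : ContinuousAt f p := hf.continuousAt (U.isOpen.mem_nhds hp)
    have hl : Filter.Tendsto (fun s : ℝ => p + s • eF 0) (nhdsWithin 0 {0}ᶜ) (nhds p) := by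
      have : Continuous fun s : ℝ => p + s • eF 0 := by fun_prop
      have h2 := this.tendsto 0
      simp only [zero_smul, add_zero] at h2
      exact h2.mono_left nhdsWithin_le_nhds
    have hz : ∀ᶠ s in nhdsWithin (0 : ℝ) {0}ᶜ, f (p + s • eF 0) = 0 := by
      filter_upwards [hl (U.isOpen.mem_nhds hp), self_mem_nhdsWithin] with s hs hs0
      refine h _ hs ?_
      simpa [eF, hu] using hs0
    have hlim : Filter.Tendsto (fun s : ℝ => f (p + s • eF 0)) (nhdsWithin 0 {0}ᶜ) (nhds (f p)) :=
      hc.tendsto.comp hl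
    exact tendsto_nhds_unique hlim
      ((Filter.tendsto_congr' hz).2 tendsto_const_nhds)
  · exact h p hp hu

/-- The coefficient `σ_y` does not depend on `x, z`, and `σ_x, σ_z` do not depend on `y`.  The mixed
entries of `u` occur in the equation for `w` with the coefficients `r₁, r₂`, only one of which is
nonzero, and so give a relation independent of the one in `sg_independent`. -/
theorem sg_cross (ha₁ : a₁ ≠ 0) (hr : (r₁ ≠ 0 ∧ r₂ = 0) ∨ (r₁ = 0 ∧ r₂ ≠ 0)) (V : VField U)
    (hV : IsSymmetryGenerator (genSystem a₁ a₂ a₃ b₁ r₁ r₂) V) :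
    ∀ p ∈ U, dd (eB 1) (sg V.1 2) p = 0 ∧ dd (eB 2) (sg V.1 1) p = 0 ∧
      dd (eB 2) (sg V.1 3) p = 0 ∧ dd (eB 3) (sg V.1 2) p = 0 := by
  obtain ⟨-, -, hk12, -, hk23⟩ := sg_independent ha₁ V hV
  have hc : ∀ i l, ContinuousOn (dd (eB i) (sg V.1 l)) (U : Set Pt) := fun i l =>
    (dd_smoothOn U.isOpen (sg_smooth V.2.1 l) _).continuousOn
  have key := fun {p : Pt} (hp : p ∈ U) {i k : Fin 4} (h : i ≠ k) =>
    (offDiagonal_equations V hV hp 0 (mixedEntry 0 i k)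
      (mixedEntry_symm 0 i k) (mixedEntry_diag 0 h)).2
  simp only [totalD0_zero] at key
  have h12 : ∀ p ∈ U, r₁ * dd (eB 1) (sg V.1 2) p + r₂ * dd (eB 2) (sg V.1 1) p = 0 := by
    refine eq_zero_of_eq_zero_off_axis
      ((continuousOn_const.mul (hc _ _)).add (continuousOn_const.mul (hc _ _))) fun p hp hu => ?_
    have := key hp (i := 1) (k := 2) (by decide)
    simp [mixedEntry] at this
    refine (mul_eq_zero.1 (?_ : p.2 0 * _ = 0)).resolve_left hu
    linear_combination -this / 2
  have h23 : ∀ p ∈ U, r₁ * dd (eB 3) (sg V.1 2) p + r₂ * dd (eB 2) (sg V.1 3) p = 0 := by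
    refine eq_zero_of_eq_zero_off_axis
      ((continuousOn_const.mul (hc _ _)).add (continuousOn_const.mul (hc _ _))) fun p hp hu => ?_
    have := key hp (i := 2) (k := 3) (by decide)
    simp [mixedEntry] at this
    refine (mul_eq_zero.1 (?_ : p.2 0 * _ = 0)).resolve_left hu
    linear_combination -this / 2
  intro p hp
  have e1 := h12 p hp
  have e2 := h23 p hp
  have e3 := hk12 p hp
  have e4 := hk23 p hp
  rcases hr with ⟨hr1, hr2⟩ | ⟨hr1, hr2⟩
  · simp [hr1, hr2] at e1 e2
    simp [e1, ha₁] at e3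
    simp [e2, ha₁] at e4
    exact ⟨e1, e3, e4, e2⟩
  · simp [hr1, hr2] at e1 e2
    simp [e1] at e3
    simp [e2] at e4
    exact ⟨e3, e1, e2, e4⟩

/-! ### The symmetry condition on jets concentrated in one spatial direction -/

section LineJets

variable {U : TopologicalSpace.Opens Pt} {a₁ a₂ a₃ b₁ r₁ r₂ : ℝ}

/-- The coefficients of the second-order operator of the Schrödinger equation; also used for the
operator acting on `w`, with `b₁` in place of `a₁`. -/
def lapCoeff (c : ℝ) : Fin 4 → ℝ := ![0, 1, c, 1]

/-- The coefficients of the second-order operator acting on `|ψ|²`. -/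
def rhoCoeff (r₁ r₂ : ℝ) : Fin 4 → ℝ := ![0, r₁, r₂, r₁]

/-- `f_xx + c f_yy + f_zz` for a function `f` of the variables of order zero. -/
def baseLap (c : ℝ) (f : Pt → ℝ) (p : Pt) : ℝ :=
  dd (eB 1) (dd (eB 1) f) p + c * dd (eB 2) (dd (eB 2) f) p + dd (eB 3) (dd (eB 3) f) p

/-- The contribution to `D_i D_i f` of the jet whose first- and second-order entries in the `i`-th
direction are `A` and `K`. -/
def lineD2 (i : Fin 4) (f : Pt → ℝ) (p : Pt) (A K : Fin 3 → ℝ) : ℝ :=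
  ∑ β, (2 * (A β * dd (eB i) (dd (eF β) f) p) + K β * dd (eF β) f p +
    A β * ∑ γ, A γ * dd (eF γ) (dd (eF β) f) p)

/-- The jet over `p` whose only nonzero entries are the derivatives of first and second order in
the `i`-th direction and the time derivatives. -/
def lineJet (p : Pt) (i : Fin 4) (A K T : Fin 3 → ℝ) : Jet2 :=
  ((p, fun α l => if l = i then A α else if l = 0 then T α else 0),
    fun α l m => if l = i ∧ m = i then K α else 0)

theorem totalD0_lineJet_zero (p : Pt) {i : Fin 4} (hi : i ≠ 0) (A K T : Fin 3 → ℝ) (f : Pt → ℝ) :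
    totalD0 0 f (lineJet p i A K T).1 = dd (eB 0) f p + ∑ β, T β * dd (eF β) f p := by
  simp [totalD0_eq, lineJet, hi.symm]

theorem totalD0_lineJet_self (p : Pt) (i : Fin 4) (A K T : Fin 3 → ℝ) (f : Pt → ℝ) :
    totalD0 i f (lineJet p i A K T).1 = dd (eB i) f p + ∑ β, A β * dd (eF β) f p := by
  simp [totalD0_eq, lineJet]

theorem totalD0_lineJet_of_ne (p : Pt) {i m : Fin 4} (hm : m ≠ 0) (h : m ≠ i) (A K T : Fin 3 → ℝ)
    (f : Pt → ℝ) : totalD0 m f (lineJet p i A K T).1 = dd (eB m) f p := by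
  simp [totalD0_eq, lineJet, h, hm]

theorem totalD2_lineJet_self {f : Pt → ℝ} (hf : ContDiffOn ℝ ∞ f (U : Set Pt)) {p : Pt}
    (hp : p ∈ U) (i : Fin 4) (A K T : Fin 3 → ℝ) :
    totalD2 i i f (lineJet p i A K T) = dd (eB i) (dd (eB i) f) p + lineD2 i f p A K := by
  rw [totalD2, totalD0_lineJet_self, lineD2, add_assoc, ← Finset.sum_add_distrib]
  refine congrArg₂ (· + ·) rfl (Finset.sum_congr rfl fun β _ => ?_)
  rw [totalD0_lineJet_self]
  simp only [lineJet, if_true, and_self]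
  rw [dd_comm U.isOpen hf (eF β) (eB i) p hp]
  ring

theorem totalD2_lineJet_of_ne (f : Pt → ℝ) (p : Pt) {i m : Fin 4} (hm : m ≠ 0) (h : m ≠ i)
    (A K T : Fin 3 → ℝ) :
    totalD2 m m f (lineJet p i A K T) = dd (eB m) (dd (eB m) f) p := by
  rw [totalD2, totalD0_lineJet_of_ne p hm h]
  simp [lineJet, h, hm]

/-- The base coefficients do not depend on `u, v, w`, and the time component only depends
on `t`. -/
structure BaseProjectable (V : VField U) : Prop where
  fib : ∀ l α, ∀ p ∈ U, dd (eF α) (sg V.1 l) p = 0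
  time : ∀ i, i ≠ 0 → ∀ p ∈ U, dd (eB i) (sg V.1 0) p = 0

namespace BaseProjectable

variable {V : VField U} (h : BaseProjectable V)
include h

theorem totalD0_eq_dd (i l : Fin 4) (J : Jet1) (hJ : J.1 ∈ U) :
    totalD0 i (sg V.1 l) J = dd (eB i) (sg V.1 l) J.1 := by
  simp [totalD0_eq, h.fib _ _ _ hJ]

theorem dd_dd_fib (v : Pt) (l : Fin 4) (α : Fin 3) {p : Pt} (hp : p ∈ U) :
    dd v (dd (eF α) (sg V.1 l)) p = 0 := by
  rw [dd_congr U.isOpen (h.fib l α) v p hp, dd_const]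

theorem totalD2_eq_dd (i l : Fin 4) (j : Jet2) (hj : j.1.1 ∈ U) :
    totalD2 i i (sg V.1 l) j = dd (eB i) (dd (eB i) (sg V.1 l)) j.1.1 := by
  have e : ∀ α, dd (eF α) (dd (eB i) (sg V.1 l)) j.1.1 = 0 := fun α => by
    rw [dd_comm U.isOpen (sg_smooth V.2.1 l) _ _ _ hj, h.dd_dd_fib _ _ _ hj]
  simp [totalD2, totalD0_eq, h.fib _ _ _ hj, h.dd_dd_fib _ _ _ hj, e]

theorem dd_dd_time {i : Fin 4} (hi : i ≠ 0) (v : Pt) {p : Pt} (hp : p ∈ U) :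
    dd v (dd (eB i) (sg V.1 0)) p = 0 := by
  rw [dd_congr U.isOpen (h.time i hi) v p hp, dd_const]

theorem prol1_time {p : Pt} (hp : p ∈ U) {i : Fin 4} (hi : i ≠ 0) (A K T : Fin 3 → ℝ) (α : Fin 3) :
    prol1 V.1 α 0 (lineJet p i A K T).1 = dd (eB 0) (ph V.1 α) p + ∑ β, T β * dd (eF β) (ph V.1 α) p
      - dd (eB 0) (sg V.1 0) p * T α - dd (eB 0) (sg V.1 i) p * A α := by
  have e : prol1 V.1 α 0 (lineJet p i A K T).1 = totalD0 0 (ph V.1 α) (lineJet p i A K T).1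
    - ∑ k, totalD0 0 (sg V.1 k) (lineJet p i A K T).1 * (lineJet p i A K T).1.2 α k := rfl
  rw [e, totalD0_lineJet_zero p hi, sub_sub]
  congr 1
  rw [Fin.sum_univ_four]
  simp only [h.totalD0_eq_dd _ _ _ (show (lineJet p i A K T).1.1 ∈ U from hp)]
  fin_cases i
  · exact absurd rfl hi
  all_goals simp [lineJet]

theorem prol1_self {p : Pt} (hp : p ∈ U) {i : Fin 4} (hi : i ≠ 0) (A K T : Fin 3 → ℝ) (α : Fin 3) :
    prol1 V.1 α i (lineJet p i A K T).1 = dd (eB i) (ph V.1 α) p + ∑ β, A β * dd (eF β) (ph V.1 α) p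
      - dd (eB i) (sg V.1 i) p * A α := by
  have e : prol1 V.1 α i (lineJet p i A K T).1 = totalD0 i (ph V.1 α) (lineJet p i A K T).1
    - ∑ k, totalD0 i (sg V.1 k) (lineJet p i A K T).1 * (lineJet p i A K T).1.2 α k := rfl
  rw [e, totalD0_lineJet_self p i]
  congr 1
  rw [Fin.sum_univ_four]
  simp only [h.totalD0_eq_dd _ _ _ (show (lineJet p i A K T).1.1 ∈ U from hp)]
  have hz := h.time i hi p hp
  fin_cases i
  · exact absurd rfl hi
  all_goals (simp at hz; simp [lineJet, hz])

theorem prol2_self {p : Pt} (hp : p ∈ U) {i : Fin 4} (hi : i ≠ 0) (A K T : Fin 3 → ℝ) (α : Fin 3) :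
    prol2 V.1 α i i (lineJet p i A K T) = dd (eB i) (dd (eB i) (ph V.1 α)) p
      + lineD2 i (ph V.1 α) p A K - dd (eB i) (dd (eB i) (sg V.1 i)) p * A α
      - 2 * dd (eB i) (sg V.1 i) p * K α := by
  rw [prol2_diag U.isOpen V.2.1 α i _ hp (fun α l m => by
    simp only [lineJet, and_comm (a := l = i)]),
    totalD2_lineJet_self (ph_smooth V.2.1 α) hp, sub_sub (_ + _)]
  congr 1
  rw [Fin.sum_univ_four]
  simp only [h.totalD0_eq_dd _ _ _ (show (lineJet p i A K T).1.1 ∈ U from hp),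
    h.totalD2_eq_dd _ _ _ (show (lineJet p i A K T).1.1 ∈ U from hp)]
  have hz := h.dd_dd_time hi (eB i) hp
  fin_cases i
  · exact absurd rfl hi
  all_goals (simp at hz; simp [lineJet, hz]; ring)

theorem prol2_of_ne {p : Pt} (hp : p ∈ U) {i m : Fin 4} (hm : m ≠ 0) (hne : m ≠ i)
    (A K T : Fin 3 → ℝ) (α : Fin 3) :
    prol2 V.1 α m m (lineJet p i A K T) = dd (eB m) (dd (eB m) (ph V.1 α)) p
      - dd (eB m) (dd (eB m) (sg V.1 i)) p * A α := by
  rw [prol2_diag U.isOpen V.2.1 α m _ hp (fun α l m => by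
    simp only [lineJet, and_comm (a := l = i)]), totalD2_lineJet_of_ne _ _ hm hne]
  congr 1
  simp only [h.totalD0_eq_dd _ _ _ (show (lineJet p i A K T).1.1 ∈ U from hp),
    h.totalD2_eq_dd _ _ _ (show (lineJet p i A K T).1.1 ∈ U from hp)]
  have hz := h.dd_dd_time hm (eB m) hp
  rw [Finset.sum_eq_single i]
  · simp [lineJet, hne]
  · intro l _ hl
    by_cases h0 : l = 0
    · subst h0
      simp [lineJet, hne, hz]
    · simp [lineJet, hne, hl, h0]
  · simp

end BaseProjectable

theorem lineJet_on_variety {p : Pt} {i : Fin 4} (hi : i ≠ 0) {A K T : Fin 3 → ℝ}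
    (hT0 : T 0 = a₂ * p.2 1 * (p.2 0 ^ 2 + p.2 1 ^ 2) + p.2 1 * p.2 2 + a₃ * p.2 0
      - lapCoeff a₁ i * K 1)
    (hT1 : T 1 = lapCoeff a₁ i * K 0 - a₂ * p.2 0 * (p.2 0 ^ 2 + p.2 1 ^ 2) - p.2 0 * p.2 2
      + a₃ * p.2 1)
    (hK : lapCoeff b₁ i * K 2 =
      rhoCoeff r₁ r₂ i * (2 * (A 0 ^ 2 + p.2 0 * K 0 + A 1 ^ 2 + p.2 1 * K 1))) :
    ∀ k, genSystem a₁ a₂ a₃ b₁ r₁ r₂ k (lineJet p i A K T) = 0 := by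
  intro k
  fin_cases i
  · exact absurd rfl hi
  all_goals
    simp [lapCoeff, rhoCoeff] at hT0 hT1 hK
    fin_cases k
    · simp [genSystem, schrodingerIm, lap, lineJet]
      linear_combination hT0
    · simp [genSystem, schrodingerRe, lap, lineJet]
      linear_combination -hT1
    · simp [genSystem, rho2, lap, lineJet]
      linear_combination hK

/-- The symmetry condition on a jet concentrated in the `i`-th direction. -/
theorem line_equations (V : VField U) (h : BaseProjectable V)
    (hV : IsSymmetryGenerator (genSystem a₁ a₂ a₃ b₁ r₁ r₂) V) {p : Pt} (hp : p ∈ U)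
    {i : Fin 4} (hi : i ≠ 0) {A K T : Fin 3 → ℝ}
    (hT0 : T 0 = a₂ * p.2 1 * (p.2 0 ^ 2 + p.2 1 ^ 2) + p.2 1 * p.2 2 + a₃ * p.2 0
      - lapCoeff a₁ i * K 1)
    (hT1 : T 1 = lapCoeff a₁ i * K 0 - a₂ * p.2 0 * (p.2 0 ^ 2 + p.2 1 ^ 2) - p.2 0 * p.2 2
      + a₃ * p.2 1)
    (hK : lapCoeff b₁ i * K 2 =
      rhoCoeff r₁ r₂ i * (2 * (A 0 ^ 2 + p.2 0 * K 0 + A 1 ^ 2 + p.2 1 * K 1))) :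
    (dd (eB 0) (ph V.1 0) p + ∑ β, T β * dd (eF β) (ph V.1 0) p
      - dd (eB 0) (sg V.1 0) p * T 0 - dd (eB 0) (sg V.1 i) p * A 0
      + baseLap a₁ (ph V.1 1) p - baseLap a₁ (sg V.1 i) p * A 1
      + lapCoeff a₁ i * (lineD2 i (ph V.1 1) p A K - 2 * dd (eB i) (sg V.1 i) p * K 1)
      - a₂ * (ph V.1 1 p * (p.2 0 ^ 2 + p.2 1 ^ 2)
        + 2 * p.2 1 * (p.2 0 * ph V.1 0 p + p.2 1 * ph V.1 1 p))
      - (ph V.1 1 p * p.2 2 + p.2 1 * ph V.1 2 p) - a₃ * ph V.1 0 p = 0) ∧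
    (baseLap a₁ (ph V.1 0) p - baseLap a₁ (sg V.1 i) p * A 0
      + lapCoeff a₁ i * (lineD2 i (ph V.1 0) p A K - 2 * dd (eB i) (sg V.1 i) p * K 0)
      - (dd (eB 0) (ph V.1 1) p + ∑ β, T β * dd (eF β) (ph V.1 1) p
      - dd (eB 0) (sg V.1 0) p * T 1 - dd (eB 0) (sg V.1 i) p * A 1)
      - a₂ * (ph V.1 0 p * (p.2 0 ^ 2 + p.2 1 ^ 2)
        + 2 * p.2 0 * (p.2 0 * ph V.1 0 p + p.2 1 * ph V.1 1 p))
      - (ph V.1 0 p * p.2 2 + p.2 0 * ph V.1 2 p) + a₃ * ph V.1 1 p = 0) ∧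
    (baseLap b₁ (ph V.1 2) p - baseLap b₁ (sg V.1 i) p * A 2
      + lapCoeff b₁ i * (lineD2 i (ph V.1 2) p A K - 2 * dd (eB i) (sg V.1 i) p * K 2)
      - 2 * p.2 0 * (r₁ * dd (eB 1) (dd (eB 1) (ph V.1 0)) p
        + r₂ * dd (eB 2) (dd (eB 2) (ph V.1 0)) p + r₁ * dd (eB 3) (dd (eB 3) (ph V.1 0)) p)
      - 2 * p.2 1 * (r₁ * dd (eB 1) (dd (eB 1) (ph V.1 1)) p
        + r₂ * dd (eB 2) (dd (eB 2) (ph V.1 1)) p + r₁ * dd (eB 3) (dd (eB 3) (ph V.1 1)) p)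
      + 2 * (p.2 0 * A 0 + p.2 1 * A 1) * (r₁ * dd (eB 1) (dd (eB 1) (sg V.1 i)) p
        + r₂ * dd (eB 2) (dd (eB 2) (sg V.1 i)) p + r₁ * dd (eB 3) (dd (eB 3) (sg V.1 i)) p)
      - 2 * rhoCoeff r₁ r₂ i * (2 * A 0 * (dd (eB i) (ph V.1 0) p
          + ∑ β, A β * dd (eF β) (ph V.1 0) p - dd (eB i) (sg V.1 i) p * A 0)
        + ph V.1 0 p * K 0
        + p.2 0 * (lineD2 i (ph V.1 0) p A K - 2 * dd (eB i) (sg V.1 i) p * K 0)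
        + 2 * A 1 * (dd (eB i) (ph V.1 1) p
          + ∑ β, A β * dd (eF β) (ph V.1 1) p - dd (eB i) (sg V.1 i) p * A 1)
        + ph V.1 1 p * K 1
        + p.2 1 * (lineD2 i (ph V.1 1) p A K - 2 * dd (eB i) (sg V.1 i) p * K 1)) = 0) := by
  have e := symmetry_equations V.1 _ (hV (lineJet p i A K T) hp (fun α l m => by
    simp only [lineJet, and_comm (a := l = i)]) (lineJet_on_variety hi hT0 hT1 hK))
  have t0 := fun α => h.prol1_time hp hi A K T α
  have s1 := fun α => h.prol1_self hp hi A K T α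
  have s2 := fun α => h.prol2_self hp hi A K T α
  have n2 := fun {m : Fin 4} (hm : m ≠ 0) (hne : m ≠ i) α => h.prol2_of_ne hp hm hne A K T α
  have j0 : (lineJet p i A K T).1.1 = p := rfl
  simp only [j0, t0] at e
  unfold baseLap
  fin_cases i
  · exact absurd rfl hi
  · simp only [Fin.mk_one, Fin.isValue] at s1 s2 n2 e ⊢
    have m2 := n2 (m := 2) (by decide) (by decide)
    have m3 := n2 (m := 3) (by decide) (by decide)
    simp only [s1, s2, m2, m3] at e
    simp [lineJet] at e
    simp [lapCoeff, rhoCoeff]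
    refine ⟨?_, ?_, ?_⟩
    · linear_combination e.1
    · linear_combination e.2.1
    · linear_combination e.2.2
  · simp only [Fin.reduceFinMk, Fin.isValue] at s1 s2 n2 e ⊢
    have m2 := n2 (m := 1) (by decide) (by decide)
    have m3 := n2 (m := 3) (by decide) (by decide)
    simp only [s1, s2, m2, m3] at e
    simp [lineJet] at e
    simp [lapCoeff, rhoCoeff]
    refine ⟨?_, ?_, ?_⟩
    · linear_combination e.1
    · linear_combination e.2.1
    · linear_combination e.2.2
  · simp only [Fin.reduceFinMk, Fin.isValue] at s1 s2 n2 e ⊢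
    have m2 := n2 (m := 1) (by decide) (by decide)
    have m3 := n2 (m := 2) (by decide) (by decide)
    simp only [s1, s2, m2, m3] at e
    simp [lineJet] at e
    simp [lapCoeff, rhoCoeff]
    refine ⟨?_, ?_, ?_⟩
    · linear_combination e.1
    · linear_combination e.2.1
    · linear_combination e.2.2

end LineJets

/-! ### The determining equations -/

section Determining

variable {U : TopologicalSpace.Opens Pt} {a₁ a₂ a₃ b₁ r₁ r₂ : ℝ}

theorem lapCoeff_ne_zero {c : ℝ} (hc : c ≠ 0) {i : Fin 4} (hi : i ≠ 0) : lapCoeff c i ≠ 0 := by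
  fin_cases i
  · exact absurd rfl hi
  all_goals simp [lapCoeff, hc]

/-- The entries `u_t, v_t` which put a jet with vanishing other entries but `u_ii`, `v_ii` on the
solution variety; `τ` is the entry `w_t`. -/
def timeEntries (a₁ a₂ a₃ : ℝ) (i : Fin 4) (p : Pt) (K0 K1 τ : ℝ) : Fin 3 → ℝ :=
  ![a₂ * p.2 1 * (p.2 0 ^ 2 + p.2 1 ^ 2) + p.2 1 * p.2 2 + a₃ * p.2 0 - lapCoeff a₁ i * K1,
    lapCoeff a₁ i * K0 - a₂ * p.2 0 * (p.2 0 ^ 2 + p.2 1 ^ 2) - p.2 0 * p.2 2 + a₃ * p.2 1, τ]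

/-- The coefficients of `∂_u` and `∂_v` do not depend on `w`, since the entry `w_t` does not occur in
the system and is arbitrary. -/
theorem ph_w_independent (V : VField U) (h : BaseProjectable V)
    (hV : IsSymmetryGenerator (genSystem a₁ a₂ a₃ b₁ r₁ r₂) V) {p : Pt} (hp : p ∈ U) :
    dd (eF 2) (ph V.1 0) p = 0 ∧ dd (eF 2) (ph V.1 1) p = 0 := by
  have H := fun τ : ℝ => line_equations (i := 1) (A := 0) (K := 0)
    (T := timeEntries a₁ a₂ a₃ 1 p 0 0 τ) V h hV hp (by decide) (by simp [timeEntries])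
    (by simp [timeEntries]) (by simp)
  have e := H 0
  have e' := H 1
  simp [Fin.sum_univ_three, lineD2, timeEntries] at e e'
  constructor
  · linear_combination e'.1 - e.1
  · linear_combination e.2.1 - e'.2.1

/-- The conditions obtained from the first- and second-order entries in one direction: the
coefficients of `∂_u` and `∂_v` are affine in `u, v` and satisfy the Cauchy--Riemann equations, the
scaling of the direction is half that of the time, and the last three equations relate the coefficient
of `∂_w` to those of `∂_u` and `∂_v`. -/
theorem line_conditions (ha₁ : a₁ ≠ 0) (hb₁ : b₁ ≠ 0) (V : VField U) (h : BaseProjectable V)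
    (hV : IsSymmetryGenerator (genSystem a₁ a₂ a₃ b₁ r₁ r₂) V) {p : Pt} (hp : p ∈ U)
    {i : Fin 4} (hi : i ≠ 0) :
    (dd (eF 1) (ph V.1 1) p = dd (eF 0) (ph V.1 0) p ∧
      dd (eF 0) (ph V.1 1) p = - dd (eF 1) (ph V.1 0) p ∧
      2 * dd (eB i) (sg V.1 i) p = dd (eB 0) (sg V.1 0) p) ∧
    (dd (eF 0) (dd (eF 0) (ph V.1 0)) p = 0 ∧ dd (eF 0) (dd (eF 1) (ph V.1 0)) p = 0 ∧
      dd (eF 1) (dd (eF 1) (ph V.1 0)) p = 0) ∧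
    (2 * lapCoeff a₁ i * dd (eB i) (dd (eF 0) (ph V.1 0)) p = baseLap a₁ (sg V.1 i) p ∧
      2 * lapCoeff a₁ i * dd (eB i) (dd (eF 1) (ph V.1 0)) p = - dd (eB 0) (sg V.1 i) p) ∧
    (lapCoeff b₁ i * dd (eF 0) (ph V.1 2) p + 2 * rhoCoeff r₁ r₂ i *
      (dd (eF 2) (ph V.1 2) p * p.2 0 - ph V.1 0 p - p.2 0 * dd (eF 0) (ph V.1 0) p
        - p.2 1 * dd (eF 0) (ph V.1 1) p) = 0 ∧
     lapCoeff b₁ i * dd (eF 1) (ph V.1 2) p + 2 * rhoCoeff r₁ r₂ i *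
      (dd (eF 2) (ph V.1 2) p * p.2 1 - ph V.1 1 p - p.2 0 * dd (eF 1) (ph V.1 0) p
        - p.2 1 * dd (eF 1) (ph V.1 1) p) = 0 ∧
     lapCoeff b₁ i * dd (eF 0) (dd (eF 0) (ph V.1 2)) p + 2 * rhoCoeff r₁ r₂ i *
      (dd (eF 2) (ph V.1 2) p - 2 * dd (eF 0) (ph V.1 0) p) = 0) := by
  have hca := lapCoeff_ne_zero ha₁ hi
  have hcb := lapCoeff_ne_zero hb₁ hi
  have w0 : ∀ p ∈ U, dd (eF 2) (ph V.1 0) p = 0 := fun p hp => (ph_w_independent V h hV hp).1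
  have w1 : ∀ p ∈ U, dd (eF 2) (ph V.1 1) p = 0 := fun p hp => (ph_w_independent V h hV hp).2
  have w0' : ∀ v, dd v (dd (eF 2) (ph V.1 0)) p = 0 := fun v => by
    rw [dd_congr U.isOpen w0 v p hp, dd_const]
  have w1' : ∀ v, dd v (dd (eF 2) (ph V.1 1)) p = 0 := fun v => by
    rw [dd_congr U.isOpen w1 v p hp, dd_const]
  have w0'' : ∀ v, dd (eF 2) (dd v (ph V.1 0)) p = 0 := fun v => by
    rw [dd_comm U.isOpen (ph_smooth V.2.1 0) _ _ p hp, w0']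
  have w1'' : ∀ v, dd (eF 2) (dd v (ph V.1 1)) p = 0 := fun v => by
    rw [dd_comm U.isOpen (ph_smooth V.2.1 1) _ _ p hp, w1']
  have c0 := dd_comm U.isOpen (ph_smooth V.2.1 0) (eF 1) (eF 0) p hp
  have c1 := dd_comm U.isOpen (ph_smooth V.2.1 1) (eF 1) (eF 0) p hp
  have H := fun (A0 A1 K0 K1 K2 : ℝ) (hK : lapCoeff b₁ i * K2 = rhoCoeff r₁ r₂ i *
      (2 * (A0 ^ 2 + p.2 0 * K0 + A1 ^ 2 + p.2 1 * K1))) =>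
    line_equations (i := i) (A := ![A0, A1, 0]) (K := ![K0, K1, K2])
      (T := timeEntries a₁ a₂ a₃ i p K0 K1 0) V h hV hp hi rfl rfl hK
  have hdiv : ∀ X : ℝ, lapCoeff b₁ i * (X / lapCoeff b₁ i) = X := fun X => by field_simp
  -- the conditions are polynomial in the entries; their coefficients are found from these values
  have z := H 0 0 0 0 0 (by simp)
  have k0 := H 0 0 1 0 _ (hdiv _)
  have k1 := H 0 0 0 1 _ (hdiv _)
  have x := H 1 0 0 0 _ (hdiv _)
  have x' := H (-1) 0 0 0 _ (hdiv _)
  have y := H 0 1 0 0 _ (hdiv _)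
  have y' := H 0 (-1) 0 0 _ (hdiv _)
  have xy := H 1 1 0 0 _ (hdiv _)
  have hk0 := hdiv (rhoCoeff r₁ r₂ i * (2 * p.2 0))
  have hk1 := hdiv (rhoCoeff r₁ r₂ i * (2 * p.2 1))
  have hx := hdiv (rhoCoeff r₁ r₂ i * 2)
  clear H hdiv
  simp [timeEntries, Fin.sum_univ_three, lineD2, w0 p hp, w1 p hp, w0', w1', w0'', w1'', c0, c1]
    at z k0 k1 x x' y y' xy
  have f1 : dd (eF 1) (ph V.1 1) p = dd (eF 0) (ph V.1 0) p ∧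
      2 * dd (eB i) (sg V.1 i) p = dd (eB 0) (sg V.1 0) p := by
    have e1 := mul_left_cancel₀ hca (a := lapCoeff a₁ i)
      (b := - dd (eF 0) (ph V.1 0) p + dd (eB 0) (sg V.1 0) p + dd (eF 1) (ph V.1 1) p
        - 2 * dd (eB i) (sg V.1 i) p) (c := 0) (by linear_combination k1.1 - z.1)
    have e2 := mul_left_cancel₀ hca (a := lapCoeff a₁ i)
      (b := dd (eF 0) (ph V.1 0) p + dd (eB 0) (sg V.1 0) p - dd (eF 1) (ph V.1 1) p
        - 2 * dd (eB i) (sg V.1 i) p) (c := 0) (by linear_combination k0.2.1 - z.2.1)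
    constructor
    · linear_combination (e1 - e2) / 2
    · linear_combination -(e1 + e2) / 2
  have q0 : dd (eF 0) (dd (eF 0) (ph V.1 0)) p = 0 :=
    (mul_eq_zero.1 (show lapCoeff a₁ i * _ = 0 by
      linear_combination (x.2.1 + x'.2.1 - 2 * z.2.1) / 2)).resolve_left hca
  have q0' : dd (eF 0) (dd (eF 0) (ph V.1 1)) p = 0 :=
    (mul_eq_zero.1 (show lapCoeff a₁ i * _ = 0 by
      linear_combination (x.1 + x'.1 - 2 * z.1) / 2)).resolve_left hca
  have q1 : dd (eF 1) (dd (eF 1) (ph V.1 0)) p = 0 :=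
    (mul_eq_zero.1 (show lapCoeff a₁ i * _ = 0 by
      linear_combination (y.2.1 + y'.2.1 - 2 * z.2.1) / 2)).resolve_left hca
  have q01 : dd (eF 0) (dd (eF 1) (ph V.1 0)) p = 0 :=
    (mul_eq_zero.1 (show 2 * lapCoeff a₁ i * _ = 0 by
      linear_combination xy.2.1 - x.2.1 - y.2.1 + z.2.1)).resolve_left
        (mul_ne_zero two_ne_zero hca)
  refine ⟨⟨f1.1, ?_, f1.2⟩, ⟨q0, q01, q1⟩, ⟨?_, ?_⟩, ?_, ?_, ?_⟩
  · refine mul_left_cancel₀ hca ?_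
    linear_combination k0.1 - z.1
  · linear_combination (x.2.1 - x'.2.1) / 2
  · linear_combination (y.2.1 - y'.2.1) / 2
  · linear_combination k0.2.2 - z.2.2
      - (dd (eF 2) (ph V.1 2) p - 2 * dd (eB i) (sg V.1 i) p) * hk0
  · linear_combination k1.2.2 - z.2.2
      - (dd (eF 2) (ph V.1 2) p - 2 * dd (eB i) (sg V.1 i) p) * hk1
  · linear_combination (x.2.2 + x'.2.2 - 2 * z.2.2) / 2
      - (dd (eF 2) (ph V.1 2) p - 2 * dd (eB i) (sg V.1 i) p) * hx
      + 2 * rhoCoeff r₁ r₂ i * (p.2 0 * q0 + p.2 1 * q0')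

/-- The determining equations.  `A` and `B` are the coefficients of the real and of the imaginary
part of the linear action of the field on `ψ`: it acts on `ψ` by `ψ ↦ (A - i B) ψ`. -/
structure Determined (a₁ a₃ b₁ : ℝ) (V : VField U) (A B : Pt → ℝ) : Prop where
  smooth_A : ContDiffOn ℝ ∞ A (U : Set Pt)
  smooth_B : ContDiffOn ℝ ∞ B (U : Set Pt)
  fib_A : ∀ α, ∀ p ∈ U, dd (eF α) A p = 0
  fib_B : ∀ α, ∀ p ∈ U, dd (eF α) B p = 0
  space_A : ∀ i, i ≠ 0 → ∀ p ∈ U, dd (eB i) A p = 0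
  ph_zero : ∀ p ∈ U, ph V.1 0 p = A p * p.2 0 + B p * p.2 1
  ph_one : ∀ p ∈ U, ph V.1 1 p = A p * p.2 1 - B p * p.2 0
  ph_two : ∀ p ∈ U, ph V.1 2 p = dd (eB 0) B p + 2 * A p * p.2 2
  proj : BaseProjectable V
  -- the base directions: scaling, and a rotation in the `x, z`-plane
  time : ∀ p ∈ U, dd (eB 0) (sg V.1 0) p = -2 * A p
  diag : ∀ i, i ≠ 0 → ∀ p ∈ U, dd (eB i) (sg V.1 i) p = - A p
  cross : ∀ p ∈ U, dd (eB 1) (sg V.1 2) p = 0 ∧ dd (eB 2) (sg V.1 1) p = 0 ∧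
    dd (eB 2) (sg V.1 3) p = 0 ∧ dd (eB 3) (sg V.1 2) p = 0
  anti : ∀ p ∈ U, dd (eB 1) (sg V.1 3) p + dd (eB 3) (sg V.1 1) p = 0
  -- the drift of the base directions is compensated by the phase
  drift : ∀ i, i ≠ 0 → ∀ p ∈ U, dd (eB 0) (sg V.1 i) p = -2 * lapCoeff a₁ i * dd (eB i) B p
  -- the terms of order zero of the Schrödinger equation and of the equation for `w`
  schrodinger : ∀ p ∈ U, dd (eB 0) A p - baseLap a₁ B p = -2 * a₃ * A p
  laplace : ∀ p ∈ U, baseLap b₁ (dd (eB 0) B) p = 0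

theorem dd_base_coord (v : Pt) (i : Fin 4) (p : Pt) : dd v (fun q : Pt => q.1 i) p = v.1 i := by
  refine dd_eq_of_hasDerivAt (by fun_prop) ?_
  simpa using ((hasDerivAt_id (0 : ℝ)).mul_const (v.1 i)).const_add (p.1 i)

theorem dd_fib_coord (v : Pt) (α : Fin 3) (p : Pt) : dd v (fun q : Pt => q.2 α) p = v.2 α := by
  refine dd_eq_of_hasDerivAt (by fun_prop) ?_
  simpa using ((hasDerivAt_id (0 : ℝ)).mul_const (v.2 α)).const_add (p.2 α)

theorem dd_linear_fib {A B : Pt → ℝ} (hA : ContDiffOn ℝ ∞ A (U : Set Pt))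
    (hB : ContDiffOn ℝ ∞ B (U : Set Pt)) (α β : Fin 3) (i : Fin 4) {p : Pt} (hp : p ∈ U) :
    dd (eB i) (fun q => A q * q.2 α + B q * q.2 β) p =
      dd (eB i) A p * p.2 α + dd (eB i) B p * p.2 β := by
  have dA := smoothOn_differentiableAt U.isOpen hA hp
  have dB := smoothOn_differentiableAt U.isOpen hB hp
  rw [dd_add, dd_mul, dd_mul, dd_fib_coord, dd_fib_coord]
  · simp [eB]
  all_goals fun_prop

theorem dd_dd_linear_fib {A B : Pt → ℝ} (hA : ContDiffOn ℝ ∞ A (U : Set Pt))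
    (hB : ContDiffOn ℝ ∞ B (U : Set Pt)) (α β : Fin 3) (i k : Fin 4) {p : Pt} (hp : p ∈ U) :
    dd (eB k) (dd (eB i) (fun q => A q * q.2 α + B q * q.2 β)) p =
      dd (eB k) (dd (eB i) A) p * p.2 α + dd (eB k) (dd (eB i) B) p * p.2 β := by
  rw [dd_congr U.isOpen (fun q hq => dd_linear_fib hA hB α β i hq) _ p hp,
    dd_linear_fib (dd_smoothOn U.isOpen hA _) (dd_smoothOn U.isOpen hB _) α β k hp]

theorem dd_dd_of_eq_zero {f : Pt → ℝ} {w : Pt} (h : ∀ p ∈ U, dd w f p = 0) (v : Pt) {p : Pt}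
    (hp : p ∈ U) : dd v (dd w f) p = 0 := by
  rw [dd_congr U.isOpen h v p hp, dd_const]

theorem dd_dd_of_eq_zero' {f : Pt → ℝ} (hf : ContDiffOn ℝ ∞ f (U : Set Pt)) {w : Pt}
    (h : ∀ p ∈ U, dd w f p = 0) (v : Pt) {p : Pt} (hp : p ∈ U) : dd w (dd v f) p = 0 := by
  rw [dd_comm U.isOpen hf w v p hp, dd_dd_of_eq_zero h v hp]

/-- The symmetry generators satisfy the determining equations. -/
theorem exists_determined (ha₁ : a₁ ≠ 0) (hb₁ : b₁ ≠ 0)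
    (hr : (r₁ ≠ 0 ∧ r₂ = 0) ∨ (r₁ = 0 ∧ r₂ ≠ 0)) (V : VField U)
    (hV : IsSymmetryGenerator (genSystem a₁ a₂ a₃ b₁ r₁ r₂) V) :
    ∃ A B, Determined a₁ a₃ b₁ V A B := by
  obtain ⟨hfib, htime, -, hanti, -⟩ := sg_independent ha₁ V hV
  have hcross := sg_cross ha₁ hr V hV
  have hproj : BaseProjectable V := ⟨hfib, htime⟩
  have sσ := fun l => sg_smooth V.2.1 l
  have sφ := fun α => ph_smooth V.2.1 α
  have L := fun {p : Pt} (hp : p ∈ U) {i : Fin 4} (hi : i ≠ 0) =>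
    line_conditions ha₁ hb₁ V hproj hV hp hi
  have W : ∀ p ∈ U, dd (eF 2) (ph V.1 0) p = 0 := fun p hp => (ph_w_independent V hproj hV hp).1
  set A := dd (eF 0) (ph V.1 0) with hA
  set B := dd (eF 1) (ph V.1 0) with hB
  have sA : ContDiffOn ℝ ∞ A (U : Set Pt) := dd_smoothOn U.isOpen (sφ 0) _
  have sB : ContDiffOn ℝ ∞ B (U : Set Pt) := dd_smoothOn U.isOpen (sφ 0) _
  have fib_A : ∀ α, ∀ p ∈ U, dd (eF α) A p = 0 := by
    intro α p hp
    obtain ⟨-, ⟨q0, q01, -⟩, -⟩ := L hp (i := 1) (by decide)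
    fin_cases α
    · exact q0
    · exact (dd_comm U.isOpen (sφ 0) (eF 1) (eF 0) p hp).trans q01
    · exact dd_dd_of_eq_zero' (sφ 0) W _ hp
  have fib_B : ∀ α, ∀ p ∈ U, dd (eF α) B p = 0 := by
    intro α p hp
    obtain ⟨-, ⟨-, q01, q1⟩, -⟩ := L hp (i := 1) (by decide)
    fin_cases α
    · exact q01
    · exact q1
    · exact dd_dd_of_eq_zero' (sφ 0) W _ hp
  -- comparison of a direction that enters the right-hand side of the equation for `w` with one
  -- that does not
  obtain ⟨i, k, hi, hk, hri, hrk⟩ : ∃ i k : Fin 4, i ≠ 0 ∧ k ≠ 0 ∧ rhoCoeff r₁ r₂ i ≠ 0 ∧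
      rhoCoeff r₁ r₂ k = 0 := by
    rcases hr with ⟨h1, h2⟩ | ⟨h1, h2⟩
    · exact ⟨1, 2, by decide, by decide, by simpa [rhoCoeff] using h1, by simpa [rhoCoeff] using h2⟩
    · exact ⟨2, 1, by decide, by decide, by simpa [rhoCoeff] using h2, by simpa [rhoCoeff] using h1⟩
  have w20 : ∀ p ∈ U, dd (eF 0) (ph V.1 2) p = 0 := fun p hp => by
    have := (L hp hk).2.2.2.1
    simpa [hrk, lapCoeff_ne_zero hb₁ hk] using this
  have w21 : ∀ p ∈ U, dd (eF 1) (ph V.1 2) p = 0 := fun p hp => by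
    have := (L hp hk).2.2.2.2.1
    simpa [hrk, lapCoeff_ne_zero hb₁ hk] using this
  have w22 : ∀ p ∈ U, dd (eF 2) (ph V.1 2) p = 2 * A p := fun p hp => by
    have h1 := (L hp hi).2.2.2.2.2
    rw [dd_dd_of_eq_zero w20 _ hp] at h1
    have := (mul_eq_zero.1 (show (2 * rhoCoeff r₁ r₂ i) *
      (dd (eF 2) (ph V.1 2) p - 2 * A p) = 0 by linear_combination h1)).resolve_left
        (mul_ne_zero two_ne_zero hri)
    linear_combination this
  have ph_zero : ∀ p ∈ U, ph V.1 0 p = A p * p.2 0 + B p * p.2 1 := fun p hp => by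
    have h1 := (L hp hi).2.2.2.1
    rw [w20 p hp, w22 p hp, (L hp hi).1.2.1] at h1
    have := (mul_eq_zero.1 (show (2 * rhoCoeff r₁ r₂ i) *
      (A p * p.2 0 + B p * p.2 1 - ph V.1 0 p) = 0 by linear_combination h1)).resolve_left
        (mul_ne_zero two_ne_zero hri)
    linear_combination -this
  have ph_one : ∀ p ∈ U, ph V.1 1 p = A p * p.2 1 - B p * p.2 0 := fun p hp => by
    have h1 := (L hp hi).2.2.2.2.1
    rw [w21 p hp, w22 p hp, (L hp hi).1.1] at h1
    have := (mul_eq_zero.1 (show (2 * rhoCoeff r₁ r₂ i) *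
      (A p * p.2 1 - B p * p.2 0 - ph V.1 1 p) = 0 by linear_combination h1)).resolve_left
        (mul_ne_zero two_ne_zero hri)
    linear_combination -this
  -- the base coefficients are harmonic, so that `A` only depends on `t`
  have hdiag : ∀ i, i ≠ 0 → ∀ p ∈ U, dd (eB i) (sg V.1 i) p = 1 / 2 * dd (eB 0) (sg V.1 0) p :=
    fun i hi p hp => by linear_combination (L hp hi).1.2.2 / 2
  have hdiag2 : ∀ i m, i ≠ 0 → m ≠ 0 → ∀ p ∈ U, dd (eB m) (dd (eB i) (sg V.1 i)) p = 0 :=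
    fun i m hi hm p hp => by
      rw [dd_congr U.isOpen (hdiag i hi) _ p hp,
        dd_const_mul _ (smoothOn_differentiableAt U.isOpen (dd_smoothOn U.isOpen (sσ 0) _) hp),
        dd_dd_of_eq_zero' (sσ 0) (htime m hm) _ hp, mul_zero]
  have h13 : ∀ p ∈ U, dd (eB 3) (sg V.1 1) p = - dd (eB 1) (sg V.1 3) p := fun p hp => by
    linear_combination hanti p hp
  have h31 : ∀ p ∈ U, dd (eB 1) (sg V.1 3) p = - dd (eB 3) (sg V.1 1) p := fun p hp => by
    linear_combination hanti p hp
  have hLs : ∀ i, i ≠ 0 → ∀ p ∈ U, baseLap a₁ (sg V.1 i) p = 0 := by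
    intro i hi p hp
    have c12 := dd_dd_of_eq_zero (fun q hq => (hcross q hq).1) (eB 1) hp
    have c21 := dd_dd_of_eq_zero (fun q hq => (hcross q hq).2.1) (eB 2) hp
    have c23 := dd_dd_of_eq_zero (fun q hq => (hcross q hq).2.2.1) (eB 2) hp
    have c32 := dd_dd_of_eq_zero (fun q hq => (hcross q hq).2.2.2) (eB 3) hp
    unfold baseLap
    fin_cases i
    · exact absurd rfl hi
    · have e : dd (eB 3) (dd (eB 3) (sg V.1 1)) p = 0 := by
        rw [dd_congr U.isOpen h13 _ p hp, dd_neg, dd_comm U.isOpen (sσ 3) _ _ p hp,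
          hdiag2 3 1 (by decide) (by decide) p hp, neg_zero]
      simp [hdiag2 1 1 (by decide) (by decide) p hp, c21, e]
    · simp [hdiag2 2 2 (by decide) (by decide) p hp, c12, c32]
    · have e : dd (eB 1) (dd (eB 1) (sg V.1 3)) p = 0 := by
        rw [dd_congr U.isOpen h31 _ p hp, dd_neg, dd_comm U.isOpen (sσ 1) _ _ p hp,
          hdiag2 1 3 (by decide) (by decide) p hp, neg_zero]
      simp [hdiag2 3 3 (by decide) (by decide) p hp, c23, e]
  have space_A : ∀ i, i ≠ 0 → ∀ p ∈ U, dd (eB i) A p = 0 := fun i hi p hp => by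
    have := (L hp hi).2.2.1.1
    rw [hLs i hi p hp] at this
    exact (mul_eq_zero.1 this).resolve_left
      (mul_ne_zero two_ne_zero (lapCoeff_ne_zero ha₁ hi))
  -- the terms of order zero
  have hph_one : ∀ p ∈ U, ph V.1 1 p = A p * p.2 1 + (-1 * B p) * p.2 0 := fun p hp => by
    rw [ph_one p hp]; ring
  have snB : ContDiffOn ℝ ∞ (fun p => -1 * B p) (U : Set Pt) := contDiffOn_const.mul sB
  have dsB : ∀ p ∈ U, ∀ v, dd v (fun p => -1 * B p) p = - dd v B p := fun p hp v => by
    rw [dd_const_mul _ (smoothOn_differentiableAt U.isOpen sB hp)]; ring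
  have d0 : ∀ i, ∀ p ∈ U, dd (eB i) (ph V.1 0) p = dd (eB i) A p * p.2 0 + dd (eB i) B p * p.2 1 :=
    fun i p hp => by rw [dd_congr U.isOpen ph_zero _ p hp, dd_linear_fib sA sB _ _ _ hp]
  have d1 : ∀ i, ∀ p ∈ U, dd (eB i) (ph V.1 1) p = dd (eB i) A p * p.2 1 - dd (eB i) B p * p.2 0 :=
    fun i p hp => by
      rw [dd_congr U.isOpen hph_one _ p hp, dd_linear_fib sA snB _ _ _ hp, dsB p hp]; ring
  have dd0 : ∀ i, i ≠ 0 → ∀ p ∈ U,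
      dd (eB i) (dd (eB i) (ph V.1 0)) p = dd (eB i) (dd (eB i) B) p * p.2 1 :=
    fun i hi p hp => by
      rw [dd_congr U.isOpen (dd_congr U.isOpen ph_zero _) _ p hp,
        dd_dd_linear_fib sA sB _ _ _ _ hp, dd_dd_of_eq_zero (space_A i hi) _ hp]; ring
  have dd1 : ∀ i, i ≠ 0 → ∀ p ∈ U,
      dd (eB i) (dd (eB i) (ph V.1 1)) p = - dd (eB i) (dd (eB i) B) p * p.2 0 :=
    fun i hi p hp => by
      rw [dd_congr U.isOpen (dd_congr U.isOpen hph_one _) _ p hp,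
        dd_dd_linear_fib sA snB _ _ _ _ hp, dd_dd_of_eq_zero (space_A i hi) _ hp,
        dd_congr U.isOpen (fun q hq => dsB q hq (eB i)) _ p hp, dd_neg]; ring
  have Z := fun {p : Pt} (hp : p ∈ U) => line_equations (i := 1) (A := 0) (K := 0)
    (T := timeEntries a₁ a₂ a₃ 1 p 0 0 0) V hproj hV hp (by decide) (by simp [timeEntries])
    (by simp [timeEntries]) (by simp)
  have LB0 : ∀ p ∈ U, ∀ c, baseLap c (ph V.1 0) p = baseLap c B p * p.2 1 := fun p hp c => by
    simp only [baseLap, dd0 1 (by decide) p hp, dd0 2 (by decide) p hp, dd0 3 (by decide) p hp]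
    ring
  have LB1 : ∀ p ∈ U, ∀ c, baseLap c (ph V.1 1) p = - baseLap c B p * p.2 0 := fun p hp c => by
    simp only [baseLap, dd1 1 (by decide) p hp, dd1 2 (by decide) p hp, dd1 3 (by decide) p hp]
    ring
  set τ' := dd (eB 0) (sg V.1 0) with hτ'
  have sτ' : ContDiffOn ℝ ∞ τ' (U : Set Pt) := dd_smoothOn U.isOpen (sσ 0) _
  have sB0 : ContDiffOn ℝ ∞ (dd (eB 0) B) (U : Set Pt) := dd_smoothOn U.isOpen sB _
  have E : ∀ p ∈ U,
      p.2 0 * (dd (eB 0) A p - baseLap a₁ B p - a₃ * τ' p) + p.2 1 * (dd (eB 0) B p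
        - τ' p * (a₂ * (p.2 0 ^ 2 + p.2 1 ^ 2) + p.2 2) - 2 * a₂ * A p * (p.2 0 ^ 2 + p.2 1 ^ 2)
        - ph V.1 2 p) = 0 ∧
      - p.2 1 * (dd (eB 0) A p - baseLap a₁ B p - a₃ * τ' p) + p.2 0 * (dd (eB 0) B p
        - τ' p * (a₂ * (p.2 0 ^ 2 + p.2 1 ^ 2) + p.2 2) - 2 * a₂ * A p * (p.2 0 ^ 2 + p.2 1 ^ 2)
        - ph V.1 2 p) = 0 := fun p hp => by
    have z := Z hp
    have f11 : dd (eF 1) (ph V.1 1) p = A p := (L hp hi).1.1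
    have f10 : dd (eF 0) (ph V.1 1) p = - B p := (L hp hi).1.2.1
    simp only [Fin.sum_univ_three, ← hA, ← hB, f11, f10, LB0 p hp, LB1 p hp, d0 0 p hp,
      d1 0 p hp] at z
    simp [timeEntries, lineD2] at z
    rw [ph_zero p hp, ph_one p hp] at z
    constructor
    · linear_combination z.1
    · linear_combination z.2.1
  have sBL : ContinuousOn (baseLap a₁ B) (U : Set Pt) := by
    have := fun i => (dd_smoothOn U.isOpen (dd_smoothOn U.isOpen sB (eB i)) (eB i)).continuousOn
    exact ((this 1).add (continuousOn_const.mul (this 2))).add (this 3)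
  have hX : ∀ p ∈ U, dd (eB 0) A p - baseLap a₁ B p - a₃ * τ' p = 0 := by
    refine eq_zero_of_eq_zero_off_axis (((dd_smoothOn U.isOpen sA _).continuousOn.sub sBL).sub
      (continuousOn_const.mul sτ'.continuousOn)) fun p hp hu => ?_
    have hpos : p.2 0 ^ 2 + p.2 1 ^ 2 ≠ 0 := by positivity
    refine (mul_eq_zero.1 (show (p.2 0 ^ 2 + p.2 1 ^ 2) * _ = 0 from ?_)).resolve_left hpos
    linear_combination p.2 0 * (E p hp).1 - p.2 1 * (E p hp).2
  have hY : ∀ p ∈ U, ph V.1 2 p = dd (eB 0) B p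
        - τ' p * (a₂ * (p.2 0 ^ 2 + p.2 1 ^ 2) + p.2 2)
        - A p * (2 * a₂ * (p.2 0 ^ 2 + p.2 1 ^ 2)) := by
    suffices h : ∀ p ∈ U, dd (eB 0) B p - τ' p * (a₂ * (p.2 0 ^ 2 + p.2 1 ^ 2) + p.2 2)
        - A p * (2 * a₂ * (p.2 0 ^ 2 + p.2 1 ^ 2)) - ph V.1 2 p = 0 from
      fun p hp => by linear_combination -h p hp
    refine eq_zero_of_eq_zero_off_axis (ContinuousOn.sub (ContinuousOn.sub (ContinuousOn.sub
      sB0.continuousOn (sτ'.continuousOn.mul (by fun_prop)))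
      (sA.continuousOn.mul (by fun_prop))) (sφ 2).continuousOn) fun p hp hu => ?_
    refine (mul_eq_zero.1 (show p.2 0 * _ = 0 from ?_)).resolve_left hu
    linear_combination (E p hp).2 + p.2 1 * hX p hp
  -- differentiation with respect to `w` compares the two weights
  have time : ∀ p ∈ U, τ' p = -2 * A p := fun p hp => by
    have e := w22 p hp
    have dB0 := smoothOn_differentiableAt U.isOpen sB0 hp
    have dτ' := smoothOn_differentiableAt U.isOpen sτ' hp
    have dA := smoothOn_differentiableAt U.isOpen sA hp
    rw [dd_congr U.isOpen hY _ p hp, dd_sub, dd_sub, dd_mul, dd_mul,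
      dd_dd_of_eq_zero' sB (fib_B 2) _ hp, dd_dd_of_eq_zero' (sσ 0) (hfib 0 2) _ hp,
      fib_A 2 p hp] at e
    · have c1 : dd (eF 2) (fun q : Pt => a₂ * (q.2 0 ^ 2 + q.2 1 ^ 2) + q.2 2) p = 1 := by
        refine dd_eq_of_hasDerivAt (by fun_prop) ?_
        simpa [eF] using (hasDerivAt_id' (0 : ℝ)).const_add (p.2 2)
      have c2 : dd (eF 2) (fun q : Pt => 2 * a₂ * (q.2 0 ^ 2 + q.2 1 ^ 2)) p = 0 := by
        refine dd_eq_of_hasDerivAt (by fun_prop) ?_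
        simpa [eF] using hasDerivAt_const (0 : ℝ) (2 * a₂ * (p.2 0 ^ 2 + p.2 1 ^ 2))
      rw [c1, c2] at e
      linear_combination -e
    all_goals fun_prop
  refine ⟨A, B, sA, sB, fib_A, fib_B, space_A, ph_zero, ph_one, fun p hp => ?_, hproj, time,
    fun i hi p hp => ?_, hcross, hanti, fun i hi p hp => ?_, fun p hp => ?_, fun p hp => ?_⟩
  · rw [hY p hp, time p hp]; ring
  · rw [hdiag i hi p hp]
    linear_combination time p hp / 2
  · have := (L hp hi).2.2.1.2
    linear_combination this
  · linear_combination hX p hp + a₃ * time p hp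
  · have z := (Z hp).2.2
    simp [lineD2, dd0 1 (by decide) p hp, dd0 2 (by decide) p hp, dd0 3 (by decide) p hp,
      dd1 1 (by decide) p hp, dd1 2 (by decide) p hp, dd1 3 (by decide) p hp] at z
    have e : ∀ i, i ≠ 0 → dd (eB i) (dd (eB i) (ph V.1 2)) p =
        dd (eB i) (dd (eB i) (dd (eB 0) B)) p := fun i hi => by
      have h2 : ∀ q ∈ U, ph V.1 2 q = dd (eB 0) B q * 1 + A q * (2 * q.2 2) := fun q hq => by
        rw [hY q hq, time q hq]; ring
      have h3 : ∀ q ∈ U, dd (eB i) (ph V.1 2) q = dd (eB i) (dd (eB 0) B) q := fun q hq => by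
        rw [dd_congr U.isOpen h2 _ q hq]
        have dB0 := smoothOn_differentiableAt U.isOpen sB0 hq
        have dA := smoothOn_differentiableAt U.isOpen sA hq
        rw [dd_add, dd_mul, dd_mul, dd_const_mul, dd_fib_coord, space_A i hi q hq]
        · simp [eB]
        all_goals fun_prop
      rw [dd_congr U.isOpen h3 _ p hp]
    unfold baseLap at z ⊢
    rw [e 1 (by decide), e 2 (by decide), e 3 (by decide)] at z
    linear_combination z

end Determining

section Sufficiency

variable {U : TopologicalSpace.Opens Pt} {a₁ a₂ a₃ b₁ r₁ r₂ : ℝ}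

/-! ### The determining equations are sufficient -/

theorem dd_affine_base {C : Pt → ℝ} {M : Fin 3 → Pt → ℝ} (hC : ContDiffOn ℝ ∞ C (U : Set Pt))
    (hM : ∀ α, ContDiffOn ℝ ∞ (M α) (U : Set Pt)) (i : Fin 4) {p : Pt} (hp : p ∈ U) :
    dd (eB i) (fun q => C q + ∑ α, M α q * q.2 α) p =
      dd (eB i) C p + ∑ α, dd (eB i) (M α) p * p.2 α := by
  have dC := smoothOn_differentiableAt U.isOpen hC hp
  have dM := fun α => smoothOn_differentiableAt U.isOpen (hM α) hp
  have du : ∀ α, DifferentiableAt ℝ (fun q : Pt => q.2 α) p := fun α => by fun_prop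
  rw [dd_add dC (DifferentiableAt.fun_sum fun α _ => (dM α).fun_mul (du α)),
    dd_sum fun α _ => (dM α).fun_mul (du α)]
  congr 1
  refine Finset.sum_congr rfl fun α _ => ?_
  rw [dd_mul (dM α) (du α), dd_fib_coord]
  simp [eB]

theorem dd_affine_fib {C : Pt → ℝ} {M : Fin 3 → Pt → ℝ} (hC : ContDiffOn ℝ ∞ C (U : Set Pt))
    (hM : ∀ α, ContDiffOn ℝ ∞ (M α) (U : Set Pt)) (γ : Fin 3)
    (fC : ∀ p ∈ U, dd (eF γ) C p = 0) (fM : ∀ α, ∀ p ∈ U, dd (eF γ) (M α) p = 0)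
    {p : Pt} (hp : p ∈ U) :
    dd (eF γ) (fun q => C q + ∑ α, M α q * q.2 α) p = M γ p := by
  have dC := smoothOn_differentiableAt U.isOpen hC hp
  have dM := fun α => smoothOn_differentiableAt U.isOpen (hM α) hp
  have du : ∀ α, DifferentiableAt ℝ (fun q : Pt => q.2 α) p := fun α => by fun_prop
  rw [dd_add dC (DifferentiableAt.fun_sum fun α _ => (dM α).fun_mul (du α)),
    dd_sum fun α _ => (dM α).fun_mul (du α), fC p hp, zero_add, Finset.sum_eq_single γ]
  · rw [dd_mul (dM _) (du _), dd_fib_coord, fM _ p hp]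
    simp [eF]
  · intro α _ hα
    rw [dd_mul (dM _) (du _), dd_fib_coord, fM _ p hp]
    simp [eF, hα]
  · simp

/-- Total derivatives of a function that is affine in `u, v, w`. -/
theorem totalD_affine {C : Pt → ℝ} {M : Fin 3 → Pt → ℝ} (hC : ContDiffOn ℝ ∞ C (U : Set Pt))
    (hM : ∀ α, ContDiffOn ℝ ∞ (M α) (U : Set Pt))
    (fC : ∀ γ, ∀ p ∈ U, dd (eF γ) C p = 0) (fM : ∀ γ α, ∀ p ∈ U, dd (eF γ) (M α) p = 0)
    {f : Pt → ℝ} (hf : ∀ p ∈ U, f p = C p + ∑ α, M α p * p.2 α) (i : Fin 4) (j : Jet2)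
    (hj : j.1.1 ∈ U) :
    totalD0 i f j.1 = dd (eB i) C j.1.1 +
      ∑ α, (dd (eB i) (M α) j.1.1 * j.1.1.2 α + M α j.1.1 * j.1.2 α i) ∧
    totalD2 i i f j = dd (eB i) (dd (eB i) C) j.1.1 +
      ∑ α, (dd (eB i) (dd (eB i) (M α)) j.1.1 * j.1.1.2 α
        + 2 * dd (eB i) (M α) j.1.1 * j.1.2 α i + M α j.1.1 * j.2 α i i) := by
  have sCi := dd_smoothOn U.isOpen hC (eB i)
  have sMi := fun α => dd_smoothOn U.isOpen (hM α) (eB i)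
  have eb : ∀ p ∈ U, dd (eB i) f p = dd (eB i) C p + ∑ α, dd (eB i) (M α) p * p.2 α :=
    fun p hp => by rw [dd_congr U.isOpen hf _ p hp, dd_affine_base hC hM i hp]
  have ef : ∀ γ, ∀ p ∈ U, dd (eF γ) f p = M γ p :=
    fun γ p hp => by rw [dd_congr U.isOpen hf _ p hp, dd_affine_fib hC hM γ (fC γ) (fM γ) hp]
  have ebf : ∀ γ, ∀ p ∈ U, dd (eF γ) (dd (eB i) f) p = dd (eB i) (M γ) p := fun γ p hp => by
    rw [dd_congr U.isOpen eb _ p hp, dd_affine_fib sCi sMi γ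
      (fun q hq => dd_dd_of_eq_zero' hC (fC γ) _ hq)
      (fun α q hq => dd_dd_of_eq_zero' (hM α) (fM γ α) _ hq) hp]
  have ebb : ∀ p ∈ U, dd (eB i) (dd (eB i) f) p =
      dd (eB i) (dd (eB i) C) p + ∑ α, dd (eB i) (dd (eB i) (M α)) p * p.2 α := fun p hp => by
    rw [dd_congr U.isOpen eb _ p hp, dd_affine_base sCi sMi i hp]
  have efb : ∀ γ, ∀ p ∈ U, dd (eB i) (dd (eF γ) f) p = dd (eB i) (M γ) p := fun γ p hp => by
    rw [dd_congr U.isOpen (ef γ) _ p hp]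
  have eff : ∀ γ δ, ∀ p ∈ U, dd (eF δ) (dd (eF γ) f) p = 0 := fun γ δ p hp => by
    rw [dd_congr U.isOpen (ef γ) _ p hp, fM δ γ p hp]
  constructor
  · simp only [totalD0_eq, eb _ hj, ef _ _ hj, Fin.sum_univ_three]
    ring
  · simp only [totalD2, totalD0_eq, ebb _ hj, ef _ _ hj, ebf _ _ hj, efb _ _ hj, eff _ _ _ hj,
      Fin.sum_univ_three]
    ring

namespace Determined

variable {V : VField U} {A B : Pt → ℝ} (h : Determined a₁ a₃ b₁ V A B)
include h

/-- The second derivatives of the base coefficients in one spatial direction vanish. -/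
theorem dd_dd_sg (i l : Fin 4) (hi : i ≠ 0) {p : Pt} (hp : p ∈ U) :
    dd (eB i) (dd (eB i) (sg V.1 l)) p = 0 := by
  have sσ := fun l => sg_smooth V.2.1 l
  have hd : ∀ k m, k ≠ 0 → m ≠ 0 → dd (eB m) (dd (eB k) (sg V.1 k)) p = 0 := fun k m hk hm => by
    rw [dd_congr U.isOpen (h.diag k hk) _ p hp, dd_neg, h.space_A m hm p hp, neg_zero]
  have h13 : ∀ p ∈ U, dd (eB 3) (sg V.1 1) p = - dd (eB 1) (sg V.1 3) p := fun p hp => by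
    linear_combination h.anti p hp
  have h31 : ∀ p ∈ U, dd (eB 1) (sg V.1 3) p = - dd (eB 3) (sg V.1 1) p := fun p hp => by
    linear_combination h.anti p hp
  by_cases hl : l = 0
  · subst hl
    exact dd_dd_of_eq_zero (h.proj.time i hi) _ hp
  by_cases hil : i = l
  · subst hil
    exact hd i i hi hi
  have c := h.cross
  fin_cases i
  · exact absurd rfl hi
  all_goals fin_cases l
  all_goals first
    | exact absurd rfl hl
    | exact absurd rfl hil
    | exact dd_dd_of_eq_zero (fun q hq => (c q hq).1) _ hp
    | exact dd_dd_of_eq_zero (fun q hq => (c q hq).2.1) _ hp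
    | exact dd_dd_of_eq_zero (fun q hq => (c q hq).2.2.1) _ hp
    | exact dd_dd_of_eq_zero (fun q hq => (c q hq).2.2.2) _ hp
    | skip
  · change dd (eB 1) (dd (eB 1) (sg V.1 3)) p = 0
    rw [dd_congr U.isOpen h31 _ p hp, dd_neg, dd_comm U.isOpen (sσ 1) _ _ p hp,
      hd 1 3 (by decide) (by decide), neg_zero]
  · change dd (eB 3) (dd (eB 3) (sg V.1 1)) p = 0
    rw [dd_congr U.isOpen h13 _ p hp, dd_neg, dd_comm U.isOpen (sσ 3) _ _ p hp,
      hd 3 1 (by decide) (by decide), neg_zero]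

/-- The first and second prolongation coefficients of a field satisfying the determining equations,
for a component `φ_α = C + ∑ M_β u^β`. -/
theorem prol_affine {C : Pt → ℝ} {M : Fin 3 → Pt → ℝ} (hC : ContDiffOn ℝ ∞ C (U : Set Pt))
    (hM : ∀ α, ContDiffOn ℝ ∞ (M α) (U : Set Pt))
    (fC : ∀ γ, ∀ p ∈ U, dd (eF γ) C p = 0) (fM : ∀ γ α, ∀ p ∈ U, dd (eF γ) (M α) p = 0)
    {α : Fin 3} (hf : ∀ p ∈ U, ph V.1 α p = C p + ∑ β, M β p * p.2 β) (i : Fin 4) (j : Jet2)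
    (hj : j.1.1 ∈ U) (hs : ∀ α i k, j.2 α i k = j.2 α k i) :
    (prol1 V.1 α i j.1 = dd (eB i) C j.1.1 +
      ∑ β, (dd (eB i) (M β) j.1.1 * j.1.1.2 β + M β j.1.1 * j.1.2 β i)
      - ∑ l, dd (eB i) (sg V.1 l) j.1.1 * j.1.2 α l) ∧
    (i ≠ 0 → prol2 V.1 α i i j = dd (eB i) (dd (eB i) C) j.1.1 +
      ∑ β, (dd (eB i) (dd (eB i) (M β)) j.1.1 * j.1.1.2 β
        + 2 * dd (eB i) (M β) j.1.1 * j.1.2 β i + M β j.1.1 * j.2 β i i)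
      - 2 * ∑ l, dd (eB i) (sg V.1 l) j.1.1 * j.2 α i l) := by
  obtain ⟨e0, e2⟩ := totalD_affine hC hM fC fM hf i j hj
  constructor
  · rw [← e0]
    change _ - _ = _
    congr 1
    refine Finset.sum_congr rfl fun l _ => ?_
    rw [← h.proj.totalD0_eq_dd i l j.1 hj]
    rfl
  · intro hi
    rw [prol2_diag U.isOpen V.2.1 α i j hj hs, e2, Finset.mul_sum]
    congr 1
    refine Finset.sum_congr rfl fun l _ => ?_
    rw [h.proj.totalD0_eq_dd i l j.1 hj, h.proj.totalD2_eq_dd i l j hj, h.dd_dd_sg i l hi hj]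
    ring

/-- The solutions of the determining equations are symmetry generators: the prolonged field maps
each equation to a linear combination of the equations. -/
theorem isSymmetryGenerator : IsSymmetryGenerator (genSystem a₁ a₂ a₃ b₁ r₁ r₂) V := by
  intro j hj hs hΔ
  have sA := h.smooth_A
  have sB := h.smooth_B
  have fz : ∀ γ, ∀ p ∈ U, dd (eF γ) (fun _ : Pt => (0 : ℝ)) p = 0 := fun γ p _ => dd_const _ _ _
  have nB : ∀ p ∈ U, ∀ v, dd v (fun p => - B p) p = - dd v B p := fun p hp v => dd_neg
  have A2 : ∀ p ∈ U, ∀ v, dd v (fun p => 2 * A p) p = 2 * dd v A p := fun p hp v =>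
    dd_const_mul _ (smoothOn_differentiableAt U.isOpen sA hp)
  have p0 := h.prol_affine (C := fun _ => 0) (M := ![A, B, fun _ => 0]) (α := 0)
    contDiffOn_const (fun α => by fin_cases α; exacts [sA, sB, contDiffOn_const]) fz
    (fun γ α => by fin_cases α; exacts [h.fib_A γ, h.fib_B γ, fz γ])
    (fun p hp => by rw [h.ph_zero p hp]; simp [Fin.sum_univ_three])
  have p1 := h.prol_affine (C := fun _ => 0) (M := ![fun p => - B p, A, fun _ => 0]) (α := 1)
    contDiffOn_const (fun α => by fin_cases α; exacts [sB.neg, sA, contDiffOn_const]) fz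
    (fun γ α => by
      fin_cases α
      exacts [fun p hp => by simp [nB p hp, h.fib_B γ p hp], h.fib_A γ, fz γ])
    (fun p hp => by rw [h.ph_one p hp]; simp [Fin.sum_univ_three]; ring)
  have p2 := h.prol_affine (C := dd (eB 0) B) (M := ![fun _ => 0, fun _ => 0, fun p => 2 * A p])
    (α := 2) (dd_smoothOn U.isOpen sB _)
    (fun α => by
      fin_cases α
      exacts [contDiffOn_const, contDiffOn_const, contDiffOn_const.mul sA])
    (fun γ p hp => dd_dd_of_eq_zero' sB (h.fib_B γ) _ hp)
    (fun γ α => by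
      fin_cases α
      exacts [fz γ, fz γ, fun p hp => by simp [A2 p hp, h.fib_A γ p hp]])
    (fun p hp => by rw [h.ph_two p hp]; simp [Fin.sum_univ_three])
  have sA1 := h.space_A 1 (by decide) _ hj
  have sA2 := h.space_A 2 (by decide) _ hj
  have sA3 := h.space_A 3 (by decide) _ hj
  have z1 : ∀ v, dd v (dd (eB 1) A) j.1.1 = 0 := fun v =>
    dd_dd_of_eq_zero (h.space_A 1 (by decide)) _ hj
  have z2 : ∀ v, dd v (dd (eB 2) A) j.1.1 = 0 := fun v =>
    dd_dd_of_eq_zero (h.space_A 2 (by decide)) _ hj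
  have z3 : ∀ v, dd v (dd (eB 3) A) j.1.1 = 0 := fun v =>
    dd_dd_of_eq_zero (h.space_A 3 (by decide)) _ hj
  have nBB : ∀ v w, dd v (dd w (fun p => - B p)) j.1.1 = - dd v (dd w B) j.1.1 := fun v w => by
    rw [dd_congr U.isOpen (fun q hq => nB q hq w) _ _ hj, dd_neg]
  have AAA : ∀ v w, dd v (dd w (fun p => 2 * A p)) j.1.1 = 2 * dd v (dd w A) j.1.1 := fun v w => by
    rw [dd_congr U.isOpen (fun q hq => A2 q hq w) _ _ hj,
      dd_const_mul _ (smoothOn_differentiableAt U.isOpen (dd_smoothOn U.isOpen sA w) hj)]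
  have zz : ∀ v w, dd v (dd w (fun _ : Pt => (0 : ℝ))) j.1.1 = 0 := fun v w => by
    rw [dd_congr U.isOpen (fun q _ => dd_const w 0 q) _ _ hj, dd_const]
  have t1 := h.proj.time 1 (by decide) _ hj
  have t2 := h.proj.time 2 (by decide) _ hj
  have t3 := h.proj.time 3 (by decide) _ hj
  have t0 := h.time _ hj
  have g1 := h.diag 1 (by decide) _ hj
  have g2 := h.diag 2 (by decide) _ hj
  have g3 := h.diag 3 (by decide) _ hj
  obtain ⟨c1, c2, c3, c4⟩ := h.cross _ hj
  have an : dd (eB 3) (sg V.1 1) j.1.1 = - dd (eB 1) (sg V.1 3) j.1.1 := by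
    linear_combination h.anti _ hj
  have d1 := h.drift 1 (by decide) _ hj
  have d2 := h.drift 2 (by decide) _ hj
  have d3 := h.drift 3 (by decide) _ hj
  have hS := h.schrodinger _ hj
  have hL := h.laplace _ hj
  have e0 := fun i => (p0 i j hj hs).1
  have e1 := fun i => (p1 i j hj hs).1
  have f01 := (p0 1 j hj hs).2 (by decide)
  have f02 := (p0 2 j hj hs).2 (by decide)
  have f03 := (p0 3 j hj hs).2 (by decide)
  have f11 := (p1 1 j hj hs).2 (by decide)
  have f12 := (p1 2 j hj hs).2 (by decide)
  have f13 := (p1 3 j hj hs).2 (by decide)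
  have f21 := (p2 1 j hj hs).2 (by decide)
  have f22 := (p2 2 j hj hs).2 (by decide)
  have f23 := (p2 3 j hj hs).2 (by decide)
  have e00 := e0 0
  have e01 := e0 1
  have e02 := e0 2
  have e03 := e0 3
  have e10 := e1 0
  have e11 := e1 1
  have e12 := e1 2
  have e13 := e1 3
  clear p0 p1 p2 e0 e1
  have symm31 := fun α => hs α 3 1
  have q0 := h.ph_zero _ hj
  have q1 := h.ph_one _ hj
  have q2 := h.ph_two _ hj
  simp [Fin.sum_univ_three, Fin.sum_univ_four, sA1, sA2, sA3, z1, z2, z3, nBB, AAA, zz, nB _ hj,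
    A2 _ hj, t0, t1, t2, t3, g1, g2, g3, c1, c2, c3, c4, an, d1, d2, d3, lapCoeff, symm31]
    at f01 f02 f03 f11 f12 f13 f21 f22 f23 e00 e01 e02 e03 e10 e11 e12 e13
  have E1 := hΔ 0
  have E2 := hΔ 1
  have E3 := hΔ 2
  simp [genSystem, schrodingerIm, lap] at E1
  simp [genSystem, schrodingerRe, lap] at E2
  simp [genSystem, rho2, lap] at E3
  unfold baseLap at hS hL
  have key := symmetry_of_equations (a₁ := a₁) (a₂ := a₂) (a₃ := a₃) (b₁ := b₁) (r₁ := r₁)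
    (r₂ := r₂) V.1 j
  rw [f01, f02, f03, f11, f12, f13, f21, f22, f23, e00, e01, e02, e03, e10, e11, e12, e13,
    q0, q1, q2] at key
  refine key ?_ ?_ ?_
  · linear_combination 3 * A j.1.1 * E1 - B j.1.1 * E2 + j.1.1.2 0 * hS
  · linear_combination 3 * A j.1.1 * E2 + B j.1.1 * E1 - j.1.1.2 1 * hS
  · linear_combination 4 * A j.1.1 * E3 + hL

end Determined

/-- The symmetry generators are the solutions of the determining equations. -/
theorem isSymmetryGenerator_iff (ha₁ : a₁ ≠ 0) (hb₁ : b₁ ≠ 0)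
    (hr : (r₁ ≠ 0 ∧ r₂ = 0) ∨ (r₁ = 0 ∧ r₂ ≠ 0)) (V : VField U) :
    IsSymmetryGenerator (genSystem a₁ a₂ a₃ b₁ r₁ r₂) V ↔
      ∃ A B, Determined a₁ a₃ b₁ V A B :=
  ⟨exists_determined ha₁ hb₁ hr V, fun ⟨_, _, h⟩ => h.isSymmetryGenerator⟩

end Sufficiency

/-! ### Functions of the time on a convex open set -/

section Time

variable {U : TopologicalSpace.Opens Pt}

theorem times_isOpen (U : TopologicalSpace.Opens Pt) : IsOpen (times U) := by
  have h : IsOpenMap fun p : Pt => p.1 0 :=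
    (isOpenMap_eval (X := fun _ : Fin 4 => ℝ) 0).comp isOpenMap_fst
  exact h _ U.isOpen

theorem mem_times {p : Pt} (hp : p ∈ U) : p.1 0 ∈ times U := ⟨p, hp, rfl⟩

theorem times_convex (hU : Convex ℝ (U : Set Pt)) : Convex ℝ (times U) :=
  hU.is_linear_image (f := fun p : Pt => p.1 0) ⟨fun _ _ => rfl, fun _ _ => rfl⟩

theorem deriv_smoothOn {I : Set ℝ} (hI : IsOpen I) {f : ℝ → ℝ} (hf : ContDiffOn ℝ ∞ f I) :
    ContDiffOn ℝ ∞ (deriv f) I :=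
  hf.deriv_of_isOpen hI (by simp)

theorem smoothOn_hasDerivAt {I : Set ℝ} (hI : IsOpen I) {f : ℝ → ℝ} (hf : ContDiffOn ℝ ∞ f I)
    {t : ℝ} (ht : t ∈ I) : HasDerivAt f (deriv f t) t :=
  (smoothOn_differentiableAt hI hf ht).hasDerivAt

theorem deriv_congr {I : Set ℝ} (hI : IsOpen I) {f g : ℝ → ℝ} (h : ∀ t ∈ I, f t = g t) :
    ∀ t ∈ I, deriv f t = deriv g t := fun t ht => by
  have : f =ᶠ[nhds t] g := by
    filter_upwards [hI.mem_nhds ht] with s hs using h s hs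
  exact this.deriv_eq

theorem smoothOn_comp_time {f : ℝ → ℝ} (hf : ContDiffOn ℝ ∞ f (times U)) :
    ContDiffOn ℝ ∞ (fun p : Pt => f (p.1 0)) (U : Set Pt) :=
  hf.comp (t := times U) (by fun_prop) fun _ hp => mem_times hp

theorem dd_time {f : ℝ → ℝ} (hf : ContDiffOn ℝ ∞ f (times U)) (v : Pt) {p : Pt} (hp : p ∈ U) :
    dd v (fun q : Pt => f (q.1 0)) p = v.1 0 * deriv f (p.1 0) := by
  refine dd_eq_of_hasDerivAt
    (smoothOn_differentiableAt U.isOpen (smoothOn_comp_time hf) hp) ?_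
  have h1 : HasDerivAt (fun s : ℝ => p.1 0 + s * v.1 0) (v.1 0) 0 := by
    simpa using ((hasDerivAt_id (0 : ℝ)).mul_const (v.1 0)).const_add (p.1 0)
  have h2 := smoothOn_hasDerivAt (times_isOpen U) hf (mem_times hp)
  have h3 : HasDerivAt f (deriv f (p.1 0)) (p.1 0 + (0 : ℝ) * v.1 0) := by simpa using h2
  have := h3.comp (0 : ℝ) h1
  rw [mul_comm]
  exact this

theorem pt_eq_sum (v : Pt) : v = ∑ i, v.1 i • eB i + ∑ α, v.2 α • eF α := by
  refine Prod.ext ?_ ?_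
  · funext i
    fin_cases i <;> simp [eB, eF, Fin.sum_univ_four, Fin.sum_univ_three]
  · funext α
    fin_cases α <;> simp [eB, eF, Fin.sum_univ_four, Fin.sum_univ_three]

theorem dd_eq_sum (f : Pt → ℝ) (v p : Pt) :
    dd v f p = ∑ i, v.1 i * dd (eB i) f p + ∑ α, v.2 α * dd (eF α) f p := by
  conv_lhs => rw [pt_eq_sum v]
  simp only [dd, map_add, map_sum, map_smul, smul_eq_mul]

/-- A function whose derivative in the direction `q - p` vanishes takes the same value at `p` and
`q`. -/
theorem eq_of_dd_eq_zero (hU : Convex ℝ (U : Set Pt)) {f : Pt → ℝ}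
    (hf : ContDiffOn ℝ ∞ f (U : Set Pt)) {p q : Pt} (hp : p ∈ U) (hq : q ∈ U)
    (h : ∀ x ∈ U, dd (q - p) f x = 0) : f q = f p := by
  have hmem : ∀ s ∈ Set.Icc (0 : ℝ) 1, p + s • (q - p) ∈ U := fun s hs =>
    hU.add_smul_sub_mem hp hq hs
  have hd : ∀ s ∈ Set.Icc (0 : ℝ) 1, HasDerivAt (fun s : ℝ => f (p + s • (q - p))) 0 s := by
    intro s hs
    have h1 := (smoothOn_differentiableAt U.isOpen hf (hmem s hs)).hasFDerivAt
    have h2 : HasDerivAt (fun s : ℝ => p + s • (q - p)) (q - p) s := by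
      simpa using ((hasDerivAt_id s).smul_const (q - p)).const_add p
    have h3 := h1.comp_hasDerivAt s h2
    have h4 : fderiv ℝ f (p + s • (q - p)) (q - p) = 0 := h _ (hmem s hs)
    rwa [h4] at h3
  have := constant_of_has_deriv_right_zero (f := fun s : ℝ => f (p + s • (q - p))) (a := 0)
    (b := 1) (fun s hs => (hd s hs).continuousAt.continuousWithinAt)
    (fun s hs => (hd s ⟨hs.1, hs.2.le⟩).hasDerivWithinAt) 1 (by simp)
  simpa using this

/-- A function whose derivatives vanish in all directions but that of the time is a smooth function
of the time. -/
theorem exists_time_function (hU : Convex ℝ (U : Set Pt)) {f : Pt → ℝ}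
    (hf : ContDiffOn ℝ ∞ f (U : Set Pt)) (hb : ∀ i, i ≠ 0 → ∀ p ∈ U, dd (eB i) f p = 0)
    (hF : ∀ α, ∀ p ∈ U, dd (eF α) f p = 0) :
    ∃ g : ℝ → ℝ, ContDiffOn ℝ ∞ g (times U) ∧ ∀ p ∈ U, f p = g (p.1 0) := by
  classical
  have hpq : ∀ p ∈ U, ∀ q ∈ U, q.1 0 = p.1 0 → f q = f p := fun p hp q hq e => by
    refine eq_of_dd_eq_zero hU hf hp hq fun x hx => ?_
    rw [dd_eq_sum]
    have h1 : ∀ i, (q - p).1 i * dd (eB i) f x = 0 := fun i => by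
      by_cases hi : i = 0
      · subst hi; simp [e]
      · rw [hb i hi x hx, mul_zero]
    simp only [h1, hF _ x hx]
    simp
  choose! c hcU hct using fun t (ht : t ∈ times U) => (ht : ∃ p, p ∈ U ∧ p.1 0 = t)
  have hg : ∀ p ∈ U, f p = f (c (p.1 0)) := fun p hp =>
    hpq _ (hcU _ (mem_times hp)) _ hp (hct _ (mem_times hp)).symm
  refine ⟨fun t => f (c t), fun t ht => ?_, hg⟩
  have hl : ContDiff ℝ ∞ fun s : ℝ => c t + (s - t) • eB 0 := by fun_prop
  have h0 : c t + (t - t) • eB 0 = c t := by simp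
  have hfc : ContDiffAt ℝ ∞ f (c t + (t - t) • eB 0) := by
    rw [h0]; exact hf.contDiffAt (U.isOpen.mem_nhds (hcU t ht))
  have hcomp : ContDiffAt ℝ ∞ (fun s : ℝ => f (c t + (s - t) • eB 0)) t :=
    hfc.comp t hl.contDiffAt
  refine (hcomp.congr_of_eventuallyEq ?_).contDiffWithinAt
  have : ∀ᶠ s in nhds t, c t + (s - t) • eB 0 ∈ U := by
    refine hl.continuous.continuousAt.eventually_mem ?_
    rw [h0]; exact U.isOpen.mem_nhds (hcU t ht)
  filter_upwards [this] with s hs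
  have := hg _ hs
  have e : (c t + (s - t) • eB 0).1 0 = s := by simp [eB, hct t ht]
  rw [e] at this
  exact this.symm

/-- A function all of whose derivatives vanish is constant. -/
theorem exists_const (hU : Convex ℝ (U : Set Pt)) {f : Pt → ℝ}
    (hf : ContDiffOn ℝ ∞ f (U : Set Pt)) (hb : ∀ i, ∀ p ∈ U, dd (eB i) f p = 0)
    (hF : ∀ α, ∀ p ∈ U, dd (eF α) f p = 0) : ∃ c : ℝ, ∀ p ∈ U, f p = c := by
  by_cases hne : ∃ p, p ∈ U
  · obtain ⟨p, hp⟩ := hne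
    refine ⟨f p, fun q hq => eq_of_dd_eq_zero hU hf hp hq fun x hx => ?_⟩
    rw [dd_eq_sum]
    simp [hb _ x hx, hF _ x hx]
  · exact ⟨0, fun p hp => absurd ⟨p, hp⟩ hne⟩

end Time

/-! ### The explicit solutions of the determining equations -/

section Explicit

variable {U : TopologicalSpace.Opens Pt} {a₁ a₂ a₃ b₁ r₁ r₂ : ℝ}

/-- The phase coefficient `-(τ''/8) (x² + y²/a₁ + z²) - (x/2) g' - (y/(2a₁)) h' - (z/2) k' + m`. -/
def phase (a₁ : ℝ) (τ g h k m : ℝ → ℝ) (p : Pt) : ℝ :=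
  -(deriv (deriv τ) (p.1 0) / 8) * (p.1 1 ^ 2 + p.1 2 ^ 2 / a₁ + p.1 3 ^ 2)
    - p.1 1 / 2 * deriv g (p.1 0) - p.1 2 / (2 * a₁) * deriv h (p.1 0)
    - p.1 3 / 2 * deriv k (p.1 0) + m (p.1 0)

/-- The coefficient `(τ'/2) x_i + c x_l + g` of a base direction. -/
def slope (τ : ℝ → ℝ) (c : ℝ) (g : ℝ → ℝ) (i l : Fin 4) (p : Pt) : ℝ :=
  deriv τ (p.1 0) / 2 * p.1 i + c * p.1 l + g (p.1 0)

/-- The vector field `τ ∂_t + (τ'/2) (x ∂_x + y ∂_y + z ∂_z) + c (z ∂_x - x ∂_z)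
+ g ∂_x + h ∂_y + k ∂_z - (τ'/2) (u ∂_u + v ∂_v) + B (v ∂_u - u ∂_v) + (B_t - τ' w) ∂_w`, where `B`
is the phase coefficient.  All the fields of the statement are of this form. -/
def genField (a₁ : ℝ) (τ : ℝ → ℝ) (c : ℝ) (g h k m : ℝ → ℝ) (p : Pt) : Pt :=
  (![τ (p.1 0), slope τ c g 1 3 p, slope τ 0 h 2 2 p, slope τ (-c) k 3 1 p],
   ![-(deriv τ (p.1 0) / 2) * p.2 0 + phase a₁ τ g h k m p * p.2 1,
     -(deriv τ (p.1 0) / 2) * p.2 1 - phase a₁ τ g h k m p * p.2 0,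
     phase a₁ (deriv τ) (deriv g) (deriv h) (deriv k) (deriv m) p - deriv τ (p.1 0) * p.2 2])

/-- The parameters of `genField` are smooth on `I`. -/
structure SmoothParams (I : Set ℝ) (τ g h k m : ℝ → ℝ) : Prop where
  τ : ContDiffOn ℝ ∞ τ I
  g : ContDiffOn ℝ ∞ g I
  h : ContDiffOn ℝ ∞ h I
  k : ContDiffOn ℝ ∞ k I
  m : ContDiffOn ℝ ∞ m I

theorem SmoothParams.deriv {I : Set ℝ} (hI : IsOpen I) {τ g h k m : ℝ → ℝ}
    (H : SmoothParams I τ g h k m) :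
    SmoothParams I (deriv τ) (deriv g) (deriv h) (deriv k) (deriv m) :=
  ⟨deriv_smoothOn hI H.τ, deriv_smoothOn hI H.g, deriv_smoothOn hI H.h, deriv_smoothOn hI H.k,
    deriv_smoothOn hI H.m⟩

theorem coord_smooth (i : Fin 4) : ContDiffOn ℝ ∞ (fun p : Pt => p.1 i) (U : Set Pt) := by
  fun_prop

theorem slope_smooth {τ g : ℝ → ℝ} (hτ : ContDiffOn ℝ ∞ τ (times U))
    (hg : ContDiffOn ℝ ∞ g (times U)) (c : ℝ) (i l : Fin 4) :
    ContDiffOn ℝ ∞ (slope τ c g i l) (U : Set Pt) := by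
  have h1 := smoothOn_comp_time (deriv_smoothOn (times_isOpen U) hτ)
  have h2 := smoothOn_comp_time hg
  exact (((h1.div_const 2).mul (coord_smooth i)).add (contDiffOn_const.mul (coord_smooth l))).add h2

theorem phase_smooth (a₁ : ℝ) {τ g h k m : ℝ → ℝ} (H : SmoothParams (times U) τ g h k m) :
    ContDiffOn ℝ ∞ (phase a₁ τ g h k m) (U : Set Pt) := by
  have hI := times_isOpen U
  have h1 := smoothOn_comp_time (deriv_smoothOn hI (deriv_smoothOn hI H.τ))
  have h2 := smoothOn_comp_time (deriv_smoothOn hI H.g)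
  have h3 := smoothOn_comp_time (deriv_smoothOn hI H.h)
  have h4 := smoothOn_comp_time (deriv_smoothOn hI H.k)
  have h5 := smoothOn_comp_time H.m
  have hq : ContDiffOn ℝ ∞ (fun p : Pt => p.1 1 ^ 2 + p.1 2 ^ 2 / a₁ + p.1 3 ^ 2) (U : Set Pt) := by
    fun_prop
  exact ((((((h1.div_const 8).neg).mul hq).sub (((coord_smooth 1).div_const 2).mul h2)).sub
    (((coord_smooth 2).div_const (2 * a₁)).mul h3)).sub (((coord_smooth 3).div_const 2).mul h4)).add h5

theorem dd_slope {τ g : ℝ → ℝ} (hτ : ContDiffOn ℝ ∞ τ (times U))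
    (hg : ContDiffOn ℝ ∞ g (times U)) (c : ℝ) (i l : Fin 4) (v : Pt) {p : Pt} (hp : p ∈ U) :
    dd v (slope τ c g i l) p = v.1 0 * (deriv (deriv τ) (p.1 0) / 2 * p.1 i + deriv g (p.1 0))
      + deriv τ (p.1 0) / 2 * v.1 i + c * v.1 l := by
  have s1 := deriv_smoothOn (times_isOpen U) hτ
  have h1 := smoothOn_differentiableAt U.isOpen (smoothOn_comp_time s1) hp
  have h2 := smoothOn_differentiableAt U.isOpen (smoothOn_comp_time hg) hp
  have e : slope τ c g i l = fun p => 1 / 2 * (deriv τ (p.1 0) * p.1 i) + c * p.1 l + g (p.1 0) := by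
    funext q; unfold slope; ring
  rw [e, dd_add, dd_add, dd_const_mul, dd_const_mul, dd_mul, dd_time s1 v hp, dd_time hg v hp,
    dd_base_coord, dd_base_coord]
  · ring
  all_goals first | assumption | fun_prop

theorem dd_phase (a₁ : ℝ) {τ g h k m : ℝ → ℝ} (H : SmoothParams (times U) τ g h k m) (v : Pt)
    {p : Pt} (hp : p ∈ U) :
    dd v (phase a₁ τ g h k m) p =
      v.1 0 * phase a₁ (deriv τ) (deriv g) (deriv h) (deriv k) (deriv m) p
      - v.1 1 * (deriv (deriv τ) (p.1 0) / 4 * p.1 1 + deriv g (p.1 0) / 2)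
      - v.1 2 * (deriv (deriv τ) (p.1 0) / (4 * a₁) * p.1 2 + deriv h (p.1 0) / (2 * a₁))
      - v.1 3 * (deriv (deriv τ) (p.1 0) / 4 * p.1 3 + deriv k (p.1 0) / 2) := by
  have hI := times_isOpen U
  have s1 := deriv_smoothOn hI (deriv_smoothOn hI H.τ)
  have s2 := deriv_smoothOn hI H.g
  have s3 := deriv_smoothOn hI H.h
  have s4 := deriv_smoothOn hI H.k
  have h1 := smoothOn_differentiableAt U.isOpen (smoothOn_comp_time s1) hp
  have h2 := smoothOn_differentiableAt U.isOpen (smoothOn_comp_time s2) hp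
  have h3 := smoothOn_differentiableAt U.isOpen (smoothOn_comp_time s3) hp
  have h4 := smoothOn_differentiableAt U.isOpen (smoothOn_comp_time s4) hp
  have h5 := smoothOn_differentiableAt U.isOpen (smoothOn_comp_time H.m) hp
  have e : phase a₁ τ g h k m = fun p =>
      -1 / 8 * (deriv (deriv τ) (p.1 0) * (p.1 1 * p.1 1 + 1 / a₁ * (p.1 2 * p.1 2)
        + p.1 3 * p.1 3))
      - 1 / 2 * (p.1 1 * deriv g (p.1 0)) - 1 / (2 * a₁) * (p.1 2 * deriv h (p.1 0))
      - 1 / 2 * (p.1 3 * deriv k (p.1 0)) + m (p.1 0) := by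
    funext q; unfold phase; ring
  rw [e, dd_add, dd_sub, dd_sub, dd_sub, dd_const_mul, dd_const_mul, dd_const_mul, dd_const_mul,
    dd_mul, dd_mul, dd_mul, dd_mul, dd_add, dd_add, dd_const_mul, dd_mul, dd_mul, dd_mul,
    dd_time s1 v hp, dd_time s2 v hp, dd_time s3 v hp, dd_time s4 v hp, dd_time H.m v hp]
  · simp only [dd_base_coord]
    unfold phase
    ring
  all_goals first | assumption | fun_prop

theorem genField_smooth (a₁ : ℝ) {τ g h k m : ℝ → ℝ} (H : SmoothParams (times U) τ g h k m) (c : ℝ) :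
    ContDiffOn ℝ ∞ (genField a₁ τ c g h k m) (U : Set Pt) := by
  have hI := times_isOpen U
  have h0 := smoothOn_comp_time H.τ
  have h1 := smoothOn_comp_time (deriv_smoothOn hI H.τ)
  have h2 := phase_smooth a₁ H
  have h3 := phase_smooth a₁ (H.deriv hI)
  refine ContDiffOn.prodMk (contDiffOn_pi.2 fun i => ?_) (contDiffOn_pi.2 fun α => ?_)
  · fin_cases i
    · exact h0
    · exact slope_smooth H.τ H.g _ _ _
    · exact slope_smooth H.τ H.h _ _ _
    · exact slope_smooth H.τ H.k _ _ _
  · fin_cases α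
    · change ContDiffOn ℝ ∞ (fun p : Pt => -(deriv τ (p.1 0) / 2) * p.2 0
        + phase a₁ τ g h k m p * p.2 1) _
      fun_prop
    · change ContDiffOn ℝ ∞ (fun p : Pt => -(deriv τ (p.1 0) / 2) * p.2 1
        - phase a₁ τ g h k m p * p.2 0) _
      fun_prop
    · change ContDiffOn ℝ ∞ (fun p : Pt =>
        phase a₁ (deriv τ) (deriv g) (deriv h) (deriv k) (deriv m) p - deriv τ (p.1 0) * p.2 2) _
      fun_prop

/-- The second derivatives of the phase coefficient enter through
`-(τ''/4) (2 + c/a₁)`. -/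
theorem baseLap_phase (ha₁ : a₁ ≠ 0) {τ g h k m : ℝ → ℝ} (H : SmoothParams (times U) τ g h k m)
    (c : ℝ) {p : Pt} (hp : p ∈ U) :
    baseLap c (phase a₁ τ g h k m) p = -(deriv (deriv τ) (p.1 0) / 4) * (2 + c / a₁) := by
  have hI := times_isOpen U
  have s1 := deriv_smoothOn hI H.τ
  have e1 : ∀ q ∈ U, dd (eB 1) (phase a₁ τ g h k m) q = -1 / 2 * slope (deriv τ) 0 (deriv g) 1 1 q :=
    fun q hq => by rw [dd_phase a₁ H _ hq]; simp [eB, slope]; ring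
  have e2 : ∀ q ∈ U, dd (eB 2) (phase a₁ τ g h k m) q =
      -1 / (2 * a₁) * slope (deriv τ) 0 (deriv h) 2 2 q :=
    fun q hq => by rw [dd_phase a₁ H _ hq]; simp [eB, slope]; field_simp; ring
  have e3 : ∀ q ∈ U, dd (eB 3) (phase a₁ τ g h k m) q = -1 / 2 * slope (deriv τ) 0 (deriv k) 3 3 q :=
    fun q hq => by rw [dd_phase a₁ H _ hq]; simp [eB, slope]; ring
  have d := fun {f : ℝ → ℝ} (hf : ContDiffOn ℝ ∞ f (times U)) (i : Fin 4) =>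
    smoothOn_differentiableAt U.isOpen (slope_smooth s1 (deriv_smoothOn hI hf) 0 i i) hp
  unfold baseLap
  rw [dd_congr U.isOpen e1 _ p hp, dd_congr U.isOpen e2 _ p hp, dd_congr U.isOpen e3 _ p hp,
    dd_const_mul _ (d H.g 1), dd_const_mul _ (d H.h 2), dd_const_mul _ (d H.k 3),
    dd_slope s1 (deriv_smoothOn hI H.g) _ _ _ _ hp, dd_slope s1 (deriv_smoothOn hI H.h) _ _ _ _ hp,
    dd_slope s1 (deriv_smoothOn hI H.k) _ _ _ _ hp]
  simp [eB]
  field_simp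
  ring

/-- The explicit fields solve the determining equations, provided that `(2 a₁ + b₁) τ''' = 0`; this
is the equation `laplace` for the term `-(τ''/8) (x² + y²/a₁ + z²)` of the phase coefficient. -/
theorem determined_of_eq_genField (ha₁ : a₁ ≠ 0) {V : VField U} {τ g h k m : ℝ → ℝ} {c : ℝ}
    (H : SmoothParams (times U) τ g h k m)
    (hV : ∀ p ∈ U, V.1 p = genField a₁ τ c g h k m p)
    (hτ : ∀ t ∈ times U, deriv (deriv τ) t = 4 * a₃ * deriv τ t)
    (hb : ∀ t ∈ times U, (2 * a₁ + b₁) * deriv (deriv (deriv τ)) t = 0) :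
    Determined a₁ a₃ b₁ V (fun p => -1 / 2 * deriv τ (p.1 0)) (phase a₁ τ g h k m) := by
  have hI := times_isOpen U
  have s1 := deriv_smoothOn hI H.τ
  have s2 := deriv_smoothOn hI s1
  have H' := H.deriv hI
  have d1 : ∀ p ∈ U, DifferentiableAt ℝ (fun q : Pt => deriv τ (q.1 0)) p := fun p hp =>
    smoothOn_differentiableAt U.isOpen (smoothOn_comp_time s1) hp
  have e0 : ∀ p ∈ U, sg V.1 0 p = τ (p.1 0) := fun p hp => by simp [sg, hV p hp, genField]
  have e1 : ∀ p ∈ U, sg V.1 1 p = slope τ c g 1 3 p := fun p hp => by simp [sg, hV p hp, genField]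
  have e2 : ∀ p ∈ U, sg V.1 2 p = slope τ 0 h 2 2 p := fun p hp => by simp [sg, hV p hp, genField]
  have e3 : ∀ p ∈ U, sg V.1 3 p = slope τ (-c) k 3 1 p := fun p hp => by
    simp [sg, hV p hp, genField]
  have f0 : ∀ v, ∀ p ∈ U, dd v (sg V.1 0) p = _ := fun v p hp =>
    (dd_congr U.isOpen e0 v p hp).trans (dd_time H.τ v hp)
  have f1 : ∀ v, ∀ p ∈ U, dd v (sg V.1 1) p = _ := fun v p hp =>
    (dd_congr U.isOpen e1 v p hp).trans (dd_slope H.τ H.g _ _ _ v hp)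
  have f2 : ∀ v, ∀ p ∈ U, dd v (sg V.1 2) p = _ := fun v p hp =>
    (dd_congr U.isOpen e2 v p hp).trans (dd_slope H.τ H.h _ _ _ v hp)
  have f3 : ∀ v, ∀ p ∈ U, dd v (sg V.1 3) p = _ := fun v p hp =>
    (dd_congr U.isOpen e3 v p hp).trans (dd_slope H.τ H.k _ _ _ v hp)
  have fA : ∀ v, ∀ p ∈ U, dd v (fun p : Pt => -1 / 2 * deriv τ (p.1 0)) p =
      -1 / 2 * (v.1 0 * deriv (deriv τ) (p.1 0)) := fun v p hp => by
    rw [dd_const_mul _ (d1 p hp), dd_time s1 v hp]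
  have hB0 : ∀ p ∈ U, dd (eB 0) (phase a₁ τ g h k m) p =
      phase a₁ (deriv τ) (deriv g) (deriv h) (deriv k) (deriv m) p := fun p hp => by
    rw [dd_phase a₁ H _ hp]; simp [eB]
  refine ⟨contDiffOn_const.mul (smoothOn_comp_time s1), phase_smooth a₁ H, fun α p hp => ?_,
    fun α p hp => ?_, fun i hi p hp => ?_, fun p hp => ?_, fun p hp => ?_, fun p hp => ?_,
    ⟨fun l α p hp => ?_, fun i hi p hp => ?_⟩, fun p hp => ?_, fun i hi p hp => ?_, fun p hp => ?_,
    fun p hp => ?_, fun i hi p hp => ?_, fun p hp => ?_, fun p hp => ?_⟩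
  · rw [fA _ p hp]; simp [eF]
  · rw [dd_phase a₁ H _ hp]; simp [eF]
  · rw [fA _ p hp]; simp [eB, hi]
  · simp [ph, hV p hp, genField]; ring
  · simp [ph, hV p hp, genField]; ring
  · rw [hB0 p hp]; simp [ph, hV p hp, genField]; ring
  · fin_cases l
    · exact (f0 _ p hp).trans (by simp [eF])
    · exact (f1 _ p hp).trans (by simp [eF])
    · exact (f2 _ p hp).trans (by simp [eF])
    · exact (f3 _ p hp).trans (by simp [eF])
  · rw [f0 _ p hp]; simp [eB, hi]
  · rw [f0 _ p hp]; simp [eB]; ring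
  · fin_cases i
    · exact absurd rfl hi
    · exact (f1 _ p hp).trans (by simp [eB]; ring)
    · exact (f2 _ p hp).trans (by simp [eB]; ring)
    · exact (f3 _ p hp).trans (by simp [eB]; ring)
  · rw [f1 _ p hp, f2 _ p hp, f2 _ p hp, f3 _ p hp]
    simp [eB]
  · rw [f1 _ p hp, f3 _ p hp]
    simp [eB]
  · rw [dd_phase a₁ H _ hp]
    fin_cases i
    · exact absurd rfl hi
    · exact (f1 _ p hp).trans (by simp [eB, lapCoeff]; ring)
    · exact (f2 _ p hp).trans (by simp [eB, lapCoeff]; field_simp; ring)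
    · exact (f3 _ p hp).trans (by simp [eB, lapCoeff]; ring)
  · rw [fA _ p hp, baseLap_phase ha₁ H _ hp]
    have := hτ _ (mem_times hp)
    simp [eB]
    field_simp
    linear_combination 2 * this
  · have e : baseLap b₁ (dd (eB 0) (phase a₁ τ g h k m)) p =
        baseLap b₁ (phase a₁ (deriv τ) (deriv g) (deriv h) (deriv k) (deriv m)) p := by
      unfold baseLap
      rw [dd_congr U.isOpen (dd_congr U.isOpen hB0 _) _ p hp,
        dd_congr U.isOpen (dd_congr U.isOpen hB0 _) _ p hp,
        dd_congr U.isOpen (dd_congr U.isOpen hB0 _) _ p hp]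
    rw [e, baseLap_phase ha₁ H' _ hp]
    have := hb _ (mem_times hp)
    field_simp
    linear_combination -this

/-- On a convex open set, the solutions of the determining equations are explicit. -/
theorem Determined.exists_genField (ha₁ : a₁ ≠ 0) (hU : Convex ℝ (U : Set Pt)) {V : VField U}
    {A B : Pt → ℝ} (D : Determined a₁ a₃ b₁ V A B) :
    ∃ (τ : ℝ → ℝ) (c : ℝ) (g h k m : ℝ → ℝ), SmoothParams (times U) τ g h k m ∧
      (∀ p ∈ U, V.1 p = genField a₁ τ c g h k m p) ∧
      (∀ t ∈ times U, deriv (deriv τ) t = 4 * a₃ * deriv τ t) := by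
  have hI := times_isOpen U
  have sσ := fun l => sg_smooth V.2.1 l
  have hfib := D.proj.fib
  obtain ⟨τ, hτ, eτ⟩ := exists_time_function hU (sσ 0) D.proj.time (hfib 0)
  have s1 := deriv_smoothOn hI hτ
  have hA : ∀ p ∈ U, A p = -(deriv τ (p.1 0) / 2) := fun p hp => by
    have h1 := D.time p hp
    rw [dd_congr U.isOpen eτ _ p hp, dd_time hτ _ hp] at h1
    simp [eB] at h1
    linear_combination h1 / 2
  -- the rotation coefficient is constant in time because `B_xz` enters with both signs
  obtain ⟨c, hc⟩ : ∃ c : ℝ, ∀ p ∈ U, dd (eB 3) (sg V.1 1) p = c := by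
    refine exists_const hU (dd_smoothOn U.isOpen (sσ 1) _) (fun i p hp => ?_)
      (fun α p hp => dd_dd_of_eq_zero' (sσ 1) (hfib 1 α) _ hp)
    fin_cases i
    · have h13 : ∀ p ∈ U, dd (eB 3) (sg V.1 1) p = - dd (eB 1) (sg V.1 3) p := fun p hp => by
        linear_combination D.anti p hp
      have dB := fun i => smoothOn_differentiableAt U.isOpen (dd_smoothOn U.isOpen D.smooth_B (eB i)) hp
      have k1 : dd (eB 0) (dd (eB 3) (sg V.1 1)) p = -2 * dd (eB 3) (dd (eB 1) B) p := by
        rw [dd_comm U.isOpen (sσ 1) _ _ p hp,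
          dd_congr U.isOpen (D.drift 1 (by decide)) _ p hp, dd_const_mul _ (dB 1)]
        simp [lapCoeff]
      have k2 : dd (eB 0) (dd (eB 3) (sg V.1 1)) p = 2 * dd (eB 1) (dd (eB 3) B) p := by
        rw [dd_congr U.isOpen h13 _ p hp, dd_neg, dd_comm U.isOpen (sσ 3) _ _ p hp,
          dd_congr U.isOpen (D.drift 3 (by decide)) _ p hp, dd_const_mul _ (dB 3)]
        simp [lapCoeff]
      have k3 := dd_comm U.isOpen D.smooth_B (eB 1) (eB 3) p hp
      change dd (eB 0) (dd (eB 3) (sg V.1 1)) p = 0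
      linear_combination (k1 + k2) / 2 + k3
    · change dd (eB 1) (dd (eB 3) (sg V.1 1)) p = 0
      rw [dd_comm U.isOpen (sσ 1) _ _ p hp, dd_congr U.isOpen (D.diag 1 (by decide)) _ p hp,
        dd_neg, D.space_A 3 (by decide) p hp, neg_zero]
    · exact dd_dd_of_eq_zero' (sσ 1) (fun q hq => (D.cross q hq).2.1) _ hp
    · exact D.dd_dd_sg 3 1 (by decide) hp
  have hc' : ∀ p ∈ U, dd (eB 1) (sg V.1 3) p = -c := fun p hp => by
    linear_combination D.anti p hp - hc p hp
  have zero_smooth : ContDiffOn ℝ ∞ (fun _ : ℝ => (0 : ℝ)) (times U) := contDiffOn_const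
  have dσ : ∀ l, ∀ p ∈ U, DifferentiableAt ℝ (sg V.1 l) p := fun l p hp =>
    smoothOn_differentiableAt U.isOpen (sσ l) hp
  have hdiag : ∀ i, i ≠ 0 → ∀ p ∈ U, dd (eB i) (sg V.1 i) p = deriv τ (p.1 0) / 2 :=
    fun i hi p hp => by rw [D.diag i hi p hp, hA p hp, neg_neg]
  -- removal of the homogeneous part leaves a function of the time
  have rest : ∀ (i l : Fin 4) (κ : ℝ), i ≠ 0 → l ≠ 0 →
      (∀ n, n ≠ 0 → ∀ p ∈ U, dd (eB n) (sg V.1 i) p =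
        deriv τ (p.1 0) / 2 * (eB n).1 i + κ * (eB n).1 l) →
      ∃ g : ℝ → ℝ, ContDiffOn ℝ ∞ g (times U) ∧ ∀ p ∈ U, sg V.1 i p = slope τ κ g i l p := by
    intro i l κ hi hl hd
    have ss := slope_smooth hτ zero_smooth κ i l
    have ds : ∀ p ∈ U, DifferentiableAt ℝ (slope τ κ (fun _ => 0) i l) p := fun p hp =>
      smoothOn_differentiableAt U.isOpen ss hp
    obtain ⟨g, hg, eg⟩ := exists_time_function hU
      (f := fun p => sg V.1 i p - slope τ κ (fun _ => 0) i l p) ((sσ i).sub ss)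
      (fun n hn p hp => by
        rw [dd_sub (dσ i p hp) (ds p hp), hd n hn p hp, dd_slope hτ zero_smooth _ _ _ _ hp]
        simp [eB, hn])
      (fun α p hp => by
        rw [dd_sub (dσ i p hp) (ds p hp), hfib i α p hp, dd_slope hτ zero_smooth _ _ _ _ hp]
        simp [eF])
    refine ⟨g, hg, fun p hp => ?_⟩
    have := eg p hp
    simp only [slope] at this ⊢
    linear_combination this
  obtain ⟨g, hg, eg⟩ := rest 1 3 c (by decide) (by decide) (fun n hn p hp => by
    fin_cases n
    · exact absurd rfl hn
    · exact (hdiag 1 (by decide) p hp).trans (by simp [eB])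
    · exact (D.cross p hp).2.1.trans (by simp [eB])
    · exact (hc p hp).trans (by simp [eB]))
  obtain ⟨h, hh, eh⟩ := rest 2 2 0 (by decide) (by decide) (fun n hn p hp => by
    fin_cases n
    · exact absurd rfl hn
    · exact (D.cross p hp).1.trans (by simp [eB])
    · exact (hdiag 2 (by decide) p hp).trans (by simp [eB])
    · exact (D.cross p hp).2.2.2.trans (by simp [eB]))
  obtain ⟨k, hk, ek⟩ := rest 3 1 (-c) (by decide) (by decide) (fun n hn p hp => by
    fin_cases n
    · exact absurd rfl hn
    · exact (hc' p hp).trans (by simp [eB])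
    · exact (D.cross p hp).2.2.1.trans (by simp [eB])
    · exact (hdiag 3 (by decide) p hp).trans (by simp [eB]))
  -- the spatial gradient of `B` is known from the drift, which leaves a function of the time
  have H0 : SmoothParams (times U) τ g h k (fun _ => 0) := ⟨hτ, hg, hh, hk, contDiffOn_const⟩
  have dB : ∀ p ∈ U, DifferentiableAt ℝ B p := fun p hp =>
    smoothOn_differentiableAt U.isOpen D.smooth_B hp
  have dP : ∀ p ∈ U, DifferentiableAt ℝ (phase a₁ τ g h k fun _ => 0) p := fun p hp =>
    smoothOn_differentiableAt U.isOpen (phase_smooth a₁ H0) hp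
  obtain ⟨m, hm, em⟩ := exists_time_function hU (f := fun p => B p - phase a₁ τ g h k (fun _ => 0) p)
    (D.smooth_B.sub (phase_smooth a₁ H0))
    (fun i hi p hp => by
      rw [dd_sub (dB p hp) (dP p hp), dd_phase a₁ H0 _ hp]
      have hd := D.drift i hi p hp
      fin_cases i
      · exact absurd rfl hi
      · change dd (eB 0) (sg V.1 1) p = _ at hd
        rw [dd_congr U.isOpen eg _ p hp, dd_slope hτ hg _ _ _ _ hp] at hd
        simp [eB, lapCoeff] at hd ⊢
        linear_combination hd / 2
      · change dd (eB 0) (sg V.1 2) p = _ at hd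
        rw [dd_congr U.isOpen eh _ p hp, dd_slope hτ hh _ _ _ _ hp] at hd
        simp [eB, lapCoeff] at hd ⊢
        field_simp
        linear_combination 4 * hd
      · change dd (eB 0) (sg V.1 3) p = _ at hd
        rw [dd_congr U.isOpen ek _ p hp, dd_slope hτ hk _ _ _ _ hp] at hd
        simp [eB, lapCoeff] at hd ⊢
        linear_combination hd / 2)
    (fun α p hp => by
      rw [dd_sub (dB p hp) (dP p hp), dd_phase a₁ H0 _ hp, D.fib_B α p hp]
      simp [eF])
  have H : SmoothParams (times U) τ g h k m := ⟨hτ, hg, hh, hk, hm⟩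
  have eB' : ∀ p ∈ U, B p = phase a₁ τ g h k m p := fun p hp => by
    have := em p hp
    simp only [phase] at this ⊢
    linear_combination this
  refine ⟨τ, c, g, h, k, m, H, fun p hp => ?_, fun t ht => ?_⟩
  · refine Prod.ext (funext fun i => ?_) (funext fun α => ?_)
    · fin_cases i
      · exact eτ p hp
      · exact eg p hp
      · exact eh p hp
      · exact ek p hp
    · fin_cases α
      · refine (D.ph_zero p hp).trans ?_
        rw [hA p hp, eB' p hp]; rfl
      · refine (D.ph_one p hp).trans ?_
        rw [hA p hp, eB' p hp]; rfl
      · refine (D.ph_two p hp).trans ?_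
        rw [hA p hp, dd_congr U.isOpen eB' _ p hp, dd_phase a₁ H _ hp]
        simp [eB, genField]
        ring
  · obtain ⟨p, hp, rfl⟩ := ht
    have h1 := D.schrodinger p hp
    have hA' : ∀ p ∈ U, A p = -1 / 2 * deriv τ (p.1 0) := fun p hp => by rw [hA p hp]; ring
    have e : baseLap a₁ B p = baseLap a₁ (phase a₁ τ g h k m) p := by
      unfold baseLap
      rw [dd_congr U.isOpen (dd_congr U.isOpen eB' _) _ p hp,
        dd_congr U.isOpen (dd_congr U.isOpen eB' _) _ p hp,
        dd_congr U.isOpen (dd_congr U.isOpen eB' _) _ p hp]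
    rw [e, baseLap_phase ha₁ H _ hp, dd_congr U.isOpen hA' _ p hp, dd_const_mul _
      (smoothOn_differentiableAt U.isOpen (smoothOn_comp_time s1) hp), dd_time s1 _ hp, hA p hp,
      div_self ha₁] at h1
    simp [eB] at h1
    linear_combination 4 * h1

end Explicit

/-! ### Linear combinations and commutators of the explicit fields -/

section Brackets

variable {U : TopologicalSpace.Opens Pt} {a₁ : ℝ}

/-- The parameters of the explicit fields `genField`. -/
structure Params where
  τ : ℝ → ℝ
  c : ℝ
  g : ℝ → ℝ
  h : ℝ → ℝ
  k : ℝ → ℝ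
  m : ℝ → ℝ

namespace Params

/-- The explicit vector field with the given parameters. -/
def field (a₁ : ℝ) (P : Params) : Pt → Pt := genField a₁ P.τ P.c P.g P.h P.k P.m

/-- All parameter functions are smooth on `I`. -/
abbrev SmoothOn (P : Params) (I : Set ℝ) : Prop := SmoothParams I P.τ P.g P.h P.k P.m

/-- The linear combination `a P + b Q`. -/
def lin (a : ℝ) (P : Params) (b : ℝ) (Q : Params) : Params where
  τ := fun t => a * P.τ t + b * Q.τ t
  c := a * P.c + b * Q.c
  g := fun t => a * P.g t + b * Q.g t
  h := fun t => a * P.h t + b * Q.h t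
  k := fun t => a * P.k t + b * Q.k t
  m := fun t => a * P.m t + b * Q.m t

/-- The parameters of the commutator.  The bracket acts on `τ` as on vector fields, on `g, h, k` as on
densities of weight `-1/2` and on `m` as on functions; `c` rotates the pair `g, k`, and two densities
multiply to a function by their Wronskian. -/
def br (a₁ : ℝ) (P Q : Params) : Params where
  τ := fun t => P.τ t * deriv Q.τ t - Q.τ t * deriv P.τ t
  c := 0
  g := fun t => P.τ t * deriv Q.g t - 1 / 2 * (deriv P.τ t * Q.g t)
    - (Q.τ t * deriv P.g t - 1 / 2 * (deriv Q.τ t * P.g t)) - P.c * Q.k t + Q.c * P.k t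
  h := fun t => P.τ t * deriv Q.h t - 1 / 2 * (deriv P.τ t * Q.h t)
    - (Q.τ t * deriv P.h t - 1 / 2 * (deriv Q.τ t * P.h t))
  k := fun t => P.τ t * deriv Q.k t - 1 / 2 * (deriv P.τ t * Q.k t)
    - (Q.τ t * deriv P.k t - 1 / 2 * (deriv Q.τ t * P.k t)) + P.c * Q.g t - Q.c * P.g t
  m := fun t => P.τ t * deriv Q.m t - Q.τ t * deriv P.m t
    + 1 / 2 * (deriv P.g t * Q.g t - P.g t * deriv Q.g t)
    + 1 / (2 * a₁) * (deriv P.h t * Q.h t - P.h t * deriv Q.h t)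
    + 1 / 2 * (deriv P.k t * Q.k t - P.k t * deriv Q.k t)

theorem SmoothOn.lin {I : Set ℝ} {P Q : Params} (hP : P.SmoothOn I) (hQ : Q.SmoothOn I)
    (a b : ℝ) : (lin a P b Q).SmoothOn I :=
  ⟨(contDiffOn_const.mul hP.τ).add (contDiffOn_const.mul hQ.τ),
    (contDiffOn_const.mul hP.g).add (contDiffOn_const.mul hQ.g),
    (contDiffOn_const.mul hP.h).add (contDiffOn_const.mul hQ.h),
    (contDiffOn_const.mul hP.k).add (contDiffOn_const.mul hQ.k),
    (contDiffOn_const.mul hP.m).add (contDiffOn_const.mul hQ.m)⟩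

theorem SmoothOn.br {I : Set ℝ} (hI : IsOpen I) {P Q : Params} (hP : P.SmoothOn I)
    (hQ : Q.SmoothOn I) (a₁ : ℝ) : (br a₁ P Q).SmoothOn I := by
  have dP := hP.deriv hI
  have dQ := hQ.deriv hI
  have c : ∀ r : ℝ, ContDiffOn ℝ ∞ (fun _ : ℝ => r) I := fun r => contDiffOn_const
  have w : ∀ {x x' y y' : ℝ → ℝ}, ContDiffOn ℝ ∞ x I → ContDiffOn ℝ ∞ x' I →
      ContDiffOn ℝ ∞ y I → ContDiffOn ℝ ∞ y' I →
      ContDiffOn ℝ ∞ (fun t => x t * y' t - 1 / 2 * (x' t * y t)) I := fun h1 h2 h3 h4 =>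
    (h1.mul h4).sub ((c _).mul (h2.mul h3))
  have v : ∀ {x x' y y' : ℝ → ℝ}, ContDiffOn ℝ ∞ x I → ContDiffOn ℝ ∞ x' I →
      ContDiffOn ℝ ∞ y I → ContDiffOn ℝ ∞ y' I → ∀ r : ℝ,
      ContDiffOn ℝ ∞ (fun t => r * (x' t * y t - x t * y' t)) I := fun h1 h2 h3 h4 r =>
    (c _).mul ((h2.mul h3).sub (h1.mul h4))
  exact ⟨(hP.τ.mul dQ.τ).sub (hQ.τ.mul dP.τ),
    ((((w hP.τ dP.τ hQ.g dQ.g).sub (w hQ.τ dQ.τ hP.g dP.g)).sub ((c _).mul hQ.k)).add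
      ((c _).mul hP.k)),
    ((w hP.τ dP.τ hQ.h dQ.h).sub (w hQ.τ dQ.τ hP.h dP.h)),
    ((((w hP.τ dP.τ hQ.k dQ.k).sub (w hQ.τ dQ.τ hP.k dP.k)).add ((c _).mul hQ.g)).sub
      ((c _).mul hP.g)),
    (((((hP.τ.mul dQ.m).sub (hQ.τ.mul dP.m)).add (v hP.g dP.g hQ.g dQ.g _)).add
      (v hP.h dP.h hQ.h dQ.h _)).add (v hP.k dP.k hQ.k dQ.k _))⟩

end Params

theorem deriv_lin {I : Set ℝ} (hI : IsOpen I) {x y : ℝ → ℝ} (hx : ContDiffOn ℝ ∞ x I)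
    (hy : ContDiffOn ℝ ∞ y I) (a b : ℝ) :
    ∀ t ∈ I, deriv (fun t => a * x t + b * y t) t = a * deriv x t + b * deriv y t := fun _ ht =>
  (((smoothOn_hasDerivAt hI hx ht).const_mul a).add
    ((smoothOn_hasDerivAt hI hy ht).const_mul b)).deriv

theorem deriv_deriv_lin {I : Set ℝ} (hI : IsOpen I) {x y : ℝ → ℝ} (hx : ContDiffOn ℝ ∞ x I)
    (hy : ContDiffOn ℝ ∞ y I) (a b : ℝ) :
    ∀ t ∈ I, deriv (deriv fun t => a * x t + b * y t) t =
      a * deriv (deriv x) t + b * deriv (deriv y) t := fun t ht => by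
  rw [deriv_congr hI (deriv_lin hI hx hy a b) t ht,
    deriv_lin hI (deriv_smoothOn hI hx) (deriv_smoothOn hI hy) a b t ht]

theorem deriv_deriv_deriv_lin {I : Set ℝ} (hI : IsOpen I) {x y : ℝ → ℝ} (hx : ContDiffOn ℝ ∞ x I)
    (hy : ContDiffOn ℝ ∞ y I) (a b : ℝ) :
    ∀ t ∈ I, deriv (deriv (deriv fun t => a * x t + b * y t)) t =
      a * deriv (deriv (deriv x)) t + b * deriv (deriv (deriv y)) t := fun t ht => by
  rw [deriv_congr hI (deriv_deriv_lin hI hx hy a b) t ht,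
    deriv_lin hI (deriv_smoothOn hI (deriv_smoothOn hI hx))
      (deriv_smoothOn hI (deriv_smoothOn hI hy)) a b t ht]

theorem field_lin {P Q : Params} (hP : P.SmoothOn (times U)) (hQ : Q.SmoothOn (times U)) (a b : ℝ)
    {p : Pt} (hp : p ∈ U) :
    (Params.lin a P b Q).field a₁ p = a • P.field a₁ p + b • Q.field a₁ p := by
  have hI := times_isOpen U
  have ht := mem_times hp
  have e1 := deriv_lin hI hP.τ hQ.τ a b _ ht
  have e2 := deriv_deriv_lin hI hP.τ hQ.τ a b _ ht
  have e3 := deriv_deriv_deriv_lin hI hP.τ hQ.τ a b _ ht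
  have g1 := deriv_lin hI hP.g hQ.g a b _ ht
  have g2 := deriv_deriv_lin hI hP.g hQ.g a b _ ht
  have h1 := deriv_lin hI hP.h hQ.h a b _ ht
  have h2 := deriv_deriv_lin hI hP.h hQ.h a b _ ht
  have k1 := deriv_lin hI hP.k hQ.k a b _ ht
  have k2 := deriv_deriv_lin hI hP.k hQ.k a b _ ht
  have m1 := deriv_lin hI hP.m hQ.m a b _ ht
  refine Prod.ext (funext fun i => ?_) (funext fun α => ?_)
  · fin_cases i <;>
      simp [Params.field, genField, Params.lin, slope, e1] <;> ring
  · fin_cases α <;>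
      simp [Params.field, genField, Params.lin, phase, e1, e2, e3, g1, g2, h1, h2, k1, k2, m1] <;>
      ring

theorem fderiv_fst_apply {W : Pt → Pt} {p : Pt} (hW : DifferentiableAt ℝ W p) (v : Pt) (i : Fin 4) :
    (fderiv ℝ W p v).1 i = dd v (sg W i) p := by
  have h : HasFDerivAt (sg W i) (((ContinuousLinearMap.proj (R := ℝ) (φ := fun _ : Fin 4 => ℝ) i).comp
      (ContinuousLinearMap.fst ℝ Base Fib)).comp (fderiv ℝ W p)) p :=
    ((ContinuousLinearMap.proj (R := ℝ) (φ := fun _ : Fin 4 => ℝ) i).comp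
      (ContinuousLinearMap.fst ℝ Base Fib)).hasFDerivAt.comp p hW.hasFDerivAt
  rw [dd, h.fderiv]
  rfl

theorem fderiv_snd_apply {W : Pt → Pt} {p : Pt} (hW : DifferentiableAt ℝ W p) (v : Pt) (α : Fin 3) :
    (fderiv ℝ W p v).2 α = dd v (ph W α) p := by
  have h : HasFDerivAt (ph W α) (((ContinuousLinearMap.proj (R := ℝ) (φ := fun _ : Fin 3 => ℝ) α).comp
      (ContinuousLinearMap.snd ℝ Base Fib)).comp (fderiv ℝ W p)) p :=
    ((ContinuousLinearMap.proj (R := ℝ) (φ := fun _ : Fin 3 => ℝ) α).comp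
      (ContinuousLinearMap.snd ℝ Base Fib)).hasFDerivAt.comp p hW.hasFDerivAt
  rw [dd, h.fderiv]
  rfl

/-- The derivative of an explicit field in an arbitrary direction. -/
theorem fderiv_genField {P : Params} (H : P.SmoothOn (times U)) (v : Pt) {p : Pt} (hp : p ∈ U) :
    fderiv ℝ (P.field a₁) p v =
      (![v.1 0 * deriv P.τ (p.1 0), dd v (slope P.τ P.c P.g 1 3) p, dd v (slope P.τ 0 P.h 2 2) p,
        dd v (slope P.τ (-P.c) P.k 3 1) p],
       ![-(v.1 0 * deriv (deriv P.τ) (p.1 0) / 2) * p.2 0 - deriv P.τ (p.1 0) / 2 * v.2 0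
          + dd v (phase a₁ P.τ P.g P.h P.k P.m) p * p.2 1
          + phase a₁ P.τ P.g P.h P.k P.m p * v.2 1,
         -(v.1 0 * deriv (deriv P.τ) (p.1 0) / 2) * p.2 1 - deriv P.τ (p.1 0) / 2 * v.2 1
          - dd v (phase a₁ P.τ P.g P.h P.k P.m) p * p.2 0
          - phase a₁ P.τ P.g P.h P.k P.m p * v.2 0,
         dd v (phase a₁ (deriv P.τ) (deriv P.g) (deriv P.h) (deriv P.k) (deriv P.m)) p
          - v.1 0 * deriv (deriv P.τ) (p.1 0) * p.2 2 - deriv P.τ (p.1 0) * v.2 2]) := by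
  have hI := times_isOpen U
  have s1 := deriv_smoothOn hI H.τ
  have d := smoothOn_differentiableAt U.isOpen (genField_smooth a₁ H P.c) hp
  have d1 := smoothOn_differentiableAt U.isOpen (smoothOn_comp_time s1) hp
  have d2 := smoothOn_differentiableAt U.isOpen (phase_smooth a₁ H) hp
  have d3 := smoothOn_differentiableAt U.isOpen (phase_smooth a₁ (H.deriv hI)) hp
  refine Prod.ext (funext fun i => ?_) (funext fun α => ?_)
  · refine (fderiv_fst_apply d v i).trans ?_
    fin_cases i
    · exact dd_time H.τ v hp
    · rfl
    · rfl
    · rfl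
  · refine (fderiv_snd_apply d v α).trans ?_
    fin_cases α
    · have e : ph (genField a₁ P.τ P.c P.g P.h P.k P.m) 0 = fun q =>
          -1 / 2 * (deriv P.τ (q.1 0) * q.2 0) + phase a₁ P.τ P.g P.h P.k P.m q * q.2 1 := by
        funext q; simp [ph, genField]; ring
      change dd v (ph _ 0) p = _
      rw [e, dd_add, dd_const_mul, dd_mul, dd_mul, dd_time s1 v hp, dd_fib_coord, dd_fib_coord]
      · simp; ring
      all_goals first | assumption | fun_prop
    · have e : ph (genField a₁ P.τ P.c P.g P.h P.k P.m) 1 = fun q =>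
          -1 / 2 * (deriv P.τ (q.1 0) * q.2 1) - phase a₁ P.τ P.g P.h P.k P.m q * q.2 0 := by
        funext q; simp [ph, genField]; ring
      change dd v (ph _ 1) p = _
      rw [e, dd_sub, dd_const_mul, dd_mul, dd_mul, dd_time s1 v hp, dd_fib_coord, dd_fib_coord]
      · simp; ring
      all_goals first | assumption | fun_prop
    · have e : ph (genField a₁ P.τ P.c P.g P.h P.k P.m) 2 = fun q =>
          phase a₁ (deriv P.τ) (deriv P.g) (deriv P.h) (deriv P.k) (deriv P.m) q
            - deriv P.τ (q.1 0) * q.2 2 := by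
        funext q; simp [ph, genField]
      change dd v (ph _ 2) p = _
      rw [e, dd_sub, dd_mul, dd_time s1 v hp, dd_fib_coord]
      · simp; ring
      all_goals first | assumption | fun_prop

theorem deriv_wronskian {I : Set ℝ} (hI : IsOpen I) {x y : ℝ → ℝ} (hx : ContDiffOn ℝ ∞ x I)
    (hy : ContDiffOn ℝ ∞ y I) :
    ∀ t ∈ I, deriv (fun t => x t * deriv y t - y t * deriv x t) t =
      x t * deriv (deriv y) t - y t * deriv (deriv x) t := fun t ht => by
  have x0 := smoothOn_hasDerivAt hI hx ht
  have x1 := smoothOn_hasDerivAt hI (deriv_smoothOn hI hx) ht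
  have y0 := smoothOn_hasDerivAt hI hy ht
  have y1 := smoothOn_hasDerivAt hI (deriv_smoothOn hI hy) ht
  rw [((x0.fun_mul y1).fun_sub (y0.fun_mul x1)).deriv]
  ring

theorem deriv_deriv_wronskian {I : Set ℝ} (hI : IsOpen I) {x y : ℝ → ℝ} (hx : ContDiffOn ℝ ∞ x I)
    (hy : ContDiffOn ℝ ∞ y I) :
    ∀ t ∈ I, deriv (deriv fun t => x t * deriv y t - y t * deriv x t) t =
      deriv x t * deriv (deriv y) t + x t * deriv (deriv (deriv y)) t
        - deriv y t * deriv (deriv x) t - y t * deriv (deriv (deriv x)) t := fun t ht => by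
  have hx1 := deriv_smoothOn hI hx
  have hy1 := deriv_smoothOn hI hy
  have x0 := smoothOn_hasDerivAt hI hx ht
  have x2 := smoothOn_hasDerivAt hI (deriv_smoothOn hI hx1) ht
  have y0 := smoothOn_hasDerivAt hI hy ht
  have y2 := smoothOn_hasDerivAt hI (deriv_smoothOn hI hy1) ht
  rw [deriv_congr hI (deriv_wronskian hI hx hy) t ht, ((x0.fun_mul y2).fun_sub (y0.fun_mul x2)).deriv]
  ring

theorem deriv_deriv_deriv_wronskian {I : Set ℝ} (hI : IsOpen I) {x y : ℝ → ℝ}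
    (hx : ContDiffOn ℝ ∞ x I) (hy : ContDiffOn ℝ ∞ y I) :
    ∀ t ∈ I, deriv (deriv (deriv fun t => x t * deriv y t - y t * deriv x t)) t =
      2 * (deriv x t * deriv (deriv (deriv y)) t) + x t * deriv (deriv (deriv (deriv y))) t
        - 2 * (deriv y t * deriv (deriv (deriv x)) t) - y t * deriv (deriv (deriv (deriv x))) t :=
  fun t ht => by
  have hx1 := deriv_smoothOn hI hx
  have hy1 := deriv_smoothOn hI hy
  have hx2 := deriv_smoothOn hI hx1
  have hy2 := deriv_smoothOn hI hy1
  have x0 := smoothOn_hasDerivAt hI hx ht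
  have x1 := smoothOn_hasDerivAt hI hx1 ht
  have x2 := smoothOn_hasDerivAt hI hx2 ht
  have x3 := smoothOn_hasDerivAt hI (deriv_smoothOn hI hx2) ht
  have y0 := smoothOn_hasDerivAt hI hy ht
  have y1 := smoothOn_hasDerivAt hI hy1 ht
  have y2 := smoothOn_hasDerivAt hI hy2 ht
  have y3 := smoothOn_hasDerivAt hI (deriv_smoothOn hI hy2) ht
  rw [deriv_congr hI (deriv_deriv_wronskian hI hx hy) t ht, ((((x1.fun_mul y2).fun_add
    (x0.fun_mul y3)).fun_sub (y1.fun_mul x2)).fun_sub (y0.fun_mul x3)).deriv]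
  ring

/-- The first derivative of the action of time reparametrizations on densities of weight `-1/2`,
with a further linear term. -/
theorem deriv_density {I : Set ℝ} (hI : IsOpen I) {x y f g e : ℝ → ℝ} (hx : ContDiffOn ℝ ∞ x I)
    (hy : ContDiffOn ℝ ∞ y I) (hf : ContDiffOn ℝ ∞ f I) (hg : ContDiffOn ℝ ∞ g I)
    (he : ContDiffOn ℝ ∞ e I) :
    ∀ t ∈ I, deriv (fun t => x t * deriv g t - 1 / 2 * (deriv x t * g t)
      - (y t * deriv f t - 1 / 2 * (deriv y t * f t)) + e t) t =
      (1 / 2 * (deriv x t * deriv g t) + x t * deriv (deriv g) t - 1 / 2 * (deriv (deriv x) t * g t))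
      - (1 / 2 * (deriv y t * deriv f t) + y t * deriv (deriv f) t
        - 1 / 2 * (deriv (deriv y) t * f t)) + deriv e t := fun t ht => by
  have x0 := smoothOn_hasDerivAt hI hx ht
  have x1 := smoothOn_hasDerivAt hI (deriv_smoothOn hI hx) ht
  have y0 := smoothOn_hasDerivAt hI hy ht
  have y1 := smoothOn_hasDerivAt hI (deriv_smoothOn hI hy) ht
  have f0 := smoothOn_hasDerivAt hI hf ht
  have f1 := smoothOn_hasDerivAt hI (deriv_smoothOn hI hf) ht
  have g0 := smoothOn_hasDerivAt hI hg ht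
  have g1 := smoothOn_hasDerivAt hI (deriv_smoothOn hI hg) ht
  rw [((((x0.fun_mul g1).fun_sub ((x1.fun_mul g0).const_mul (1 / 2))).fun_sub
    ((y0.fun_mul f1).fun_sub ((y1.fun_mul f0).const_mul (1 / 2)))).fun_add
    (smoothOn_hasDerivAt hI he ht)).deriv]
  ring

theorem deriv_deriv_density {I : Set ℝ} (hI : IsOpen I) {x y f g e : ℝ → ℝ}
    (hx : ContDiffOn ℝ ∞ x I)
    (hy : ContDiffOn ℝ ∞ y I) (hf : ContDiffOn ℝ ∞ f I) (hg : ContDiffOn ℝ ∞ g I)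
    (he : ContDiffOn ℝ ∞ e I) :
    ∀ t ∈ I, deriv (deriv fun t => x t * deriv g t - 1 / 2 * (deriv x t * g t)
      - (y t * deriv f t - 1 / 2 * (deriv y t * f t)) + e t) t =
      (3 / 2 * (deriv x t * deriv (deriv g) t) + x t * deriv (deriv (deriv g)) t
        - 1 / 2 * (deriv (deriv (deriv x)) t * g t))
      - (3 / 2 * (deriv y t * deriv (deriv f) t) + y t * deriv (deriv (deriv f)) t
        - 1 / 2 * (deriv (deriv (deriv y)) t * f t)) + deriv (deriv e) t := fun t ht => by
  have hx1 := deriv_smoothOn hI hx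
  have hy1 := deriv_smoothOn hI hy
  have hf1 := deriv_smoothOn hI hf
  have hg1 := deriv_smoothOn hI hg
  have x0 := smoothOn_hasDerivAt hI hx ht
  have x1 := smoothOn_hasDerivAt hI hx1 ht
  have x2 := smoothOn_hasDerivAt hI (deriv_smoothOn hI hx1) ht
  have y0 := smoothOn_hasDerivAt hI hy ht
  have y1 := smoothOn_hasDerivAt hI hy1 ht
  have y2 := smoothOn_hasDerivAt hI (deriv_smoothOn hI hy1) ht
  have f0 := smoothOn_hasDerivAt hI hf ht
  have f1 := smoothOn_hasDerivAt hI hf1 ht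
  have f2 := smoothOn_hasDerivAt hI (deriv_smoothOn hI hf1) ht
  have g0 := smoothOn_hasDerivAt hI hg ht
  have g1 := smoothOn_hasDerivAt hI hg1 ht
  have g2 := smoothOn_hasDerivAt hI (deriv_smoothOn hI hg1) ht
  rw [deriv_congr hI (deriv_density hI hx hy hf hg he) t ht,
    (((((((x1.fun_mul g1).const_mul (1 / 2)).fun_add (x0.fun_mul g2)).fun_sub
      ((x2.fun_mul g0).const_mul (1 / 2))).fun_sub
    ((((y1.fun_mul f1).const_mul (1 / 2)).fun_add (y0.fun_mul f2)).fun_sub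
      ((y2.fun_mul f0).const_mul (1 / 2))))).fun_add
    (smoothOn_hasDerivAt hI (deriv_smoothOn hI he) ht)).deriv]
  ring

set_option maxHeartbeats 1000000 in
/-- The commutator of two explicit fields is the explicit field with parameters `Params.br`. -/
theorem lieBracket_field (ha₁ : a₁ ≠ 0) {P Q : Params} (hP : P.SmoothOn (times U))
    (hQ : Q.SmoothOn (times U)) {p : Pt} (hp : p ∈ U) :
    VectorField.lieBracket ℝ (P.field a₁) (Q.field a₁) p = (Params.br a₁ P Q).field a₁ p := by
  have hI := times_isOpen U
  have ht := mem_times hp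
  have hP1 := hP.deriv hI
  have hQ1 := hQ.deriv hI
  have e1 := deriv_wronskian hI hP.τ hQ.τ _ ht
  have e2 := deriv_deriv_wronskian hI hP.τ hQ.τ _ ht
  have e3 := deriv_deriv_deriv_wronskian hI hP.τ hQ.τ _ ht
  have cz : ContDiffOn ℝ ∞ (fun _ : ℝ => (0 : ℝ)) (times U) := contDiffOn_const
  have lk : ContDiffOn ℝ ∞ (fun t => -P.c * Q.k t + Q.c * P.k t) (times U) :=
    (contDiffOn_const.mul hQ.k).add (contDiffOn_const.mul hP.k)
  have lg : ContDiffOn ℝ ∞ (fun t => P.c * Q.g t + -Q.c * P.g t) (times U) :=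
    (contDiffOn_const.mul hQ.g).add (contDiffOn_const.mul hP.g)
  have brg : (Params.br a₁ P Q).g = fun t => P.τ t * deriv Q.g t - 1 / 2 * (deriv P.τ t * Q.g t)
      - (Q.τ t * deriv P.g t - 1 / 2 * (deriv Q.τ t * P.g t)) + (-P.c * Q.k t + Q.c * P.k t) := by
    funext t; simp only [Params.br]; ring
  have brh : (Params.br a₁ P Q).h = fun t => P.τ t * deriv Q.h t - 1 / 2 * (deriv P.τ t * Q.h t)
      - (Q.τ t * deriv P.h t - 1 / 2 * (deriv Q.τ t * P.h t)) + 0 := by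
    funext t; simp only [Params.br]; ring
  have brk : (Params.br a₁ P Q).k = fun t => P.τ t * deriv Q.k t - 1 / 2 * (deriv P.τ t * Q.k t)
      - (Q.τ t * deriv P.k t - 1 / 2 * (deriv Q.τ t * P.k t)) + (P.c * Q.g t + -Q.c * P.g t) := by
    funext t; simp only [Params.br]; ring
  have g1 := deriv_density hI hP.τ hQ.τ hP.g hQ.g lk _ ht
  have g2 := deriv_deriv_density hI hP.τ hQ.τ hP.g hQ.g lk _ ht
  have h1 := deriv_density hI hP.τ hQ.τ hP.h hQ.h cz _ ht
  have h2 := deriv_deriv_density hI hP.τ hQ.τ hP.h hQ.h cz _ ht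
  have k1 := deriv_density hI hP.τ hQ.τ hP.k hQ.k lg _ ht
  have k2 := deriv_deriv_density hI hP.τ hQ.τ hP.k hQ.k lg _ ht
  rw [deriv_lin hI hQ.k hP.k _ _ _ ht, ← brg] at g1
  rw [deriv_deriv_lin hI hQ.k hP.k _ _ _ ht, ← brg] at g2
  rw [deriv_lin hI hQ.g hP.g _ _ _ ht, ← brk] at k1
  rw [deriv_deriv_lin hI hQ.g hP.g _ _ _ ht, ← brk] at k2
  rw [← brh] at h1 h2
  simp only [deriv_const', add_zero] at h1 h2
  have m1 : deriv (Params.br a₁ P Q).m (p.1 0) =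
      deriv P.τ (p.1 0) * deriv Q.m (p.1 0) + P.τ (p.1 0) * deriv (deriv Q.m) (p.1 0)
      - (deriv Q.τ (p.1 0) * deriv P.m (p.1 0) + Q.τ (p.1 0) * deriv (deriv P.m) (p.1 0))
      + 1 / 2 * (deriv (deriv P.g) (p.1 0) * Q.g (p.1 0) - P.g (p.1 0) * deriv (deriv Q.g) (p.1 0))
      + 1 / (2 * a₁) * (deriv (deriv P.h) (p.1 0) * Q.h (p.1 0)
        - P.h (p.1 0) * deriv (deriv Q.h) (p.1 0))
      + 1 / 2 * (deriv (deriv P.k) (p.1 0) * Q.k (p.1 0)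
        - P.k (p.1 0) * deriv (deriv Q.k) (p.1 0)) := by
    have D := fun {f : ℝ → ℝ} (hf : ContDiffOn ℝ ∞ f (times U)) => smoothOn_hasDerivAt hI hf ht
    have := ((((((D hP.τ).fun_mul (D hQ1.m)).fun_sub ((D hQ.τ).fun_mul (D hP1.m))).fun_add
      ((((D hP1.g).fun_mul (D hQ.g)).fun_sub ((D hP.g).fun_mul (D hQ1.g))).const_mul (1 / 2))).fun_add
      ((((D hP1.h).fun_mul (D hQ.h)).fun_sub ((D hP.h).fun_mul (D hQ1.h))).const_mul
        (1 / (2 * a₁)))).fun_add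
      ((((D hP1.k).fun_mul (D hQ.k)).fun_sub ((D hP.k).fun_mul (D hQ1.k))).const_mul
        (1 / 2))).deriv
    refine this.trans ?_
    ring
  rw [VectorField.lieBracket, fderiv_genField hP _ hp, fderiv_genField hQ _ hp]
  simp only [dd_slope hP.τ hP.g _ _ _ _ hp, dd_slope hP.τ hP.h _ _ _ _ hp,
    dd_slope hP.τ hP.k _ _ _ _ hp, dd_slope hQ.τ hQ.g _ _ _ _ hp, dd_slope hQ.τ hQ.h _ _ _ _ hp,
    dd_slope hQ.τ hQ.k _ _ _ _ hp, dd_phase a₁ hP _ hp, dd_phase a₁ hQ _ hp, dd_phase a₁ hP1 _ hp,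
    dd_phase a₁ hQ1 _ hp]
  have F : ∀ R : Params, R.field a₁ p = genField a₁ R.τ R.c R.g R.h R.k R.m p := fun _ => rfl
  have brτ : (Params.br a₁ P Q).τ = fun t => P.τ t * deriv Q.τ t - Q.τ t * deriv P.τ t := rfl
  rw [← brτ] at e1 e2 e3
  have c0 : (Params.br a₁ P Q).c = 0 := rfl
  have vg := congrFun brg (p.1 0)
  have vh := congrFun brh (p.1 0)
  have vk := congrFun brk (p.1 0)
  have vm : (Params.br a₁ P Q).m (p.1 0) = P.τ (p.1 0) * deriv Q.m (p.1 0)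
    - Q.τ (p.1 0) * deriv P.m (p.1 0)
    + 1 / 2 * (deriv P.g (p.1 0) * Q.g (p.1 0) - P.g (p.1 0) * deriv Q.g (p.1 0))
    + 1 / (2 * a₁) * (deriv P.h (p.1 0) * Q.h (p.1 0) - P.h (p.1 0) * deriv Q.h (p.1 0))
    + 1 / 2 * (deriv P.k (p.1 0) * Q.k (p.1 0) - P.k (p.1 0) * deriv Q.k (p.1 0)) := rfl
  simp only [F, genField, slope, phase, e1, e2, e3, c0, g1, g2, h1, h2, k1, k2, m1, vg, vh, vk,
    vm]
  refine Prod.ext (funext fun i => ?_) (funext fun α => ?_)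
  · fin_cases i
    · simp [Params.br, mul_comm]
    · simp; ring
    · simp; ring
    · simp; ring
  · fin_cases α
    · simp; field_simp; ring
    · simp; field_simp; ring
    · simp; field_simp; ring

end Brackets

/-! ### The Lie algebra of the explicit fields -/

section HasParams

variable {U : TopologicalSpace.Opens Pt} {a₁ a₃ : ℝ}

/-- On `U`, `V` is the explicit field with the parameters `P`, where `P` is smooth and its time
component solves `τ'' = 4 a₃ τ'`. -/
structure HasParams (a₁ a₃ : ℝ) (V : VField U) (P : Params) : Prop where
  smooth : P.SmoothOn (times U)
  ode : ∀ t ∈ times U, deriv (deriv P.τ) t = 4 * a₃ * deriv P.τ t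
  eq : ∀ p ∈ U, V.1 p = P.field a₁ p

theorem exists_hasParams {P : Params} (hP : P.SmoothOn (times U))
    (h : ∀ t ∈ times U, deriv (deriv P.τ) t = 4 * a₃ * deriv P.τ t) :
    ∃ V : VField U, HasParams a₁ a₃ V P := by
  classical
  refine ⟨⟨fun p => if p ∈ U then P.field a₁ p else 0, ?_, fun p hp => if_neg hp⟩, hP, h,
    fun p hp => if_pos hp⟩
  exact (genField_smooth a₁ hP P.c).congr fun p hp => if_pos hp

theorem HasParams.lin {V W : VField U} {P Q : Params} (hV : HasParams a₁ a₃ V P)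
    (hW : HasParams a₁ a₃ W Q) (a b : ℝ) : HasParams a₁ a₃ (a • V + b • W) (Params.lin a P b Q) where
  smooth := hV.smooth.lin hW.smooth a b
  ode t ht := by
    have hI := times_isOpen U
    have e1 := deriv_lin hI hV.smooth.τ hW.smooth.τ a b t ht
    have e2 := deriv_deriv_lin hI hV.smooth.τ hW.smooth.τ a b t ht
    change deriv (deriv fun t => a * P.τ t + b * Q.τ t) t =
      4 * a₃ * deriv (fun t => a * P.τ t + b * Q.τ t) t
    rw [e1, e2, hV.ode t ht, hW.ode t ht]
    ring
  eq p hp := by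
    rw [field_lin hV.smooth hW.smooth a b hp, ← hV.eq p hp, ← hW.eq p hp]
    rfl

theorem HasParams.br (ha₁ : a₁ ≠ 0) {V W : VField U} {P Q : Params} (hV : HasParams a₁ a₃ V P)
    (hW : HasParams a₁ a₃ W Q) : HasParams a₁ a₃ ⁅V, W⁆ (Params.br a₁ P Q) where
  smooth := hV.smooth.br (times_isOpen U) hW.smooth a₁
  ode t ht := by
    have hI := times_isOpen U
    have e1 := deriv_wronskian hI hV.smooth.τ hW.smooth.τ
    have hτ : ∀ s ∈ times U, deriv (Params.br a₁ P Q).τ s = 4 * a₃ * (Params.br a₁ P Q).τ s := by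
      intro s hs
      refine (e1 s hs).trans ?_
      rw [hV.ode s hs, hW.ode s hs]
      simp only [Params.br]
      ring
    rw [deriv_congr hI hτ t ht]
    exact ((smoothOn_hasDerivAt hI (hV.smooth.br hI hW.smooth a₁).τ ht).const_mul _).deriv
  eq p hp := by
    have h : ∀ {X : VField U} {R : Params}, HasParams a₁ a₃ X R → X.1 =ᶠ[nhds p] R.field a₁ :=
      fun hX => by filter_upwards [U.isOpen.mem_nhds hp] with q hq using hX.eq q hq
    rw [VField.bracket_apply _ _ hp, Filter.EventuallyEq.lieBracket_vectorField_eq (h hV) (h hW),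
      lieBracket_field ha₁ hV.smooth hW.smooth hp]

/-- All parameters vanish on `I`. -/
structure Params.VanishesOn (P : Params) (I : Set ℝ) : Prop where
  τ : ∀ t ∈ I, P.τ t = 0
  c : P.c = 0
  g : ∀ t ∈ I, P.g t = 0
  h : ∀ t ∈ I, P.h t = 0
  k : ∀ t ∈ I, P.k t = 0
  m : ∀ t ∈ I, P.m t = 0

theorem deriv_eq_zero_of_forall {I : Set ℝ} (hI : IsOpen I) {f : ℝ → ℝ} (h : ∀ t ∈ I, f t = 0) :
    ∀ t ∈ I, deriv f t = 0 := fun t ht => by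
  rw [deriv_congr hI (g := fun _ => 0) h t ht, deriv_const]

theorem Params.VanishesOn.field_eq_zero {P : Params} (h : P.VanishesOn (times U)) {p : Pt}
    (hp : p ∈ U) : P.field a₁ p = 0 := by
  have hI := times_isOpen U
  have ht := mem_times hp
  have τ1 := deriv_eq_zero_of_forall hI h.τ
  have τ2 := deriv_eq_zero_of_forall hI τ1
  have τ3 := deriv_eq_zero_of_forall hI τ2
  have g1 := deriv_eq_zero_of_forall hI h.g
  have g2 := deriv_eq_zero_of_forall hI g1
  have h1 := deriv_eq_zero_of_forall hI h.h
  have h2 := deriv_eq_zero_of_forall hI h1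
  have k1 := deriv_eq_zero_of_forall hI h.k
  have k2 := deriv_eq_zero_of_forall hI k1
  have m1 := deriv_eq_zero_of_forall hI h.m
  refine Prod.ext (funext fun i => ?_) (funext fun α => ?_)
  · fin_cases i <;>
      simp [Params.field, genField, slope, h.τ _ ht, h.g _ ht, h.h _ ht, h.k _ ht, h.c, τ1 _ ht]
  · fin_cases α <;>
      simp [Params.field, genField, phase, τ1 _ ht, τ2 _ ht, τ3 _ ht, g1 _ ht, g2 _ ht, h1 _ ht,
        h2 _ ht, k1 _ ht, k2 _ ht, h.m _ ht, m1 _ ht]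

/-- The parameters of an explicit field are determined by the field. -/
theorem vanishesOn_of_field_eq_zero (hne : (U : Set Pt).Nonempty) {P : Params}
    (hP : P.SmoothOn (times U)) (h : ∀ p ∈ U, P.field a₁ p = 0) : P.VanishesOn (times U) := by
  have hI := times_isOpen U
  have hτ : ∀ t ∈ times U, P.τ t = 0 := by
    rintro _ ⟨p, hp, rfl⟩
    simpa [Params.field, genField] using congrFun (congrArg Prod.fst (h p hp)) 0
  have τ1 := deriv_eq_zero_of_forall hI hτ
  have τ2 := deriv_eq_zero_of_forall hI τ1
  have s1 : ∀ p ∈ U, slope P.τ P.c P.g 1 3 p = 0 := fun p hp => by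
    simpa [Params.field, genField] using congrFun (congrArg Prod.fst (h p hp)) 1
  have hc : P.c = 0 := by
    obtain ⟨p, hp⟩ := hne
    have e := dd_congr U.isOpen (g := fun _ => (0 : ℝ)) s1 (eB 3) p hp
    rw [dd_slope hP.τ hP.g _ _ _ _ hp, dd_const] at e
    simpa [eB, τ2 _ (mem_times hp)] using e
  have hg : ∀ t ∈ times U, P.g t = 0 := by
    rintro _ ⟨p, hp, rfl⟩
    simpa [slope, hc, τ1 _ (mem_times hp)] using s1 p hp
  have hh : ∀ t ∈ times U, P.h t = 0 := by
    rintro _ ⟨p, hp, rfl⟩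
    have := congrFun (congrArg Prod.fst (h p hp)) 2
    simpa [Params.field, genField, slope, hc, τ1 _ (mem_times hp)] using this
  have hk : ∀ t ∈ times U, P.k t = 0 := by
    rintro _ ⟨p, hp, rfl⟩
    have := congrFun (congrArg Prod.fst (h p hp)) 3
    simpa [Params.field, genField, slope, hc, τ1 _ (mem_times hp)] using this
  have g1 := deriv_eq_zero_of_forall hI hg
  have h1 := deriv_eq_zero_of_forall hI hh
  have k1 := deriv_eq_zero_of_forall hI hk
  have hm : ∀ p ∈ U, P.m (p.1 0) = 0 := by
    refine eq_zero_of_eq_zero_off_axis (smoothOn_comp_time hP.m).continuousOn fun p hp h0 => ?_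
    have ht := mem_times hp
    have := congrFun (congrArg Prod.snd (h p hp)) 1
    simpa [Params.field, genField, phase, h0, τ1 _ ht, τ2 _ ht, g1 _ ht, h1 _ ht, k1 _ ht] using this
  refine ⟨hτ, hc, hg, hh, hk, ?_⟩
  rintro _ ⟨p, hp, rfl⟩
  exact hm p hp

theorem HasParams.eq_zero_iff (hne : (U : Set Pt).Nonempty) {V : VField U} {P : Params}
    (hV : HasParams a₁ a₃ V P) : V = 0 ↔ P.VanishesOn (times U) := by
  refine ⟨fun h => vanishesOn_of_field_eq_zero (a₁ := a₁) hne hV.smooth fun p hp => ?_,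
    fun h => VField.ext_on fun p hp => ?_⟩
  · rw [← hV.eq p hp, h]; rfl
  · rw [hV.eq p hp, h.field_eq_zero hp]; rfl

/-- The symmetry generators of `Δ` on `U` are the explicit fields. -/
def Classified (Δ : PDESystem) (U : TopologicalSpace.Opens Pt) (a₁ a₃ : ℝ) : Prop :=
  ∀ V : VField U, IsSymmetryGenerator Δ V ↔ ∃ P, HasParams a₁ a₃ V P

/-- The generators are explicit in the cases at hand, where `τ'' = 4 a₃ τ'` implies
`(2 a₁ + b₁) τ''' = 0`. -/
theorem classified_genSystem {a₂ b₁ r₁ r₂ : ℝ} (hU : Convex ℝ (U : Set Pt)) (ha₁ : a₁ ≠ 0)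
    (hb₁ : b₁ ≠ 0) (hr : (r₁ ≠ 0 ∧ r₂ = 0) ∨ (r₁ = 0 ∧ r₂ ≠ 0)) (h : a₃ = 0 ∨ b₁ = -2 * a₁) :
    Classified (genSystem a₁ a₂ a₃ b₁ r₁ r₂) U a₁ a₃ := by
  intro V
  rw [isSymmetryGenerator_iff ha₁ hb₁ hr]
  constructor
  · rintro ⟨A, B, D⟩
    obtain ⟨τ, c, g, h, k, m, H, e, o⟩ := D.exists_genField ha₁ hU
    exact ⟨⟨τ, c, g, h, k, m⟩, H, o, e⟩
  · rintro ⟨P, hP⟩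
    refine ⟨_, _, determined_of_eq_genField ha₁ hP.smooth hP.eq hP.ode fun t ht => ?_⟩
    rcases h with h | h
    · have o : ∀ t ∈ times U, deriv (deriv P.τ) t = 0 := fun t ht => by
        rw [hP.ode t ht, h]; ring
      rw [deriv_eq_zero_of_forall (times_isOpen U) o t ht, mul_zero]
    · rw [h]; ring

/-- The explicit fields are closed under the bracket, so that the Lie algebra generated by the
generators contains nothing else. -/
theorem Classified.mem_symmetryAlgebra_iff {Δ : PDESystem} (hΔ : Classified Δ U a₁ a₃)
    (ha₁ : a₁ ≠ 0) (V : VField U) : V ∈ symmetryAlgebra Δ U ↔ ∃ P, HasParams a₁ a₃ V P := by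
  let K : LieSubalgebra ℝ (VField U) :=
    { carrier := {V | ∃ P, HasParams a₁ a₃ V P}
      add_mem' := by
        rintro V W ⟨P, hP⟩ ⟨Q, hQ⟩
        have := hP.lin hQ 1 1
        rw [one_smul, one_smul] at this
        exact ⟨_, this⟩
      zero_mem' := by
        have hc : ContDiffOn ℝ ∞ (fun _ : ℝ => (0 : ℝ)) (times U) := contDiffOn_const
        have hv : Params.VanishesOn ⟨fun _ => 0, 0, fun _ => 0, fun _ => 0, fun _ => 0, fun _ => 0⟩
            (times U) := by constructor <;> simp
        exact ⟨⟨fun _ => 0, 0, fun _ => 0, fun _ => 0, fun _ => 0, fun _ => 0⟩,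
          ⟨hc, hc, hc, hc, hc⟩, by simp, fun p hp => (hv.field_eq_zero hp).symm⟩
      smul_mem' := by
        rintro a V ⟨P, hP⟩
        have := hP.lin hP a 0
        rw [zero_smul, add_zero] at this
        exact ⟨_, this⟩
      lie_mem' := by
        rintro V W ⟨P, hP⟩ ⟨Q, hQ⟩
        exact ⟨_, hP.br ha₁ hQ⟩ }
  have hK : symmetryAlgebra Δ U = K := by
    have : {V : VField U | IsSymmetryGenerator Δ V} = K := Set.ext fun V => hΔ V
    rw [symmetryAlgebra, this, LieSubalgebra.lieSpan_eq]
  rw [hK]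
  rfl

end HasParams

/-! ### The structure of the symmetry algebras -/

section Structure

variable {U : TopologicalSpace.Opens Pt} {a₁ a₃ : ℝ}

/-- The parameters of `τ ∂_t + …` with a multiple `c` of the rotation and with no Kac--Moody part. -/
def solvParams (τ : ℝ → ℝ) (c : ℝ) : Params :=
  ⟨τ, c, fun _ => 0, fun _ => 0, fun _ => 0, fun _ => 0⟩

/-- The parameters of `𝒴(g) + 𝒵(h) + 𝒬(k) + 𝒲(m)`. -/
def kmParams (g h k m : ℝ → ℝ) : Params := ⟨fun _ => 0, 0, g, h, k, m⟩

theorem solvParams_smooth {τ : ℝ → ℝ} (hτ : ContDiffOn ℝ ∞ τ (times U)) (c : ℝ) :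
    (solvParams τ c).SmoothOn (times U) :=
  ⟨hτ, contDiffOn_const, contDiffOn_const, contDiffOn_const, contDiffOn_const⟩

theorem fieldX2_eq : fieldX2 = (solvParams (fun t => 2 * t) 0).field a₁ := by
  have h : deriv (fun t : ℝ => 2 * t) = fun _ => 2 := by
    funext t; simp
  funext p
  refine Prod.ext (funext fun i => ?_) (funext fun α => ?_)
  · fin_cases i <;> simp [fieldX2, solvParams, Params.field, genField, slope, h]
  · fin_cases α <;> simp [fieldX2, solvParams, Params.field, genField, phase, h]

theorem deriv_exp_mul (r c : ℝ) :
    deriv (fun t : ℝ => c * Real.exp (r * t)) = fun t => c * r * Real.exp (r * t) := by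
  funext t
  have := (((hasDerivAt_id t).const_mul r).exp.const_mul c).deriv
  simp only [id] at this
  rw [this]; ring

theorem fieldX2'_eq (ha₃ : a₃ ≠ 0) :
    fieldX2' a₁ a₃ = (solvParams (fun t => 1 / (2 * a₃) * Real.exp (4 * a₃ * t)) 0).field a₁ := by
  obtain ⟨b, hb⟩ : ∃ b : ℝ → ℝ, b = fun t => 1 / (2 * a₃) * Real.exp (4 * a₃ * t) := ⟨_, rfl⟩
  have h1 : deriv b = fun t => 1 / (2 * a₃) * (4 * a₃) * Real.exp (4 * a₃ * t) := by
    rw [hb, deriv_exp_mul]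
  have h2 := deriv_exp_mul (4 * a₃) (1 / (2 * a₃) * (4 * a₃))
  have h3 := deriv_exp_mul (4 * a₃) (1 / (2 * a₃) * (4 * a₃) * (4 * a₃))
  rw [← h1] at h2
  rw [← h2] at h3
  rw [← hb]
  funext p
  have e0 : b (p.1 0) = 1 / (2 * a₃) * Real.exp (4 * a₃ * p.1 0) := congrFun hb _
  have e1 : deriv b (p.1 0) = 2 * Real.exp (4 * a₃ * p.1 0) := by
    rw [h1]; field_simp; ring
  have e2 : deriv (deriv b) (p.1 0) = 8 * a₃ * Real.exp (4 * a₃ * p.1 0) := by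
    rw [h2]; field_simp; ring
  have e3 : deriv (deriv (deriv b)) (p.1 0) = 32 * a₃ ^ 2 * Real.exp (4 * a₃ * p.1 0) := by
    rw [h3]; field_simp; ring
  refine Prod.ext (funext fun i => ?_) (funext fun α => ?_)
  · fin_cases i <;>
      simp only [fieldX2', solvParams, Params.field, genField, slope, e0, e1] <;>
      simp <;> ring
  · fin_cases α <;>
      simp only [fieldX2', solvParams, Params.field, genField, phase, e1, e2, e3] <;>
      simp <;> ring

theorem kmParams_field (g h k m : ℝ → ℝ) (p : Pt) :
    (kmParams g h k m).field a₁ p = fieldY g p + fieldZ a₁ h p + fieldQ k p + fieldW m p := by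
  refine Prod.ext (funext fun i => ?_) (funext fun α => ?_)
  · fin_cases i <;>
      simp [fieldY, fieldZ, fieldQ, fieldW, kmParams, Params.field, genField, slope]
  · fin_cases α <;>
      simp [fieldY, fieldZ, fieldQ, fieldW, kmParams, Params.field, genField, phase] <;> ring

theorem fieldY_zero (p : Pt) : fieldY (fun _ => 0) p = 0 := by
  refine Prod.ext (funext fun i => ?_) (funext fun α => ?_)
  · fin_cases i <;> simp [fieldY]
  · fin_cases α <;> simp [fieldY]

theorem fieldZ_zero (p : Pt) : fieldZ a₁ (fun _ => 0) p = 0 := by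
  refine Prod.ext (funext fun i => ?_) (funext fun α => ?_)
  · fin_cases i <;> simp [fieldZ]
  · fin_cases α <;> simp [fieldZ]

theorem fieldQ_zero (p : Pt) : fieldQ (fun _ => 0) p = 0 := by
  refine Prod.ext (funext fun i => ?_) (funext fun α => ?_)
  · fin_cases i <;> simp [fieldQ]
  · fin_cases α <;> simp [fieldQ]

theorem fieldW_zero (p : Pt) : fieldW (fun _ => 0) p = 0 := by
  refine Prod.ext (funext fun i => ?_) (funext fun α => ?_)
  · fin_cases i <;> simp [fieldW]
  · fin_cases α <;> simp [fieldW]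

theorem fieldY_eq (g : ℝ → ℝ) :
    fieldY g = (kmParams g (fun _ => 0) (fun _ => 0) fun _ => 0).field a₁ := by
  funext p; simp [kmParams_field, fieldZ_zero, fieldQ_zero, fieldW_zero]

theorem fieldZ_eq (h : ℝ → ℝ) :
    fieldZ a₁ h = (kmParams (fun _ => 0) h (fun _ => 0) fun _ => 0).field a₁ := by
  funext p; simp [kmParams_field, fieldY_zero, fieldQ_zero, fieldW_zero]

theorem fieldQ_eq (k : ℝ → ℝ) :
    fieldQ k = (kmParams (fun _ => 0) (fun _ => 0) k fun _ => 0).field a₁ := by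
  funext p; simp [kmParams_field, fieldY_zero, fieldZ_zero, fieldW_zero]

theorem fieldW_eq (m : ℝ → ℝ) :
    fieldW m = (kmParams (fun _ => 0) (fun _ => 0) (fun _ => 0) m).field a₁ := by
  funext p; simp [kmParams_field, fieldY_zero, fieldZ_zero, fieldQ_zero]

theorem br_kmParams (g h k m g' h' k' m' : ℝ → ℝ) :
    Params.br a₁ (kmParams g h k m) (kmParams g' h' k' m') =
      kmParams (fun _ => 0) (fun _ => 0) (fun _ => 0) fun t =>
        1 / 2 * (deriv g t * g' t - g t * deriv g' t)
        + 1 / (2 * a₁) * (deriv h t * h' t - h t * deriv h' t)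
        + 1 / 2 * (deriv k t * k' t - k t * deriv k' t) := by
  simp [Params.br, kmParams]

theorem kacMoodyRelations (ha₁ : a₁ ≠ 0) : KacMoodyRelations a₁ U := by
  intro f g hf hg p hp
  have c : ContDiffOn ℝ ∞ (fun _ : ℝ => (0 : ℝ)) (times U) := contDiffOn_const
  have key : ∀ {P Q : Params}, P.SmoothOn (times U) → Q.SmoothOn (times U) →
      VectorField.lieBracket ℝ (P.field a₁) (Q.field a₁) p = (Params.br a₁ P Q).field a₁ p :=
    fun hP hQ => lieBracket_field ha₁ hP hQ hp
  rw [fieldY_eq (a₁ := a₁) f, fieldY_eq (a₁ := a₁) g, fieldZ_eq f, fieldZ_eq g,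
    fieldQ_eq (a₁ := a₁) f, fieldQ_eq (a₁ := a₁) g, fieldW_eq (a₁ := a₁) f, fieldW_eq (a₁ := a₁) g]
  refine ⟨?_, ?_, ?_, ?_, ?_, ?_, ?_, ?_, ?_, ?_⟩ <;>
    refine (key ⟨by assumption, by assumption, by assumption, by assumption, by assumption⟩
      ⟨by assumption, by assumption, by assumption, by assumption, by assumption⟩).trans ?_ <;>
    rw [br_kmParams] <;>
    simp [kmParams_field, fieldY_zero, fieldZ_zero, fieldQ_zero, fieldW_zero]

theorem inKacMoody_iff {V : VField U} :
    InKacMoody a₁ V ↔ ∃ g h k m, HasParams a₁ a₃ V (kmParams g h k m) := by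
  constructor
  · rintro ⟨g, h, k, m, hg, hh, hk, hm, e⟩
    exact ⟨g, h, k, m, ⟨contDiffOn_const, hg, hh, hk, hm⟩, by simp [kmParams],
      fun p hp => (e p hp).trans (kmParams_field g h k m p).symm⟩
  · rintro ⟨g, h, k, m, H⟩
    exact ⟨g, h, k, m, H.smooth.g, H.smooth.h, H.smooth.k, H.smooth.m,
      fun p hp => (H.eq p hp).trans (kmParams_field g h k m p)⟩

theorem HasParams.inKacMoody {V : VField U} {P : Params} (H : HasParams a₁ a₃ V P)
    (hτ : P.τ = fun _ => 0) (hc : P.c = 0) : InKacMoody a₁ V := by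
  refine (inKacMoody_iff (a₃ := a₃)).2 ⟨P.g, P.h, P.k, P.m, ?_⟩
  have e : kmParams P.g P.h P.k P.m = P := by rw [kmParams, ← hτ, ← hc]
  rwa [e]

/-- A Lie algebra spanned by three elements, one of which is central, is solvable. -/
theorem isSolvable_of_span {L : Type*} [LieRing L] [LieAlgebra ℝ L] {x y z : L}
    (hxz : ⁅x, z⁆ = 0) (hyz : ⁅y, z⁆ = 0) (h : ∀ w : L, ∃ a b c : ℝ, w = a • x + b • y + c • z) :
    LieAlgebra.IsSolvable L := by
  have hzx : ⁅z, x⁆ = 0 := by rw [← lie_skew, hxz, neg_zero]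
  have hzy : ⁅z, y⁆ = 0 := by rw [← lie_skew, hyz, neg_zero]
  have hyx : ⁅y, x⁆ = -⁅x, y⁆ := (lie_skew y x).symm
  have hbr : ∀ v w : L, ∃ r : ℝ, ⁅v, w⁆ = r • ⁅x, y⁆ := fun v w => by
    obtain ⟨a, b, c, rfl⟩ := h v
    obtain ⟨a', b', c', rfl⟩ := h w
    refine ⟨a * b' - b * a', ?_⟩
    simp only [add_lie, lie_add, smul_lie, lie_smul, lie_self, hxz, hyz, hzx, hzy, hyx, smul_zero,
      smul_neg]
    module
  have h1 : ∀ v ∈ LieAlgebra.derivedSeries ℝ L 1, ∃ r : ℝ, v = r • ⁅x, y⁆ := by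
    intro v hv
    rw [LieAlgebra.derivedSeries_def, LieAlgebra.derivedSeriesOfIdeal_succ,
      LieAlgebra.derivedSeriesOfIdeal_zero, ← LieSubmodule.mem_toSubmodule,
      LieSubmodule.lieIdeal_oper_eq_linear_span'] at hv
    have : Submodule.span ℝ {⁅a, b⁆ | (a ∈ (⊤ : LieIdeal ℝ L)) (b ∈ (⊤ : LieIdeal ℝ L))} ≤
        Submodule.span ℝ {⁅x, y⁆} := by
      rw [Submodule.span_le]
      rintro _ ⟨a, -, b, -, rfl⟩
      obtain ⟨r, hr⟩ := hbr a b
      exact Submodule.mem_span_singleton.2 ⟨r, hr.symm⟩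
    obtain ⟨r, hr⟩ := Submodule.mem_span_singleton.1 (this hv)
    exact ⟨r, hr.symm⟩
  refine LieAlgebra.IsSolvable.mk (R := ℝ) (k := 2) ?_
  rw [LieAlgebra.derivedSeries_def, LieAlgebra.derivedSeriesOfIdeal_succ,
    LieSubmodule.lie_eq_bot_iff]
  intro v hv w hw
  obtain ⟨r, rfl⟩ := h1 v hv
  obtain ⟨s, rfl⟩ := h1 w hw
  simp

/-- If `b' ≠ 0` solves the linear equation `b' = κ + 4 a₃ b`, then the solutions of `τ'' = 4 a₃ τ'`
on an interval are the functions `α + β b`. -/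
theorem exists_eq_add_mul {I : Set ℝ} (hI : IsOpen I) (hI' : IsPreconnected I) {b : ℝ → ℝ} {κ : ℝ}
    (hb : ∀ t, HasDerivAt b (κ + 4 * a₃ * b t) t) (hb0 : ∀ t, κ + 4 * a₃ * b t ≠ 0) {τ : ℝ → ℝ}
    (hτ : ContDiffOn ℝ ∞ τ I) (ode : ∀ t ∈ I, deriv (deriv τ) t = 4 * a₃ * deriv τ t) :
    ∃ α β : ℝ, ∀ t ∈ I, τ t = α + β * b t := by
  have hd : ∀ t ∈ I, HasDerivAt (fun t => deriv τ t / (κ + 4 * a₃ * b t)) 0 t := fun t ht => by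
    have h1 := smoothOn_hasDerivAt hI (deriv_smoothOn hI hτ) ht
    have h2 := ((hb t).const_mul (4 * a₃)).const_add κ
    have h3 := h1.fun_div h2 (hb0 t)
    rw [ode t ht] at h3
    have e : 4 * a₃ * deriv τ t * (κ + 4 * a₃ * b t) - deriv τ t * (4 * a₃ * (κ + 4 * a₃ * b t))
        = 0 := by ring
    rwa [e, zero_div] at h3
  obtain ⟨β, hβ⟩ := hI.exists_is_const_of_deriv_eq_zero hI'
    (fun t ht => (hd t ht).differentiableAt.differentiableWithinAt) fun t ht => (hd t ht).deriv
  have hd' : ∀ t ∈ I, HasDerivAt (fun t => τ t - β * b t) 0 t := fun t ht => by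
    have h1 := (smoothOn_hasDerivAt hI hτ ht).fun_sub ((hb t).const_mul β)
    have h2 := hβ t ht
    rw [div_eq_iff (hb0 t)] at h2
    rwa [h2, sub_self] at h1
  obtain ⟨α, hα⟩ := hI.exists_is_const_of_deriv_eq_zero hI'
    (fun t ht => (hd' t ht).differentiableAt.differentiableWithinAt) fun t ht => (hd' t ht).deriv
  exact ⟨α, β, fun t ht => by rw [← hα t ht]; ring⟩

theorem deriv_affine {b : ℝ → ℝ} {κ : ℝ} (hb : ∀ t, HasDerivAt b (κ + 4 * a₃ * b t) t) (α β : ℝ) :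
    deriv (fun t => α + β * b t) = fun t => β * (κ + 4 * a₃ * b t) := by
  funext t
  exact (((hb t).const_mul β).const_add α).deriv

theorem smooth_of_affine {b : ℝ → ℝ} {κ : ℝ} (hb : ∀ t, HasDerivAt b (κ + 4 * a₃ * b t) t) :
    ContDiff ℝ ∞ b := by
  rw [contDiff_infty]
  intro n
  induction n with
  | zero => exact contDiff_zero.2 (continuous_iff_continuousAt.2 fun t => (hb t).continuousAt)
  | succ n ih =>
    push_cast
    rw [contDiff_succ_iff_deriv]
    refine ⟨fun t => (hb t).differentiableAt, by simp, ?_⟩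
    have : deriv b = fun t => κ + 4 * a₃ * b t := funext fun t => (hb t).deriv
    rw [this]
    exact contDiff_const.add (contDiff_const.mul ih)

variable {b : ℝ → ℝ} {κ : ℝ}

theorem hasParams_solvParams (hb : ∀ t, HasDerivAt b (κ + 4 * a₃ * b t) t) {V : VField U}
    {α β c : ℝ}
    (e : ∀ p ∈ U, V.1 p = (solvParams (fun t => α + β * b t) c).field a₁ p) :
    HasParams a₁ a₃ V (solvParams (fun t => α + β * b t) c) := by
  refine ⟨solvParams_smooth ((contDiff_const.add
    (contDiff_const.mul (smooth_of_affine hb))).contDiffOn) c, fun t _ => ?_, e⟩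
  have h2 : deriv (fun t => β * (κ + 4 * a₃ * b t)) t = β * (4 * a₃ * (κ + 4 * a₃ * b t)) :=
    ((((hb t).const_mul (4 * a₃)).const_add κ).const_mul β).deriv
  change deriv (deriv fun t => α + β * b t) t = 4 * a₃ * deriv (fun t => α + β * b t) t
  rw [deriv_affine hb, h2]
  ring

theorem field_solvParams_eq (hb : ∀ t, HasDerivAt b (κ + 4 * a₃ * b t) t) (α β c : ℝ) (p : Pt) :
    (solvParams (fun t => α + β * b t) c).field a₁ p =
      α • fieldX1 p + β • (solvParams b 0).field a₁ p + c • fieldX3 p := by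
  have d1 : deriv b = fun t => κ + 4 * a₃ * b t := funext fun t => (hb t).deriv
  have d2 : deriv (fun t => κ + 4 * a₃ * b t) = fun t => 4 * a₃ * (κ + 4 * a₃ * b t) :=
    funext fun t => (((hb t).const_mul (4 * a₃)).const_add κ).deriv
  have d3 : deriv (fun t => 4 * a₃ * (κ + 4 * a₃ * b t)) =
      fun t => 4 * a₃ * (4 * a₃ * (κ + 4 * a₃ * b t)) :=
    funext fun t => ((((hb t).const_mul (4 * a₃)).const_add κ).const_mul (4 * a₃)).deriv
  have e1 := deriv_affine hb α β
  have e2 : deriv (fun t => β * (κ + 4 * a₃ * b t)) = fun t => β * (4 * a₃ * (κ + 4 * a₃ * b t)) :=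
    funext fun t => ((((hb t).const_mul (4 * a₃)).const_add κ).const_mul β).deriv
  have e3 : deriv (fun t => β * (4 * a₃ * (κ + 4 * a₃ * b t))) =
      fun t => β * (4 * a₃ * (4 * a₃ * (κ + 4 * a₃ * b t))) :=
    funext fun t =>
      (((((hb t).const_mul (4 * a₃)).const_add κ).const_mul (4 * a₃)).const_mul β).deriv
  refine Prod.ext (funext fun i => ?_) (funext fun α => ?_)
  · fin_cases i <;>
      simp [fieldX1, fieldX3, solvParams, Params.field, genField, slope, e1, d1] <;> ring
  · fin_cases α <;>
      simp [fieldX1, fieldX3, solvParams, Params.field, genField, phase, e1, e2, e3, d1, d2, d3] <;>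
      ring

theorem inSpan_iff (hb : ∀ t, HasDerivAt b (κ + 4 * a₃ * b t) t) {V : VField U} :
    InSpan fieldX1 ((solvParams b 0).field a₁) fieldX3 V ↔
      ∃ α β c : ℝ, HasParams a₁ a₃ V (solvParams (fun t => α + β * b t) c) := by
  constructor
  · rintro ⟨α, β, c, e⟩
    exact ⟨α, β, c, hasParams_solvParams hb fun p hp =>
      (e p hp).trans (field_solvParams_eq hb α β c p).symm⟩
  · rintro ⟨α, β, c, H⟩
    exact ⟨α, β, c, fun p hp => (H.eq p hp).trans (field_solvParams_eq hb α β c p)⟩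

/-- The parameters `α, β` are determined, since `1` and `b` are linearly independent. -/
theorem eq_zero_of_vanishesOn (hne : (U : Set Pt).Nonempty)
    (hb : ∀ t, HasDerivAt b (κ + 4 * a₃ * b t) t) (hb0 : ∀ t, κ + 4 * a₃ * b t ≠ 0) {α β : ℝ}
    (h : ∀ t ∈ times U, α + β * b t = 0) : α = 0 ∧ β = 0 := by
  obtain ⟨p, hp⟩ := hne
  have ht := mem_times hp
  have h1 := deriv_eq_zero_of_forall (times_isOpen U) h _ ht
  rw [deriv_affine hb] at h1
  have hβ : β = 0 := (mul_eq_zero.1 h1).resolve_right (hb0 _)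
  have := h _ ht
  rw [hβ, zero_mul, add_zero] at this
  exact ⟨this, hβ⟩

end Structure

section Semidirect

variable {U : TopologicalSpace.Opens Pt} {a₁ a₃ : ℝ} {b : ℝ → ℝ} {κ : ℝ} {Δ : PDESystem}

theorem HasParams.congr (hne : (U : Set Pt).Nonempty) {V : VField U} {P Q : Params}
    (hP : HasParams a₁ a₃ V P) (hQ : HasParams a₁ a₃ V Q) :
    (Params.lin 1 P (-1) Q).VanishesOn (times U) := by
  have h := hP.lin hQ 1 (-1)
  rw [one_smul, neg_one_smul, add_neg_cancel] at h
  exact (h.eq_zero_iff hne).1 rfl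

/-- The explicit fields include `𝒲(m)` for every polynomial `m`. -/
theorem Classified.not_finiteDimensional (hΔ : Classified Δ U a₁ a₃) (ha₁ : a₁ ≠ 0)
    (hne : (U : Set Pt).Nonempty) : ¬ FiniteDimensional ℝ (symmetryAlgebra Δ U) := by
  classical
  intro hfin
  have c : ContDiffOn ℝ ∞ (fun _ : ℝ => (0 : ℝ)) (times U) := contDiffOn_const
  have hex : ∀ q : Polynomial ℝ, ∃ V : symmetryAlgebra Δ U, HasParams a₁ a₃ V.1
      (kmParams (fun _ => 0) (fun _ => 0) (fun _ => 0) fun t => q.eval t) := fun q => by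
    obtain ⟨V, hV⟩ := exists_hasParams (U := U) (a₁ := a₁) (a₃ := a₃)
      (P := kmParams (fun _ => 0) (fun _ => 0) (fun _ => 0) fun t => q.eval t)
      ⟨c, c, c, c, (q.contDiff_aeval ∞).contDiffOn⟩ (by simp [kmParams])
    exact ⟨⟨V, (hΔ.mem_symmetryAlgebra_iff ha₁ V).2 ⟨_, hV⟩⟩, hV⟩
  choose F hF using hex
  have hd : ∀ q : Polynomial ℝ, deriv (fun t => q.eval t) = fun t => q.derivative.eval t :=
    fun q => funext fun t => q.deriv
  have hval : ∀ q, ∀ p ∈ U, (F q).1.1 p = fieldW (fun t => q.eval t) p := fun q p hp => by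
    rw [(hF q).eq p hp, fieldW_eq (a₁ := a₁)]
  let f : Polynomial ℝ →ₗ[ℝ] symmetryAlgebra Δ U :=
    { toFun := F
      map_add' := fun q r => by
        refine Subtype.ext (VField.ext_on fun p hp => ?_)
        change (F (q + r)).1.1 p = (F q).1.1 p + (F r).1.1 p
        rw [hval _ p hp, hval _ p hp, hval _ p hp]
        refine Prod.ext (by simp [fieldW]) (funext fun α => ?_)
        fin_cases α <;> simp only [fieldW, hd] <;> simp <;> ring
      map_smul' := fun a q => by
        refine Subtype.ext (VField.ext_on fun p hp => ?_)
        change (F (a • q)).1.1 p = a • (F q).1.1 p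
        rw [hval _ p hp, hval _ p hp]
        refine Prod.ext (by simp [fieldW]) (funext fun α => ?_)
        fin_cases α <;> simp only [fieldW, hd] <;> simp <;> ring }
  have hinj : Function.Injective f := by
    rw [← LinearMap.ker_eq_bot, LinearMap.ker_eq_bot']
    intro q hq
    have h0 : (F q).1 = 0 := congrArg Subtype.val hq
    have hv := ((hF q).eq_zero_iff hne).1 h0
    refine Polynomial.eq_zero_of_infinite_isRoot q (Set.Infinite.mono (s := times U) ?_ ?_)
    · exact fun t ht => hv.m t ht
    · obtain ⟨p, hp⟩ := hne
      exact infinite_of_mem_nhds _ ((times_isOpen U).mem_nhds (mem_times hp))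
  exact Polynomial.not_finite (Module.Finite.of_injective f hinj)

/-- The structure of the algebra of explicit fields; `b` and the constant `1` span the solutions of
`τ'' = 4 a₃ τ'`. -/
theorem Classified.hasSemidirectStructure (hΔ : Classified Δ U a₁ a₃) (ha₁ : a₁ ≠ 0)
    (hU : Convex ℝ (U : Set Pt)) (hne : (U : Set Pt).Nonempty)
    (hb : ∀ t, HasDerivAt b (κ + 4 * a₃ * b t) t) (hb0 : ∀ t, κ + 4 * a₃ * b t ≠ 0) :
    HasSemidirectStructure Δ U a₁ fieldX1 ((solvParams b 0).field a₁) fieldX3 := by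
  have hI := times_isOpen U
  have hmem := hΔ.mem_symmetryAlgebra_iff ha₁
  have hS : ∀ V : VField U, InSpan fieldX1 ((solvParams b 0).field a₁) fieldX3 V →
      V ∈ symmetryAlgebra Δ U := fun V hV => by
    obtain ⟨α, β, c, H⟩ := (inSpan_iff hb).1 hV
    exact (hmem V).2 ⟨_, H⟩
  have hN : ∀ V : VField U, InKacMoody a₁ V → V ∈ symmetryAlgebra Δ U := fun V hV => by
    obtain ⟨g, h, k, m, H⟩ := (inKacMoody_iff (a₃ := a₃)).1 hV
    exact (hmem V).2 ⟨_, H⟩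
  have hex : ∀ α β c : ℝ, ∃ V : symmetryAlgebra Δ U,
      HasParams a₁ a₃ V.1 (solvParams (fun t => α + β * b t) c) := fun α β c => by
    obtain ⟨V, hV⟩ := exists_hasParams (U := U) (a₁ := a₁) (a₃ := a₃)
      (P := solvParams (fun t => α + β * b t) c)
      (solvParams_smooth ((contDiff_const.add
        (contDiff_const.mul (smooth_of_affine hb))).contDiffOn) c) fun t _ => by
        have h2 : deriv (fun t => β * (κ + 4 * a₃ * b t)) t = β * (4 * a₃ * (κ + 4 * a₃ * b t)) :=
          ((((hb t).const_mul (4 * a₃)).const_add κ).const_mul β).deriv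
        simp only [solvParams]
        rw [deriv_affine hb, h2]
        ring
    exact ⟨⟨V, (hmem V).2 ⟨_, hV⟩⟩, hV⟩
  obtain ⟨x, hx⟩ := hex 1 0 0
  obtain ⟨y, hy⟩ := hex 0 1 0
  obtain ⟨z, hz⟩ := hex 0 0 1
  have hval : ∀ {V : VField U} {α β c : ℝ},
      HasParams a₁ a₃ V (solvParams (fun t => α + β * b t) c) ↔
        V = α • x.1 + β • y.1 + c • z.1 := by
    intro V α β c
    have e : ∀ p ∈ U, (solvParams (fun t => α + β * b t) c).field a₁ p =
        (α • x.1 + β • y.1 + c • z.1 : VField U).1 p := fun p hp => by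
      change _ = α • x.1.1 p + β • y.1.1 p + c • z.1.1 p
      rw [hx.eq p hp, hy.eq p hp, hz.eq p hp, field_solvParams_eq hb, field_solvParams_eq hb,
        field_solvParams_eq hb, field_solvParams_eq hb]
      module
    constructor
    · exact fun H => VField.ext_on fun p hp => (H.eq p hp).trans (e p hp)
    · rintro rfl
      exact hasParams_solvParams hb fun p hp => (e p hp).symm
  have hspan : ∀ V : VField U, InSpan fieldX1 ((solvParams b 0).field a₁) fieldX3 V ↔
      ∃ α β c : ℝ, V = α • x.1 + β • y.1 + c • z.1 := fun V => by
    rw [inSpan_iff hb]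
    simp only [hval]
  -- the commutators of the three fields
  have hbr : ∀ {α β c α' β' c' : ℝ}, ⁅α • x.1 + β • y.1 + c • z.1,
      α' • x.1 + β' • y.1 + c' • z.1⁆ = ((α * β' - β * α') * κ) • x.1 +
        ((α * β' - β * α') * (4 * a₃)) • y.1 + (0 : ℝ) • z.1 := by
    intro α β c α' β' c'
    have h1 := (hval (α := α) (β := β) (c := c)).2 rfl
    have h2 := (hval (α := α') (β := β') (c := c')).2 rfl
    refine hval.1 ?_
    have h3 := h1.br ha₁ h2
    have e : Params.br a₁ (solvParams (fun t => α + β * b t) c)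
        (solvParams (fun t => α' + β' * b t) c') = solvParams (fun t => (α * β' - β * α') * κ +
          (α * β' - β * α') * (4 * a₃) * b t) 0 := by
      simp only [Params.br, solvParams, deriv_affine hb, deriv_const]
      congr 1 <;> first | rfl | (funext t; ring)
    rwa [e] at h3
  let S : LieSubalgebra ℝ (symmetryAlgebra Δ U) :=
    { carrier := {V | ∃ α β c : ℝ, V = α • x + β • y + c • z}
      add_mem' := by
        rintro _ _ ⟨α, β, c, rfl⟩ ⟨α', β', c', rfl⟩
        exact ⟨α + α', β + β', c + c', by module⟩
      zero_mem' := ⟨0, 0, 0, by module⟩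
      smul_mem' := by
        rintro r _ ⟨α, β, c, rfl⟩
        exact ⟨r * α, r * β, r * c, by module⟩
      lie_mem' := by
        rintro _ _ ⟨α, β, c, rfl⟩ ⟨α', β', c', rfl⟩
        exact ⟨_, _, _, Subtype.ext hbr⟩ }
  have hSmem : ∀ V : symmetryAlgebra Δ U, V ∈ S ↔
      InSpan fieldX1 ((solvParams b 0).field a₁) fieldX3 V.1 := fun V => by
    rw [hspan]
    exact exists_congr fun _ => exists_congr fun _ => exists_congr fun _ => Subtype.ext_iff
  let N : LieIdeal ℝ (symmetryAlgebra Δ U) :=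
    { carrier := {V | InKacMoody a₁ V.1}
      add_mem' := by
        intro V W hV hW
        obtain ⟨g, h, k, m, H⟩ := (inKacMoody_iff (a₃ := a₃)).1 hV
        obtain ⟨g', h', k', m', H'⟩ := (inKacMoody_iff (a₃ := a₃)).1 hW
        have := H.lin H' 1 1
        rw [one_smul, one_smul] at this
        exact this.inKacMoody (by simp [Params.lin, kmParams]) (by simp [Params.lin, kmParams])
      zero_mem' := by
        refine ⟨fun _ => 0, fun _ => 0, fun _ => 0, fun _ => 0, contDiffOn_const, contDiffOn_const,
          contDiffOn_const, contDiffOn_const, fun p hp => ?_⟩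
        simp only [fieldY_zero, fieldZ_zero, fieldQ_zero, fieldW_zero, add_zero]
        rfl
      smul_mem' := by
        intro r V hV
        obtain ⟨g, h, k, m, H⟩ := (inKacMoody_iff (a₃ := a₃)).1 hV
        have := H.lin H r 0
        rw [zero_smul, add_zero] at this
        exact this.inKacMoody (by simp [Params.lin, kmParams]) (by simp [Params.lin, kmParams])
      lie_mem := by
        intro V W hW
        obtain ⟨P, hP⟩ := (hmem V.1).1 V.2
        obtain ⟨g, h, k, m, H⟩ := (inKacMoody_iff (a₃ := a₃)).1 hW
        exact (hP.br ha₁ H).inKacMoody (by simp [Params.br, kmParams]) rfl }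
  refine ⟨fun V => (hmem V).trans (hΔ V).symm, hΔ.not_finiteDimensional ha₁ hne, S, N, hSmem,
    fun V => Iff.rfl, hS, hN, ?_, ?_, ?_, ?_, kacMoodyRelations ha₁⟩
  · -- the `τ`- and `c`-components tell the two summands apart
    refine IsCompl.of_eq ?_ ?_
    · rw [eq_bot_iff]
      rintro V ⟨hVS, hVN⟩
      obtain ⟨α, β, c, H⟩ := (inSpan_iff hb).1 ((hSmem V).1 hVS)
      obtain ⟨g, h, k, m, H'⟩ := (inKacMoody_iff (a₃ := a₃)).1 hVN
      have hv := H.congr hne H'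
      obtain ⟨rfl, rfl⟩ := eq_zero_of_vanishesOn hne hb hb0 (α := α) (β := β) fun t ht => by
        simpa [Params.lin, solvParams, kmParams] using hv.τ t ht
      have hc : c = 0 := by simpa [Params.lin, solvParams, kmParams] using hv.c
      subst hc
      rw [hval] at H
      have : V.1 = 0 := by rw [H]; module
      exact (Submodule.mem_bot ℝ).2 (Subtype.ext this)
    · rw [eq_top_iff]
      rintro V -
      obtain ⟨P, hP⟩ := (hmem V.1).1 V.2
      obtain ⟨α, β, hτ⟩ := exists_eq_add_mul hI (times_convex hU).isPreconnected hb hb0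
        hP.smooth.τ hP.ode
      obtain ⟨s, hs⟩ := hex α β P.c
      have hd := hP.lin hs 1 (-1)
      rw [one_smul, neg_one_smul, ← sub_eq_add_neg] at hd
      have hK : HasParams a₁ a₃ (V.1 - s.1) (kmParams P.g P.h P.k P.m) := by
        have cz : ∀ r : ℝ, ContDiffOn ℝ ∞ (fun _ : ℝ => r) (times U) := fun r => contDiffOn_const
        have hsm : (kmParams P.g P.h P.k P.m).SmoothOn (times U) :=
          ⟨cz 0, hP.smooth.g, hP.smooth.h, hP.smooth.k, hP.smooth.m⟩
        refine ⟨hsm, by simp [kmParams], fun p hp => ?_⟩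
        have hv : (Params.lin 1 (Params.lin 1 P (-1) (solvParams (fun t => α + β * b t) P.c)) (-1)
            (kmParams P.g P.h P.k P.m)).VanishesOn (times U) := by
          constructor <;> simp +contextual [Params.lin, solvParams, kmParams, hτ]
        have h0 := hv.field_eq_zero (a₁ := a₁) hp
        rw [field_lin hd.smooth hsm _ _ hp, ← hd.eq p hp, one_smul, neg_one_smul,
          add_neg_eq_zero] at h0
        exact h0
      refine Submodule.mem_sup.2 ⟨s, (hSmem s).2 ((inSpan_iff hb).2 ⟨_, _, _, hs⟩), V - s, ?_, by
        abel⟩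
      exact (inKacMoody_iff (a₃ := a₃)).2 ⟨_, _, _, _, hK⟩
  · have hli : LinearIndependent ℝ ![x, y, z] := by
      rw [Fintype.linearIndependent_iff]
      intro r hr
      rw [Fin.sum_univ_three] at hr
      have h0 : (0 : VField U) = r 0 • x.1 + r 1 • y.1 + r 2 • z.1 :=
        (congrArg Subtype.val hr).symm
      have hv := ((hval.2 h0).eq_zero_iff hne).1 rfl
      obtain ⟨h1, h2⟩ := eq_zero_of_vanishesOn hne hb hb0 hv.τ
      intro i
      fin_cases i
      · exact h1
      · exact h2
      · exact hv.c
    have hSs : S.toSubmodule = Submodule.span ℝ (Set.range ![x, y, z]) := by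
      ext V
      rw [Submodule.mem_span_range_iff_exists_fun]
      constructor
      · rintro ⟨α, β, c, rfl⟩
        exact ⟨![α, β, c], by simp [Fin.sum_univ_three]⟩
      · rintro ⟨r, rfl⟩
        exact ⟨r 0, r 1, r 2, by simp [Fin.sum_univ_three]⟩
    change Module.finrank ℝ S.toSubmodule = 3
    rw [hSs, finrank_span_eq_card hli, Fintype.card_fin]
  · have m1 : x ∈ S := ⟨1, 0, 0, by module⟩
    have m2 : y ∈ S := ⟨0, 1, 0, by module⟩
    have m3 : z ∈ S := ⟨0, 0, 1, by module⟩
    refine isSolvable_of_span (x := (⟨x, m1⟩ : S)) (y := ⟨y, m2⟩) (z := ⟨z, m3⟩) ?_ ?_ ?_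
    · refine Subtype.ext (Subtype.ext ?_)
      have := hbr (α := 1) (β := 0) (c := 0) (α' := 0) (β' := 0) (c' := 1)
      simpa using this
    · refine Subtype.ext (Subtype.ext ?_)
      have := hbr (α := 0) (β := 1) (c := 0) (α' := 0) (β' := 0) (c' := 1)
      simpa using this
    · rintro ⟨w, α, β, c, rfl⟩
      exact ⟨α, β, c, rfl⟩
  · -- `[𝒴(1), 𝒴(t)] = 𝒲(-1/2)` is not zero
    intro hab
    have c : ∀ r : ℝ, ContDiffOn ℝ ∞ (fun _ : ℝ => r) (times U) := fun r => contDiffOn_const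
    have hexN : ∀ g : ℝ → ℝ, ContDiffOn ℝ ∞ g (times U) → ∃ V : N, HasParams a₁ a₃ V.1.1
        (kmParams g (fun _ => 0) (fun _ => 0) fun _ => 0) := fun g hg => by
      obtain ⟨V, hV⟩ := exists_hasParams (U := U) (a₁ := a₁) (a₃ := a₃)
        (P := kmParams g (fun _ => 0) (fun _ => 0) fun _ => 0) ⟨c 0, hg, c 0, c 0, c 0⟩
        (by simp [kmParams])
      exact ⟨⟨⟨V, (hmem V).2 ⟨_, hV⟩⟩, (inKacMoody_iff (a₃ := a₃)).2 ⟨_, _, _, _, hV⟩⟩, hV⟩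
    obtain ⟨V, hV⟩ := hexN (fun _ => 1) (c 1)
    obtain ⟨W, hW⟩ := hexN (fun t => t) contDiffOn_id
    have h0 : ⁅V.1.1, W.1.1⁆ = 0 := congrArg (fun X : N => X.1.1) (hab.trivial V W)
    have hv := ((hV.br ha₁ hW).eq_zero_iff hne).1 h0
    obtain ⟨p, hp⟩ := hne
    have := hv.m _ (mem_times hp)
    rw [br_kmParams] at this
    simp [kmParams] at this

end Semidirect

/-! ### Isomorphisms induced by changes of the time -/

section Isomorphism

/-- A linear relation between Lie algebras that respects brackets and is total and injective on both
sides is an isomorphism. -/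
theorem nonempty_lieEquiv_of_rel {L L' : Type*} [LieRing L] [LieAlgebra ℝ L] [LieRing L']
    [LieAlgebra ℝ L'] (R : L → L' → Prop)
    (hlin : ∀ x x' y y', R x x' → R y y' → ∀ a b : ℝ, R (a • x + b • y) (a • x' + b • y'))
    (hlie : ∀ x x' y y', R x x' → R y y' → R ⁅x, y⁆ ⁅x', y'⁆)
    (hl : ∀ x, ∃ x', R x x') (hr : ∀ x', ∃ x, R x x')
    (hl0 : ∀ x', R 0 x' → x' = 0) (hr0 : ∀ x, R x 0 → x = 0) : Nonempty (L ≃ₗ⁅ℝ⁆ L') := by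
  choose f hf using hl
  have hu : ∀ x x', R x x' → x' = f x := fun x x' h => by
    have := hlin _ _ _ _ h (hf x) 1 (-1)
    rw [one_smul, neg_one_smul, add_neg_cancel] at this
    have := hl0 _ this
    rwa [one_smul, neg_one_smul, add_neg_eq_zero] at this
  let F : L →ₗ⁅ℝ⁆ L' :=
    { toFun := f
      map_add' := fun x y => by
        have := hlin _ _ _ _ (hf x) (hf y) 1 1
        simp only [one_smul] at this
        exact (hu _ _ this).symm
      map_smul' := fun a x => by
        have := hlin _ _ _ _ (hf x) (hf x) a 0
        simp only [zero_smul, add_zero] at this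
        exact (hu _ _ this).symm
      map_lie' := fun {x y} => (hu _ _ (hlie _ _ _ _ (hf x) (hf y))).symm }
  have hinj : Function.Injective F := by
    refine (injective_iff_map_eq_zero F).2 fun x hx => hr0 x ?_
    have := hf x
    rwa [show f x = 0 from hx] at this
  have hsurj : Function.Surjective F := fun x' => by
    obtain ⟨x, hx⟩ := hr x'
    exact ⟨x, (hu _ _ hx).symm⟩
  exact ⟨LieEquiv.ofBijective F ⟨hinj, hsurj⟩⟩

/-- A change `σ` of the time from `I'` to `I`, with inverse `ρ`, such that `σ' = l r²` with
`r' = -2 a₃ r`.  It transforms the equation `τ'' = 0` for vector fields `τ ∂_t` on `I` into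
`τ'' = 4 a₃ τ'` on `I'`. -/
structure TimeChange (a₃ : ℝ) (I I' : Set ℝ) where
  σ : ℝ → ℝ
  ρ : ℝ → ℝ
  r : ℝ → ℝ
  l : ℝ
  l_ne : l ≠ 0
  r_ne : ∀ t, r t ≠ 0
  hσ : ∀ t, HasDerivAt σ (l * r t ^ 2) t
  hr : ∀ t, HasDerivAt r (-2 * a₃ * r t) t
  σ_smooth : ContDiff ℝ ∞ σ
  r_smooth : ContDiff ℝ ∞ r
  ρ_smooth : ContDiffOn ℝ ∞ ρ I
  σ_mem : ∀ t ∈ I', σ t ∈ I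
  ρ_mem : ∀ s ∈ I, ρ s ∈ I'
  σ_ρ : ∀ s ∈ I, σ (ρ s) = s
  ρ_σ : ∀ t ∈ I', ρ (σ t) = t

namespace TimeChange

variable {a₁ a₃ : ℝ} {I I' : Set ℝ} (C : TimeChange a₃ I I')

/-- The transformed parameters: `τ` transforms as a vector field, `g, h, k` as densities of weight
`-1/2`, and `m` as a function, up to the constant factor that preserves the brackets. -/
def pull (P : Params) : Params where
  τ := fun t => P.τ (C.σ t) / (C.l * C.r t ^ 2)
  c := P.c
  g := fun t => P.g (C.σ t) / C.r t
  h := fun t => P.h (C.σ t) / C.r t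
  k := fun t => P.k (C.σ t) / C.r t
  m := fun t => C.l * P.m (C.σ t)

/-- The inverse of `pull`. -/
def push (P : Params) : Params where
  τ := fun s => P.τ (C.ρ s) * (C.l * C.r (C.ρ s) ^ 2)
  c := P.c
  g := fun s => P.g (C.ρ s) * C.r (C.ρ s)
  h := fun s => P.h (C.ρ s) * C.r (C.ρ s)
  k := fun s => P.k (C.ρ s) * C.r (C.ρ s)
  m := fun s => P.m (C.ρ s) / C.l

theorem smooth_comp {f : ℝ → ℝ} (hf : ContDiffOn ℝ ∞ f I) :
    ContDiffOn ℝ ∞ (fun t => f (C.σ t)) I' :=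
  hf.comp C.σ_smooth.contDiffOn C.σ_mem

theorem pull_smooth {P : Params} (hP : P.SmoothOn I) : (C.pull P).SmoothOn I' := by
  have w := C.r_smooth.contDiffOn (s := I')
  have hd : ∀ {f : ℝ → ℝ}, ContDiffOn ℝ ∞ f I → ContDiffOn ℝ ∞ (fun t => f (C.σ t) / C.r t) I' :=
    fun hf => (C.smooth_comp hf).div w fun t _ => C.r_ne t
  exact ⟨(C.smooth_comp hP.τ).div (contDiffOn_const.mul (w.pow 2)) fun t _ =>
      mul_ne_zero C.l_ne (pow_ne_zero 2 (C.r_ne t)),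
    hd hP.g, hd hP.h, hd hP.k, contDiffOn_const.mul (C.smooth_comp hP.m)⟩

theorem push_smooth {P : Params} (hP : P.SmoothOn I') : (C.push P).SmoothOn I := by
  have w : ContDiffOn ℝ ∞ (fun s => C.r (C.ρ s)) I := C.r_smooth.comp_contDiffOn C.ρ_smooth
  have hc : ∀ {f : ℝ → ℝ}, ContDiffOn ℝ ∞ f I' → ContDiffOn ℝ ∞ (fun s => f (C.ρ s)) I :=
    fun hf => hf.comp C.ρ_smooth C.ρ_mem
  exact ⟨(hc hP.τ).mul (contDiffOn_const.mul (w.pow 2)), (hc hP.g).mul w, (hc hP.h).mul w,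
    (hc hP.k).mul w, (hc hP.m).div_const _⟩

theorem pull_lin (a b : ℝ) (P Q : Params) :
    C.pull (Params.lin a P b Q) = Params.lin a (C.pull P) b (C.pull Q) := by
  simp only [pull, Params.lin, Params.mk.injEq]
  refine ⟨?_, trivial, ?_, ?_, ?_, ?_⟩ <;> funext t <;> ring

theorem hasDerivAt_comp (hI : IsOpen I) {f : ℝ → ℝ} (hf : ContDiffOn ℝ ∞ f I) {t : ℝ}
    (ht : t ∈ I') :
    HasDerivAt (fun t => f (C.σ t)) (deriv f (C.σ t) * (C.l * C.r t ^ 2)) t :=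
  (smoothOn_hasDerivAt hI hf (C.σ_mem t ht)).comp t (C.hσ t)

theorem deriv_field (hI : IsOpen I) {f : ℝ → ℝ} (hf : ContDiffOn ℝ ∞ f I) :
    ∀ t ∈ I', deriv (fun t => f (C.σ t) / (C.l * C.r t ^ 2)) t =
      deriv f (C.σ t) + 4 * a₃ * (f (C.σ t) / (C.l * C.r t ^ 2)) := fun t ht => by
  have hl := C.l_ne
  have hw := C.r_ne t
  rw [((C.hasDerivAt_comp hI hf ht).fun_div (((C.hr t).fun_pow 2).const_mul C.l)
    (mul_ne_zero hl (pow_ne_zero 2 hw))).deriv]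
  field_simp
  ring

theorem deriv_density (hI : IsOpen I) {f : ℝ → ℝ} (hf : ContDiffOn ℝ ∞ f I) :
    ∀ t ∈ I', deriv (fun t => f (C.σ t) / C.r t) t =
      C.l * C.r t * deriv f (C.σ t) + 2 * a₃ * (f (C.σ t) / C.r t) := fun t ht => by
  have hw := C.r_ne t
  rw [((C.hasDerivAt_comp hI hf ht).fun_div (C.hr t) hw).deriv]
  field_simp
  ring

theorem deriv_function (hI : IsOpen I) {f : ℝ → ℝ} (hf : ContDiffOn ℝ ∞ f I) :
    ∀ t ∈ I', deriv (fun t => C.l * f (C.σ t)) t =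
      C.l * (deriv f (C.σ t) * (C.l * C.r t ^ 2)) := fun _ ht =>
  ((C.hasDerivAt_comp hI hf ht).const_mul C.l).deriv

theorem deriv_deriv_field (hI : IsOpen I) (hI' : IsOpen I') {f : ℝ → ℝ} (hf : ContDiffOn ℝ ∞ f I) :
    ∀ t ∈ I', deriv (deriv fun t => f (C.σ t) / (C.l * C.r t ^ 2)) t =
      deriv (deriv f) (C.σ t) * (C.l * C.r t ^ 2) +
        4 * a₃ * deriv (fun t => f (C.σ t) / (C.l * C.r t ^ 2)) t := fun t ht => by
  have hs : ContDiffOn ℝ ∞ (fun t => f (C.σ t) / (C.l * C.r t ^ 2)) I' :=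
    (C.smooth_comp hf).div (contDiffOn_const.mul (C.r_smooth.contDiffOn.pow 2)) fun t _ =>
      mul_ne_zero C.l_ne (pow_ne_zero 2 (C.r_ne t))
  rw [deriv_congr hI' (C.deriv_field hI hf) t ht]
  exact ((C.hasDerivAt_comp hI (deriv_smoothOn hI hf) ht).fun_add
    ((smoothOn_hasDerivAt hI' hs ht).const_mul (4 * a₃))).deriv

end TimeChange

/-- The parameters agree on `I`. -/
structure Params.EqOn (P Q : Params) (I : Set ℝ) : Prop where
  τ : ∀ t ∈ I, P.τ t = Q.τ t
  c : P.c = Q.c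
  g : ∀ t ∈ I, P.g t = Q.g t
  h : ∀ t ∈ I, P.h t = Q.h t
  k : ∀ t ∈ I, P.k t = Q.k t
  m : ∀ t ∈ I, P.m t = Q.m t

theorem HasParams.of_eqOn {U : TopologicalSpace.Opens Pt} {a₁ a₃ : ℝ} {V : VField U}
    {P Q : Params} (hV : HasParams a₁ a₃ V P) (hQ : Q.SmoothOn (times U))
    (h : P.EqOn Q (times U)) : HasParams a₁ a₃ V Q := by
  have hI := times_isOpen U
  have e1 := deriv_congr hI h.τ
  have e2 := deriv_congr hI e1
  refine ⟨hQ, fun t ht => by rw [← e1 t ht, ← e2 t ht, hV.ode t ht], fun p hp => ?_⟩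
  have hv : (Params.lin 1 P (-1) Q).VanishesOn (times U) := by
    constructor
    · intro t ht; simp [Params.lin, h.τ t ht]
    · simp [Params.lin, h.c]
    · intro t ht; simp [Params.lin, h.g t ht]
    · intro t ht; simp [Params.lin, h.h t ht]
    · intro t ht; simp [Params.lin, h.k t ht]
    · intro t ht; simp [Params.lin, h.m t ht]
  have h0 := hv.field_eq_zero (a₁ := a₁) hp
  rw [field_lin hV.smooth hQ _ _ hp, ← hV.eq p hp, one_smul, neg_one_smul, add_neg_eq_zero] at h0
  exact h0

namespace TimeChange

variable {a₁ a₃ : ℝ} {I I' : Set ℝ} (C : TimeChange a₃ I I')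

theorem pull_push (P : Params) : (C.pull (C.push P)).EqOn P I' := by
  have hl := C.l_ne
  have hw := C.r_ne
  constructor <;> try intro t ht
  · simp only [pull, push, C.ρ_σ t ht]
    exact mul_div_cancel_right₀ _ (mul_ne_zero hl (pow_ne_zero 2 (hw t)))
  · rfl
  · simp only [pull, push, C.ρ_σ t ht]
    exact mul_div_cancel_right₀ _ (hw t)
  · simp only [pull, push, C.ρ_σ t ht]
    exact mul_div_cancel_right₀ _ (hw t)
  · simp only [pull, push, C.ρ_σ t ht]
    exact mul_div_cancel_right₀ _ (hw t)
  · simp only [pull, push, C.ρ_σ t ht]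
    exact mul_div_cancel₀ _ hl

/-- The change of the time preserves brackets.  The terms `2 a₃ g` in the derivatives of the
densities cancel in the Wronskians. -/
theorem br_pull (hI : IsOpen I) {P Q : Params} (hP : P.SmoothOn I) (hQ : Q.SmoothOn I) :
    (Params.br a₁ (C.pull P) (C.pull Q)).EqOn (C.pull (Params.br a₁ P Q)) I' := by
  have hl := C.l_ne
  have hw := C.r_ne
  constructor <;> try intro t ht
  · have := hw t
    simp only [Params.br, pull, C.deriv_field hI hP.τ t ht, C.deriv_field hI hQ.τ t ht]
    field_simp
    ring
  · rfl
  · have := hw t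
    simp only [Params.br, pull, C.deriv_field hI hP.τ t ht, C.deriv_field hI hQ.τ t ht,
      C.deriv_density hI hP.g t ht, C.deriv_density hI hQ.g t ht]
    field_simp
    ring
  · have := hw t
    simp only [Params.br, pull, C.deriv_field hI hP.τ t ht, C.deriv_field hI hQ.τ t ht,
      C.deriv_density hI hP.h t ht, C.deriv_density hI hQ.h t ht]
    field_simp
    ring
  · have := hw t
    simp only [Params.br, pull, C.deriv_field hI hP.τ t ht, C.deriv_field hI hQ.τ t ht,
      C.deriv_density hI hP.k t ht, C.deriv_density hI hQ.k t ht]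
    field_simp
    ring
  · have := hw t
    simp only [Params.br, pull, C.deriv_function hI hP.m t ht, C.deriv_function hI hQ.m t ht,
      C.deriv_density hI hP.g t ht, C.deriv_density hI hQ.g t ht, C.deriv_density hI hP.h t ht,
      C.deriv_density hI hQ.h t ht, C.deriv_density hI hP.k t ht, C.deriv_density hI hQ.k t ht]
    have e : ∀ x y x' y' : ℝ, (C.l * C.r t * x' + 2 * a₃ * (x / C.r t)) * (y / C.r t)
        - x / C.r t * (C.l * C.r t * y' + 2 * a₃ * (y / C.r t)) = C.l * (x' * y - x * y') := by
      intro x y x' y'; field_simp; ring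
    have e' : ∀ x y : ℝ, x / (C.l * C.r t ^ 2) * (C.l * (y * (C.l * C.r t ^ 2))) = C.l * (x * y) := by
      intro x y; field_simp
    rw [e, e, e, e', e']
    ring

theorem vanishesOn_pull_iff (P : Params) : (C.pull P).VanishesOn I' ↔ P.VanishesOn I := by
  have hl := C.l_ne
  constructor
  · intro h
    have hd : ∀ {f : ℝ → ℝ}, (∀ t ∈ I', f (C.σ t) / C.r t = 0) → ∀ s ∈ I, f s = 0 :=
      fun h s hs => by
        have := h _ (C.ρ_mem s hs)
        rw [C.σ_ρ s hs] at this
        exact (div_eq_zero_iff.1 this).resolve_right (C.r_ne _)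
    refine ⟨fun s hs => ?_, h.c, hd h.g, hd h.h, hd h.k, fun s hs => ?_⟩
    · have := h.τ _ (C.ρ_mem s hs)
      simp only [pull, C.σ_ρ s hs] at this
      exact (div_eq_zero_iff.1 this).resolve_right (mul_ne_zero hl (pow_ne_zero 2 (C.r_ne _)))
    · have := h.m _ (C.ρ_mem s hs)
      simp only [pull, C.σ_ρ s hs] at this
      exact (mul_eq_zero.1 this).resolve_left hl
  · intro h
    constructor <;> try intro t ht
    · simp [pull, h.τ _ (C.σ_mem t ht)]
    · exact h.c
    · simp [pull, h.g _ (C.σ_mem t ht)]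
    · simp [pull, h.h _ (C.σ_mem t ht)]
    · simp [pull, h.k _ (C.σ_mem t ht)]
    · simp [pull, h.m _ (C.σ_mem t ht)]

/-- A change of the time induces an isomorphism of the algebras of explicit fields. -/
theorem nonempty_lieEquiv {U U' : TopologicalSpace.Opens Pt} {Δ Δ' : PDESystem}
    (C : TimeChange a₃ (times U) (times U')) (ha₁ : a₁ ≠ 0) (hne : (U : Set Pt).Nonempty)
    (hne' : (U' : Set Pt).Nonempty) (hΔ : Classified Δ U a₁ 0) (hΔ' : Classified Δ' U' a₁ a₃) :
    Nonempty (symmetryAlgebra Δ U ≃ₗ⁅ℝ⁆ symmetryAlgebra Δ' U') := by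
  have hI := times_isOpen U
  have hI' := times_isOpen U'
  have hl := C.l_ne
  -- the parameters matter on the intervals of the time only, so that the isomorphism is described
  -- by a relation rather than by a choice of parameters
  refine nonempty_lieEquiv_of_rel (fun V V' => ∃ P, HasParams a₁ 0 V.1 P ∧
    HasParams a₁ a₃ V'.1 (C.pull P)) ?_ ?_ ?_ ?_ ?_ ?_
  · rintro V V' W W' ⟨P, hP, hP'⟩ ⟨Q, hQ, hQ'⟩ a b
    refine ⟨_, hP.lin hQ a b, ?_⟩
    rw [C.pull_lin]
    exact hP'.lin hQ' a b
  · rintro V V' W W' ⟨P, hP, hP'⟩ ⟨Q, hQ, hQ'⟩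
    exact ⟨_, hP.br ha₁ hQ, (hP'.br ha₁ hQ').of_eqOn
      (C.pull_smooth (hP.smooth.br hI hQ.smooth a₁)) (C.br_pull hI hP.smooth hQ.smooth)⟩
  · rintro ⟨V, hV⟩
    obtain ⟨P, hP⟩ := (hΔ.mem_symmetryAlgebra_iff ha₁ V).1 hV
    obtain ⟨V', hV'⟩ := exists_hasParams (a₁ := a₁) (a₃ := a₃) (C.pull_smooth hP.smooth)
      fun t ht => by
        have := C.deriv_deriv_field hI hI' hP.smooth.τ t ht
        rw [hP.ode _ (C.σ_mem t ht), mul_zero, zero_mul, zero_mul, zero_add] at this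
        exact this
    exact ⟨⟨V', (hΔ'.mem_symmetryAlgebra_iff ha₁ V').2 ⟨_, hV'⟩⟩, P, hP, hV'⟩
  · rintro ⟨V', hV'⟩
    obtain ⟨P', hP'⟩ := (hΔ'.mem_symmetryAlgebra_iff ha₁ V').1 hV'
    have hs := C.push_smooth hP'.smooth
    have hps := C.pull_smooth hs
    have he := C.pull_push P'
    obtain ⟨V, hV⟩ := exists_hasParams (a₁ := a₁) (a₃ := 0) hs fun s hs' => by
      have ht := C.ρ_mem s hs'
      have h1 := C.deriv_deriv_field hI hI' hs.τ _ ht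
      have e1 := deriv_congr hI' he.τ
      have e2 := deriv_congr hI' e1
      have h2 := hP'.ode _ ht
      rw [← e1 _ ht, ← e2 _ ht] at h2
      have h3 : deriv (deriv (C.push P').τ) (C.σ (C.ρ s)) * (C.l * C.r (C.ρ s) ^ 2) = 0 := by
        have := h1.symm.trans h2
        simpa [pull] using this
      rw [C.σ_ρ s hs'] at h3
      rw [(mul_eq_zero.1 h3).resolve_right (mul_ne_zero hl (pow_ne_zero 2 (C.r_ne _)))]
      ring
    refine ⟨⟨V, (hΔ.mem_symmetryAlgebra_iff ha₁ V).2 ⟨_, hV⟩⟩, _, hV, hP'.of_eqOn hps ?_⟩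
    exact ⟨fun t ht => (he.τ t ht).symm, he.c.symm, fun t ht => (he.g t ht).symm,
      fun t ht => (he.h t ht).symm, fun t ht => (he.k t ht).symm, fun t ht => (he.m t ht).symm⟩
  · rintro V' ⟨P, hP, hP'⟩
    have h0 := (hP.eq_zero_iff hne).1 rfl
    exact Subtype.ext ((hP'.eq_zero_iff hne').2 ((C.vanishesOn_pull_iff P).2 h0))
  · rintro V ⟨P, hP, hP'⟩
    have h0 := (hP'.eq_zero_iff hne').1 rfl
    exact Subtype.ext ((hP.eq_zero_iff hne).2 ((C.vanishesOn_pull_iff P).1 h0))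

/-- The trivial change of the time. -/
def refl (I : Set ℝ) : TimeChange 0 I I where
  σ := id
  ρ := id
  r := fun _ => 1
  l := 1
  l_ne := one_ne_zero
  r_ne := fun _ => one_ne_zero
  hσ := fun t => by simpa using hasDerivAt_id t
  hr := fun t => by simpa using hasDerivAt_const t (1 : ℝ)
  σ_smooth := contDiff_id
  r_smooth := contDiff_const
  ρ_smooth := contDiffOn_id
  σ_mem := fun _ h => h
  ρ_mem := fun _ h => h
  σ_ρ := fun _ _ => rfl
  ρ_σ := fun _ _ => rfl

/-- The change of the time `s = T₁ e^{-4 a₃ t} + T₀`. -/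
def exponential {T₀ T₁ : ℝ} (ha₃ : a₃ ≠ 0) (hT₁ : T₁ ≠ 0)
    (h : I = (fun t => T₁ * Real.exp (-4 * a₃ * t) + T₀) '' I') : TimeChange a₃ I I' :=
  have hinv : ∀ t, -Real.log ((T₁ * Real.exp (-4 * a₃ * t) + T₀ - T₀) / T₁) / (4 * a₃) = t :=
    fun t => by
      rw [add_sub_cancel_right, mul_div_cancel_left₀ _ hT₁, Real.log_exp]
      field_simp
  { σ := fun t => T₁ * Real.exp (-4 * a₃ * t) + T₀
    ρ := fun s => -Real.log ((s - T₀) / T₁) / (4 * a₃)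
    r := fun t => Real.exp (-2 * a₃ * t)
    l := -4 * a₃ * T₁
    l_ne := by simp [ha₃, hT₁]
    r_ne := fun t => (Real.exp_pos _).ne'
    hσ := fun t => by
      have h1 := ((((hasDerivAt_id t).const_mul (-4 * a₃)).exp).const_mul T₁).add_const T₀
      have h2 : Real.exp (-2 * a₃ * t) ^ 2 = Real.exp (-4 * a₃ * t) := by
        rw [← Real.exp_nat_mul]
        push_cast
        ring_nf
      refine h1.congr_deriv ?_
      rw [h2]
      simp only [id]
      ring
    hr := fun t => by
      have h1 := ((hasDerivAt_id t).const_mul (-2 * a₃)).exp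
      refine h1.congr_deriv ?_
      simp only [id]
      ring
    σ_smooth := by fun_prop
    r_smooth := by fun_prop
    ρ_smooth := by
      refine ContDiffOn.div_const (ContDiffOn.neg (ContDiffOn.log (by fun_prop) ?_)) _
      intro s hs
      rw [h] at hs
      obtain ⟨t, -, rfl⟩ := hs
      simp [hT₁]
    σ_mem := fun t ht => by rw [h]; exact ⟨t, ht, rfl⟩
    ρ_mem := fun s hs => by
      rw [h] at hs
      obtain ⟨t, ht, rfl⟩ := hs
      simpa only [hinv] using ht
    σ_ρ := fun s hs => by
      rw [h] at hs
      obtain ⟨t, ht, rfl⟩ := hs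
      simp only [hinv]
    ρ_σ := fun t _ => hinv t }

end TimeChange

end Isomorphism

/-! ### Partial derivatives of composite functions -/

section Calculus

variable {F : Type*} [NormedAddCommGroup F] [NormedSpace ℝ F]
variable {𝔸 : Type*} [NormedCommRing 𝔸] [NormedAlgebra ℝ 𝔸]
variable {O : Set Base} {p : Base}

theorem pd_eq_dd (i : Fin 4) (f : Base → F) : pd i f = dd (Pi.single i 1) f := rfl

theorem pd_smoothOn (hO : IsOpen O) {f : Base → F} (hf : ContDiffOn ℝ ∞ f O) (i : Fin 4) :
    ContDiffOn ℝ ∞ (pd i f) O := dd_smoothOn hO hf _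

theorem pd_smooth {f : Base → F} (hf : ContDiff ℝ ∞ f) (i : Fin 4) : ContDiff ℝ ∞ (pd i f) :=
  contDiffOn_univ.1 (pd_smoothOn isOpen_univ hf.contDiffOn i)

theorem pd_congr (hO : IsOpen O) {f g : Base → F} (h : ∀ q ∈ O, f q = g q) (i : Fin 4) :
    ∀ q ∈ O, pd i f q = pd i g q := dd_congr hO h _

theorem pd_comm (hO : IsOpen O) {f : Base → F} (hf : ContDiffOn ℝ ∞ f O) (i j : Fin 4) :
    ∀ q ∈ O, pd i (pd j f) q = pd j (pd i f) q := dd_comm hO hf _ _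

theorem pd_add (hO : IsOpen O) {f g : Base → F} (hf : ContDiffOn ℝ ∞ f O)
    (hg : ContDiffOn ℝ ∞ g O) (i : Fin 4) (hp : p ∈ O) :
    pd i (fun q => f q + g q) p = pd i f p + pd i g p :=
  dd_add (smoothOn_differentiableAt hO hf hp) (smoothOn_differentiableAt hO hg hp)

theorem pd_mul (hO : IsOpen O) {f g : Base → 𝔸} (hf : ContDiffOn ℝ ∞ f O)
    (hg : ContDiffOn ℝ ∞ g O) (i : Fin 4) (hp : p ∈ O) :
    pd i (fun q => f q * g q) p = pd i f p * g p + f p * pd i g p :=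
  dd_mul (smoothOn_differentiableAt hO hf hp) (smoothOn_differentiableAt hO hg hp)

theorem pd_const_mul (hO : IsOpen O) (c : 𝔸) {f : Base → 𝔸} (hf : ContDiffOn ℝ ∞ f O)
    (i : Fin 4) (hp : p ∈ O) : pd i (fun q => c * f q) p = c * pd i f p :=
  dd_const_mul c (smoothOn_differentiableAt hO hf hp)

theorem pd_smul (hO : IsOpen O) {a : Base → ℝ} {f : Base → F} (ha : ContDiffOn ℝ ∞ a O)
    (hf : ContDiffOn ℝ ∞ f O) (i : Fin 4) (hp : p ∈ O) :
    pd i (fun q => a q • f q) p = pd i a p • f p + a p • pd i f p := by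
  have ha' := smoothOn_differentiableAt hO ha hp
  have hf' := smoothOn_differentiableAt hO hf hp
  simp only [pd, fderiv_fun_smul ha' hf']
  simp [add_comm]

theorem pd_const (c : F) (i : Fin 4) (p : Base) : pd i (fun _ => c) p = 0 := dd_const _ _ _

theorem pd_coord (l i : Fin 4) (p : Base) :
    pd i (fun q : Base => q l) p = if l = i then 1 else 0 := by
  have h : HasFDerivAt (fun q : Base => q l) (ContinuousLinearMap.proj (R := ℝ)
      (φ := fun _ : Fin 4 => ℝ) l) p :=
    (ContinuousLinearMap.proj (R := ℝ) (φ := fun _ : Fin 4 => ℝ) l).hasFDerivAt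
  rw [pd, h.fderiv]
  simp [Pi.single_apply]

theorem smoothOn_pi {N : Base → Base} (hN : ∀ l, ContDiffOn ℝ ∞ (fun q => N q l) O) :
    ContDiffOn ℝ ∞ N O := contDiffOn_pi.2 hN

theorem pd_apply (hO : IsOpen O) {N : Base → Base} (hN : ∀ l, ContDiffOn ℝ ∞ (fun q => N q l) O)
    (i l : Fin 4) (hp : p ∈ O) : fderiv ℝ N p (Pi.single i 1) l = pd i (fun q => N q l) p := by
  have h : HasFDerivAt (fun q => N q l) _ p :=
    hasFDerivAt_pi'.1 (smoothOn_differentiableAt hO (smoothOn_pi hN) hp).hasFDerivAt l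
  rw [pd, h.fderiv]
  rfl

/-- The chain rule. -/
theorem pd_comp (hO : IsOpen O) {N : Base → Base} (hN : ∀ l, ContDiffOn ℝ ∞ (fun q => N q l) O)
    {Φ : Base → F} (hΦ : ContDiff ℝ ∞ Φ) (i : Fin 4) (hp : p ∈ O) :
    pd i (fun q => Φ (N q)) p = ∑ l, pd i (fun q => N q l) p • pd l Φ (N p) := by
  have h1 : HasFDerivAt Φ (fderiv ℝ Φ (N p)) (N p) :=
    (hΦ.differentiable (by simp) _).hasFDerivAt
  have h2 := (smoothOn_differentiableAt hO (smoothOn_pi hN) hp).hasFDerivAt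
  have h3 : fderiv ℝ (fun q => Φ (N q)) p = (fderiv ℝ Φ (N p)).comp (fderiv ℝ N p) :=
    (h1.comp p h2).fderiv
  rw [pd, h3, ContinuousLinearMap.comp_apply,
    pi_eq_sum_univ' (fderiv ℝ N p (Pi.single i 1)), map_sum]
  refine Finset.sum_congr rfl fun l _ => ?_
  rw [map_smul, pd_apply hO hN i l hp]
  rfl

theorem smoothOn_comp {N : Base → Base} (hN : ∀ l, ContDiffOn ℝ ∞ (fun q => N q l) O)
    {Φ : Base → F} (hΦ : ContDiff ℝ ∞ Φ) : ContDiffOn ℝ ∞ (fun q => Φ (N q)) O :=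
  hΦ.comp_contDiffOn (smoothOn_pi hN)

theorem pd_mul_comp (hO : IsOpen O) {N : Base → Base}
    (hN : ∀ l, ContDiffOn ℝ ∞ (fun q => N q l) O) {G : Base → 𝔸} (hG : ContDiffOn ℝ ∞ G O)
    {Φ : Base → 𝔸} (hΦ : ContDiff ℝ ∞ Φ) (i : Fin 4) (hp : p ∈ O) :
    pd i (fun q => G q * Φ (N q)) p =
      pd i G p * Φ (N p) + G p * ∑ l, pd i (fun q => N q l) p • pd l Φ (N p) := by
  rw [pd_mul hO hG (smoothOn_comp hN hΦ) i hp, pd_comp hO hN hΦ i hp]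

theorem pd_pd_comp (hO : IsOpen O) {N : Base → Base}
    (hN : ∀ l, ContDiffOn ℝ ∞ (fun q => N q l) O)
    {Φ : Base → F} (hΦ : ContDiff ℝ ∞ Φ) (i : Fin 4) (hp : p ∈ O) :
    pd i (pd i fun q => Φ (N q)) p = ∑ l, (pd i (pd i fun q => N q l) p • pd l Φ (N p)
      + pd i (fun q => N q l) p • ∑ m, pd i (fun q => N q m) p • pd m (pd l Φ) (N p)) := by
  have hd := fun l => smoothOn_comp hN (pd_smooth hΦ l)
  have hn := fun l => pd_smoothOn hO (hN l) i
  rw [pd_congr hO (fun q hq => pd_comp hO hN hΦ i hq) i p hp, pd_eq_dd, dd_sum]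
  · refine Finset.sum_congr rfl fun l _ => ?_
    rw [← pd_comp hO hN (pd_smooth hΦ l) i hp]
    exact pd_smul hO (hn l) (hd l) i hp
  · exact fun l _ => smoothOn_differentiableAt hO ((hn l).smul (hd l)) hp

theorem pd_pd_mul_comp (hO : IsOpen O) {N : Base → Base}
    (hN : ∀ l, ContDiffOn ℝ ∞ (fun q => N q l) O) {G : Base → 𝔸} (hG : ContDiffOn ℝ ∞ G O)
    {Φ : Base → 𝔸} (hΦ : ContDiff ℝ ∞ Φ) (i : Fin 4) (hp : p ∈ O) :
    pd i (pd i fun q => G q * Φ (N q)) p = pd i (pd i G) p * Φ (N p)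
      + 2 * pd i G p * ∑ l, pd i (fun q => N q l) p • pd l Φ (N p)
      + G p * ∑ l, (pd i (pd i fun q => N q l) p • pd l Φ (N p)
        + pd i (fun q => N q l) p • ∑ m, pd i (fun q => N q m) p • pd m (pd l Φ) (N p)) := by
  have hc := smoothOn_comp hN hΦ
  have hG' := pd_smoothOn hO hG i
  have hc' := pd_smoothOn hO hc i
  rw [pd_congr hO (fun q hq => pd_mul hO hG hc i hq) i p hp,
    pd_add hO (hG'.mul hc) (hG.mul hc') i hp, pd_mul hO hG' hc i hp, pd_mul hO hG hc' i hp,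
    pd_pd_comp hO hN hΦ i hp, pd_comp hO hN hΦ i hp]
  ring

theorem smoothOn_norm_sq {Ψ : Base → ℂ} (hΨ : ContDiff ℝ ∞ Ψ) :
    ContDiff ℝ ∞ fun q => ‖Ψ q‖ ^ 2 := hΨ.norm_sq ℝ

theorem pd_norm_sq {Ψ : Base → ℂ} (hΨ : ContDiff ℝ ∞ Ψ) (i : Fin 4) (p : Base) :
    pd i (fun q => ‖Ψ q‖ ^ 2) p = 2 * inner ℝ (Ψ p) (pd i Ψ p) := by
  have h := ((hΨ.differentiable (by simp) p).hasFDerivAt).norm_sq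
  rw [pd, h.fderiv]
  simp [pd]
  ring

theorem pd_pd_norm_sq {Ψ : Base → ℂ} (hΨ : ContDiff ℝ ∞ Ψ) (i j : Fin 4) (p : Base) :
    pd i (pd j fun q => ‖Ψ q‖ ^ 2) p =
      2 * (inner ℝ (pd i Ψ p) (pd j Ψ p) + inner ℝ (Ψ p) (pd i (pd j Ψ) p)) := by
  have e : (pd j fun q => ‖Ψ q‖ ^ 2) = fun q => 2 * inner ℝ (Ψ q) (pd j Ψ q) :=
    funext fun q => pd_norm_sq hΨ j q
  have d1 := hΨ.differentiable (by simp) p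
  have d2 := (pd_smooth hΨ j).differentiable (by simp) p
  rw [e, pd_eq_dd, dd_const_mul _ (d1.inner ℝ d2), dd, fderiv_inner_apply ℝ d1 d2, add_comm]
  rfl

end Calculus

/-! ### The transformed system in terms of the jets of the new functions -/

section Quadratic

variable {F : Type*} [NormedAddCommGroup F] [NormedSpace ℝ F]

/-- The quadratic function with value `α`, gradient `β` and (symmetric) Hessian `κ` at `q₀`. -/
def quad (q₀ : Base) (α : F) (β : Fin 4 → F) (κ : Fin 4 → Fin 4 → F) (q : Base) : F :=
  α + ∑ l, (q l - q₀ l) • (β l + (1 / 2 : ℝ) • ∑ m, (q m - q₀ m) • κ l m)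

theorem quad_smooth (q₀ : Base) (α : F) (β : Fin 4 → F) (κ : Fin 4 → Fin 4 → F) :
    ContDiff ℝ ∞ (quad q₀ α β κ) := by
  unfold quad
  fun_prop

theorem pd_linear (q₀ : Base) (β : F) (κ : Fin 4 → F) (c : ℝ) (i : Fin 4) (q : Base) :
    pd i (fun q : Base => β + c • ∑ m, (q m - q₀ m) • κ m) q = c • κ i := by
  have h : ∀ m, HasFDerivAt (fun q : Base => (q m - q₀ m) • κ m)
      ((ContinuousLinearMap.proj (R := ℝ) (φ := fun _ : Fin 4 => ℝ) m).smulRight (κ m)) q :=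
    fun m => ((ContinuousLinearMap.proj (R := ℝ)
      (φ := fun _ : Fin 4 => ℝ) m).hasFDerivAt.sub_const (q₀ m)).smul_const (κ m)
  have h2 := ((HasFDerivAt.fun_sum (u := Finset.univ) fun m _ => h m).fun_const_smul c).const_add β
  rw [pd, h2.fderiv]
  simp [Pi.single_apply]

theorem pd_quad (q₀ : Base) (α : F) (β : Fin 4 → F) {κ : Fin 4 → Fin 4 → F}
    (hκ : ∀ l m, κ l m = κ m l) (i : Fin 4) :
    pd i (quad q₀ α β κ) = fun q => β i + (1 : ℝ) • ∑ m, (q m - q₀ m) • κ i m := by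
  funext q
  have h1 : ∀ l, ContDiffOn ℝ ∞ (fun q : Base => q l - q₀ l) Set.univ := fun l => by fun_prop
  have h2 : ∀ l, ContDiffOn ℝ ∞ (fun q : Base => β l + (1 / 2 : ℝ) • ∑ m, (q m - q₀ m) • κ l m)
      Set.univ := fun l => by fun_prop
  have e : ∀ l, pd i (fun q : Base =>
      (q l - q₀ l) • (β l + (1 / 2 : ℝ) • ∑ m, (q m - q₀ m) • κ l m)) q =
      (if l = i then (1 : ℝ) else 0) • (β l + (1 / 2 : ℝ) • ∑ m, (q m - q₀ m) • κ l m)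
        + (q l - q₀ l) • ((1 / 2 : ℝ) • κ l i) := fun l => by
    rw [pd_smul isOpen_univ (h1 l) (h2 l) i (Set.mem_univ q), pd_linear]
    congr 2
    rw [pd_eq_dd, dd_sub (by fun_prop) (by fun_prop), dd_const, sub_zero]
    exact pd_coord l i q
  have hs : pd i (quad q₀ α β κ) q = ∑ l, pd i (fun q : Base =>
      (q l - q₀ l) • (β l + (1 / 2 : ℝ) • ∑ m, (q m - q₀ m) • κ l m)) q := by
    unfold quad
    rw [pd_eq_dd, dd_add (by fun_prop) (by fun_prop), dd_const, zero_add, dd_sum]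
    · rfl
    · intro l _
      fun_prop
  rw [hs]
  simp only [e, Finset.sum_add_distrib, ite_smul, one_smul, zero_smul, Finset.sum_ite_eq',
    Finset.mem_univ, if_true, add_assoc]
  congr 1
  rw [Finset.smul_sum, ← Finset.sum_add_distrib]
  refine Finset.sum_congr rfl fun m _ => ?_
  rw [hκ m i]
  module

theorem pd_pd_quad (q₀ : Base) (α : F) (β : Fin 4 → F) {κ : Fin 4 → Fin 4 → F}
    (hκ : ∀ l m, κ l m = κ m l) (i j : Fin 4) (q : Base) :
    pd j (pd i (quad q₀ α β κ)) q = κ i j := by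
  rw [pd_quad q₀ α β hκ, pd_linear, one_smul]

end Quadratic

namespace Transformation

variable {τ : Transformation} {O : Set Base} {p : Base}

theorem time_isOpen (hO : IsOpen O) : IsOpen ((fun p : Base => p 0) '' O) :=
  (isOpenMap_eval (X := fun _ : Fin 4 => ℝ) 0) _ hO

theorem IsRegularOn.newVars_smooth (h : τ.IsRegularOn O) (l : Fin 4) :
    ContDiffOn ℝ ∞ (fun q => τ.newVars q l) O := by
  fin_cases l
  · exact h.smooth_T.comp (s := O) (f := fun q : Base => q 0) (by fun_prop)
      fun q hq => ⟨q, hq, rfl⟩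
  · exact h.smooth_X
  · exact h.smooth_Y
  · exact h.smooth_Z

/-- The new time depends on the old time only. -/
theorem IsRegularOn.pd_newVars_zero (hO : IsOpen O) (h : τ.IsRegularOn O) (i : Fin 4)
    (hp : p ∈ O) :
    pd i (fun q => τ.newVars q 0) p = if i = 0 then deriv τ.T (p 0) else 0 := by
  have h1 := smoothOn_hasDerivAt (time_isOpen hO) h.smooth_T ⟨p, hp, rfl⟩
  have h2 : HasFDerivAt (fun q : Base => q 0) (ContinuousLinearMap.proj (R := ℝ)
      (φ := fun _ : Fin 4 => ℝ) 0) p :=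
    (ContinuousLinearMap.proj (R := ℝ) (φ := fun _ : Fin 4 => ℝ) 0).hasFDerivAt
  have h3 : HasFDerivAt (fun q => τ.newVars q 0) _ p := h1.comp_hasFDerivAt p h2
  rw [pd, h3.fderiv]
  simp [Pi.single_apply, eq_comm]

theorem IsRegularOn.pd_newVars_zero_of_ne (hO : IsOpen O) (h : τ.IsRegularOn O) {i : Fin 4}
    (hi : i ≠ 0) (hp : p ∈ O) : pd i (fun q => τ.newVars q 0) p = 0 := by
  rw [h.pd_newVars_zero hO i hp, if_neg hi]

/-- The factor `R e^{iθ}`. -/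
def gauge (τ : Transformation) (q : Base) : ℂ :=
  (τ.R q : ℂ) * Complex.exp (Complex.I * (τ.θ q : ℂ))

theorem gauge_ne_zero (h : τ.IsRegularOn O) (hp : p ∈ O) : τ.gauge p ≠ 0 :=
  mul_ne_zero (Complex.ofReal_ne_zero.2 (h.R_ne_zero p hp)) (Complex.exp_ne_zero _)

theorem ofReal_smoothOn {f : Base → ℝ} (hf : ContDiffOn ℝ ∞ f O) :
    ContDiffOn ℝ ∞ (fun q => (f q : ℂ)) O :=
  Complex.ofRealCLM.contDiff.comp_contDiffOn hf

theorem pd_ofReal (hO : IsOpen O) {f : Base → ℝ} (hf : ContDiffOn ℝ ∞ f O) (i : Fin 4)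
    (hp : p ∈ O) : pd i (fun q => (f q : ℂ)) p = ((pd i f p : ℝ) : ℂ) := by
  have h : HasFDerivAt (fun q => (f q : ℂ)) _ p := Complex.ofRealCLM.hasFDerivAt.comp p
    (smoothOn_differentiableAt hO hf hp).hasFDerivAt
  rw [pd, h.fderiv]
  rfl

theorem exp_smoothOn (h : τ.IsRegularOn O) :
    ContDiffOn ℝ ∞ (fun q => Complex.exp (Complex.I * (τ.θ q : ℂ))) O :=
  (contDiffOn_const.mul (ofReal_smoothOn h.smooth_θ)).cexp

theorem pd_exp (hO : IsOpen O) (h : τ.IsRegularOn O) (i : Fin 4) (hp : p ∈ O) :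
    pd i (fun q => Complex.exp (Complex.I * (τ.θ q : ℂ))) p =
      Complex.exp (Complex.I * (τ.θ p : ℂ)) * (Complex.I * ((pd i τ.θ p : ℝ) : ℂ)) := by
  have h1 := (smoothOn_differentiableAt hO
    (contDiffOn_const (c := Complex.I).mul (ofReal_smoothOn h.smooth_θ)) hp).hasFDerivAt.cexp
  rw [pd, h1.fderiv, smul_apply, smul_eq_mul]
  congr 1
  have h2 := pd_const_mul hO Complex.I (ofReal_smoothOn h.smooth_θ) i hp
  rw [pd_ofReal hO h.smooth_θ i hp] at h2
  exact h2

theorem gauge_smoothOn (h : τ.IsRegularOn O) : ContDiffOn ℝ ∞ τ.gauge O :=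
  (ofReal_smoothOn h.smooth_R).mul (exp_smoothOn h)

theorem pd_gauge (hO : IsOpen O) (h : τ.IsRegularOn O) (i : Fin 4) (hp : p ∈ O) :
    pd i τ.gauge p = Complex.exp (Complex.I * (τ.θ p : ℂ)) *
      (((pd i τ.R p : ℝ) : ℂ) + Complex.I * ((τ.R p * pd i τ.θ p : ℝ) : ℂ)) := by
  have h1 := pd_mul hO (ofReal_smoothOn h.smooth_R) (exp_smoothOn h) i hp
  rw [pd_ofReal hO h.smooth_R i hp, pd_exp hO h i hp] at h1
  refine h1.trans ?_
  push_cast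
  ring

theorem pd_pd_gauge (hO : IsOpen O) (h : τ.IsRegularOn O) (i : Fin 4) (hp : p ∈ O) :
    pd i (pd i τ.gauge) p = Complex.exp (Complex.I * (τ.θ p : ℂ)) *
      (((pd i (pd i τ.R) p - τ.R p * pd i τ.θ p ^ 2 : ℝ) : ℂ) +
        Complex.I * ((2 * pd i τ.R p * pd i τ.θ p + τ.R p * pd i (pd i τ.θ) p : ℝ) : ℂ)) := by
  have hR := pd_smoothOn hO h.smooth_R i
  have hθ := pd_smoothOn hO h.smooth_θ i
  have hm : ContDiffOn ℝ ∞ (fun q => τ.R q * pd i τ.θ q) O := h.smooth_R.mul hθ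
  have s1 := ofReal_smoothOn hR
  have s2 : ContDiffOn ℝ ∞ (fun q => Complex.I * ((τ.R q * pd i τ.θ q : ℝ) : ℂ)) O :=
    contDiffOn_const.mul (ofReal_smoothOn hm)
  rw [pd_congr hO (fun q hq => pd_gauge hO h i hq) i p hp,
    pd_mul hO (exp_smoothOn h) (s1.add s2) i hp, pd_exp hO h i hp, pd_add hO s1 s2 i hp,
    pd_ofReal hO hR i hp, pd_const_mul hO _ (ofReal_smoothOn hm) i hp, pd_ofReal hO hm i hp,
    pd_mul hO h.smooth_R hθ i hp]
  push_cast
  linear_combination Complex.exp (Complex.I * (τ.θ p : ℂ)) *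
    ((τ.R p : ℝ) : ℂ) * ((pd i τ.θ p : ℝ) : ℂ) ^ 2 * Complex.I_sq

theorem norm_gauge (q : Base) : ‖τ.gauge q‖ ^ 2 = τ.R q ^ 2 := by
  rw [gauge, norm_mul, mul_comm Complex.I, Complex.norm_exp_ofReal_mul_I, mul_one,
    Complex.norm_real, Real.norm_eq_abs, sq_abs]

theorem norm_psi (Ψ : Base → ℂ) :
    (fun q => ‖τ.psi Ψ q‖ ^ 2) = fun q => τ.R q ^ 2 * ‖Ψ (τ.newVars q)‖ ^ 2 := by
  funext q
  rw [← norm_gauge, ← mul_pow, ← norm_mul]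
  rfl

/-- `∂_i² (G · Φ ∘ N)` in terms of the derivatives of `G` (`g₀`, `g₁`, `g₂`), of the components of
`N` (`n`, `h`) and of the jet `(α, β, κ)` of `Φ`. -/
def secondOrder {𝔸 : Type*} [NormedCommRing 𝔸] [NormedAlgebra ℝ 𝔸] (g₀ g₁ g₂ : 𝔸)
    (n h : Fin 4 → ℝ) (α : 𝔸) (β : Fin 4 → 𝔸) (κ : Fin 4 → Fin 4 → 𝔸) : 𝔸 :=
  g₂ * α + 2 * g₁ * ∑ l, n l • β l + g₀ * ∑ l, (h l • β l + n l • ∑ m, n m • κ l m)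

/-- The equations for `(ψ, w)` at a point in terms of the jets `(α, β, κ)` and `(c, μ, ν)` of
`Ψ` and `W` at the image point. -/
def JetEquations (τ : Transformation) (a₁ a₂ a₃ b₁ b₂ : ℝ) (p : Base) (α : ℂ) (β : Fin 4 → ℂ)
    (κ : Fin 4 → Fin 4 → ℂ) (c : ℝ) (μ : Fin 4 → ℝ) (ν : Fin 4 → Fin 4 → ℝ) : Prop :=
  let n := fun i l => pd i (fun q => τ.newVars q l) p
  let h := fun i l => pd i (pd i fun q => τ.newVars q l) p
  let e := fun i => secondOrder (τ.gauge p) (pd i τ.gauge p) (pd i (pd i τ.gauge) p) (n i) (h i)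
    α β κ
  let f := fun i => secondOrder (τ.P p) (pd i τ.P p) (pd i (pd i τ.P) p) (n i) (h i) c μ ν
    + pd i (pd i τ.S) p
  let k := fun i => secondOrder (τ.R p ^ 2) (pd i (fun q => τ.R q ^ 2) p)
    (pd i (pd i fun q => τ.R q ^ 2) p) (n i) (h i) (‖α‖ ^ 2) (fun l => 2 * inner ℝ α (β l))
    (fun l m => 2 * (inner ℝ (β m) (β l) + inner ℝ α (κ l m)))
  Complex.I * (pd 0 τ.gauge p * α + τ.gauge p * ∑ l, n 0 l • β l) + e 1 + (a₁ : ℂ) * e 2 + e 3 =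
      (a₂ : ℂ) * ((τ.R p ^ 2 * ‖α‖ ^ 2 : ℝ) : ℂ) * (τ.gauge p * α)
        + τ.gauge p * α * ((τ.P p * c + τ.S p : ℝ) : ℂ) + Complex.I * (a₃ : ℂ) * (τ.gauge p * α) ∧
    f 1 + b₁ * f 2 + f 3 = b₂ * (k 1 + k 3)

/-- The chain rule turns the system for `(ψ, w)` at a point into conditions on the jets of
`(Ψ, W)` at the image point. -/
theorem satisfiesMDS_iff (hO : IsOpen O) (h : τ.IsRegularOn O) (hp : p ∈ O) {a₁ a₂ a₃ b₁ b₂ : ℝ}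
    {Ψ : Base → ℂ} {W : Base → ℝ} (hΨ : ContDiff ℝ ∞ Ψ) (hW : ContDiff ℝ ∞ W) :
    SatisfiesMDS a₁ a₂ a₃ b₁ b₂ (τ.psi Ψ) (τ.w W) p ↔
      τ.JetEquations a₁ a₂ a₃ b₁ b₂ p (Ψ (τ.newVars p)) (fun l => pd l Ψ (τ.newVars p))
        (fun l m => pd m (pd l Ψ) (τ.newVars p)) (W (τ.newVars p))
        (fun l => pd l W (τ.newVars p)) (fun l m => pd m (pd l W) (τ.newVars p)) := by
  have hN := h.newVars_smooth
  have hG := gauge_smoothOn h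
  have hc := smoothOn_comp hN hW
  have e0 : ∀ i, pd i (τ.psi Ψ) p = _ := fun i => pd_mul_comp hO hN hG hΨ i hp
  have e1 : ∀ i, pd i (pd i (τ.psi Ψ)) p = _ := fun i => pd_pd_mul_comp hO hN hG hΨ i hp
  have hPW : ContDiffOn ℝ ∞ (fun q => τ.P q * W (τ.newVars q)) O := h.smooth_P.mul hc
  have e2 : ∀ i, pd i (pd i (τ.w W)) p = pd i (pd i fun q => τ.P q * W (τ.newVars q)) p +
      pd i (pd i τ.S) p := fun i => by
    have : ∀ q ∈ O, pd i (τ.w W) q = pd i (fun q => τ.P q * W (τ.newVars q)) q + pd i τ.S q :=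
      fun q hq => pd_add hO hPW h.smooth_S i hq
    rw [pd_congr hO this i p hp,
      pd_add hO (pd_smoothOn hO hPW i) (pd_smoothOn hO h.smooth_S i) i hp]
  have e3 := fun i => pd_pd_mul_comp hO hN (h.smooth_R.pow 2) (smoothOn_norm_sq hΨ) i hp
  have e4 : ‖τ.psi Ψ p‖ ^ 2 = τ.R p ^ 2 * ‖Ψ (τ.newVars p)‖ ^ 2 := congrFun (norm_psi Ψ) p
  simp only [pd_norm_sq hΨ, pd_pd_norm_sq hΨ] at e3
  unfold SatisfiesMDS
  rw [norm_psi, e0, e1, e1, e1, e2, e2, e2, e3, e3, e4, pd_pd_mul_comp hO hN h.smooth_P hW 1 hp,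
    pd_pd_mul_comp hO hN h.smooth_P hW 2 hp, pd_pd_mul_comp hO hN h.smooth_P hW 3 hp]
  rfl

/-- The condition on the transformation at the level of jets: all symmetric jets occur. -/
theorem jetEquations_iff (hO : IsOpen O) (h : τ.IsRegularOn O) (hp : p ∈ O) {a₁ a₂ a₃ b₁ b₂ : ℝ}
    (hτ : ∀ (Ψ : Base → ℂ) (W : Base → ℝ), ContDiff ℝ ∞ Ψ → ContDiff ℝ ∞ W → ∀ p ∈ O,
      (SatisfiesMDS a₁ a₂ a₃ b₁ b₂ (τ.psi Ψ) (τ.w W) p ↔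
        SatisfiesMDS a₁ a₂ 0 b₁ b₂ Ψ W (τ.newVars p)))
    (α : ℂ) (β : Fin 4 → ℂ) {κ : Fin 4 → Fin 4 → ℂ} (hκ : ∀ l m, κ l m = κ m l) (c : ℝ)
    (μ : Fin 4 → ℝ) {ν : Fin 4 → Fin 4 → ℝ} (hν : ∀ l m, ν l m = ν m l) :
    τ.JetEquations a₁ a₂ a₃ b₁ b₂ p α β κ c μ ν ↔
      (Complex.I * β 0 + κ 1 1 + (a₁ : ℂ) * κ 2 2 + κ 3 3 =
          (a₂ : ℂ) * ((‖α‖ ^ 2 : ℝ) : ℂ) * α + α * (c : ℂ) ∧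
        ν 1 1 + b₁ * ν 2 2 + ν 3 3 =
          b₂ * (2 * (inner ℝ (β 1) (β 1) + inner ℝ α (κ 1 1)) +
            2 * (inner ℝ (β 3) (β 3) + inner ℝ α (κ 3 3)))) := by
  set q₀ := τ.newVars p with hq₀
  have sΨ := quad_smooth q₀ α β κ
  have sW := quad_smooth q₀ c μ ν
  have h0 : quad q₀ α β κ q₀ = α := by simp [quad]
  have h0' : quad q₀ c μ ν q₀ = c := by simp [quad]
  have h1 : ∀ i, pd i (quad q₀ α β κ) q₀ = β i := fun i => by rw [pd_quad _ _ _ hκ]; simp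
  have h1' : ∀ i, pd i (quad q₀ c μ ν) q₀ = μ i := fun i => by rw [pd_quad _ _ _ hν]; simp
  have key := hτ _ _ sΨ sW p hp
  rw [satisfiesMDS_iff hO h hp sΨ sW, ← hq₀] at key
  unfold SatisfiesMDS at key
  simp only [pd_pd_norm_sq sΨ, h0, h0', h1, h1', pd_pd_quad _ _ _ hκ, pd_pd_quad _ _ _ hν,
    Complex.ofReal_zero, mul_zero, zero_mul, add_zero] at key
  exact key

end Transformation

/-! ### The transformation that removes `a₃` -/

section Removing

theorem pd_time {f : ℝ → ℝ} {p : Base} (hf : DifferentiableAt ℝ f (p 0)) (i : Fin 4) :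
    pd i (fun q : Base => f (q 0)) p = if i = 0 then deriv f (p 0) else 0 := by
  have h2 : HasFDerivAt (fun q : Base => q 0) (ContinuousLinearMap.proj (R := ℝ)
      (φ := fun _ : Fin 4 => ℝ) 0) p :=
    (ContinuousLinearMap.proj (R := ℝ) (φ := fun _ : Fin 4 => ℝ) 0).hasFDerivAt
  have h3 : HasFDerivAt (fun q : Base => f (q 0)) _ p := hf.hasDerivAt.comp_hasFDerivAt p h2
  rw [pd, h3.fderiv]
  simp [Pi.single_apply, eq_comm]

theorem pd_exp_time (c : ℝ) (i : Fin 4) (p : Base) :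
    pd i (fun q : Base => Real.exp (c * q 0)) p = if i = 0 then c * Real.exp (c * p 0) else 0 := by
  have h : HasDerivAt (fun t => Real.exp (c * t)) (c * Real.exp (c * p 0)) (p 0) :=
    (((hasDerivAt_id (p 0)).const_mul c).exp).congr_deriv (by simp; ring)
  rw [pd_time h.differentiableAt, h.deriv]

/-- The diagonal coefficients of the quadratic form `r (x² + y²/a₁ + z²)`, doubled. -/
def diagForm (a₁ r : ℝ) (l m : Fin 4) : ℝ := if l = m then 2 * r * ![0, 1, 1 / a₁, 1] l else 0

theorem diagForm_symm (a₁ r : ℝ) (l m : Fin 4) : diagForm a₁ r l m = diagForm a₁ r m l := by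
  unfold diagForm
  by_cases h : l = m
  · subst h; rfl
  · rw [if_neg h, if_neg fun e => h e.symm]

/-- With `q = x² + y²/a₁ + z²`: `T = -e^{-4 a₃ t} / (4 a₃)`, `(X, Y, Z) = e^{-2 a₃ t} (x, y, z)`,
`R = e^{-2 a₃ t}`, `θ = a₃ q / 2`, `P = e^{-4 a₃ t}`, `S = -a₃² q`. -/
def removing (a₁ a₃ : ℝ) : Transformation where
  X := fun p => Real.exp (-2 * a₃ * p 0) * p 1
  Y := fun p => Real.exp (-2 * a₃ * p 0) * p 2
  Z := fun p => Real.exp (-2 * a₃ * p 0) * p 3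
  T := fun t => -1 / (4 * a₃) * Real.exp (-4 * a₃ * t)
  R := fun p => Real.exp (-2 * a₃ * p 0)
  θ := quad 0 0 0 (diagForm a₁ (a₃ / 2))
  P := fun p => Real.exp (-4 * a₃ * p 0)
  S := quad 0 0 0 (diagForm a₁ (-a₃ ^ 2))

variable {a₁ a₃ : ℝ}

theorem deriv_removing_T (ha₃ : a₃ ≠ 0) (t : ℝ) :
    deriv (removing a₁ a₃).T t = Real.exp (-4 * a₃ * t) := by
  have h := deriv_exp_mul (-4 * a₃) (-1 / (4 * a₃))
  refine (congrFun h t).trans ?_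
  field_simp

theorem removing_newVars_of_ne {l : Fin 4} (hl : l ≠ 0) (p : Base) :
    (removing a₁ a₃).newVars p l = Real.exp (-2 * a₃ * p 0) * p l := by
  fin_cases l
  · exact absurd rfl hl
  all_goals rfl

theorem removing_smooth (l : Fin 4) :
    ContDiffOn ℝ ∞ (fun q => (removing a₁ a₃).newVars q l) Set.univ := by
  fin_cases l <;> simp [Transformation.newVars, removing] <;> fun_prop

theorem pd_removing_zero (ha₃ : a₃ ≠ 0) (i : Fin 4) (p : Base) :
    pd i (fun q => (removing a₁ a₃).newVars q 0) p =
      if i = 0 then Real.exp (-4 * a₃ * p 0) else 0 := by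
  have h : DifferentiableAt ℝ (removing a₁ a₃).T (p 0) := by
    simp only [removing]; fun_prop
  rw [← deriv_removing_T (a₁ := a₁) ha₃]
  exact pd_time h i

theorem pd_removing_of_ne {l : Fin 4} (hl : l ≠ 0) (i : Fin 4) (p : Base) :
    pd i (fun q => (removing a₁ a₃).newVars q l) p =
      (if i = 0 then -2 * a₃ * (removing a₁ a₃).newVars p l else 0) +
        if l = i then Real.exp (-2 * a₃ * p 0) else 0 := by
  have e : (fun q => (removing a₁ a₃).newVars q l) = fun q => Real.exp (-2 * a₃ * q 0) * q l :=
    funext (removing_newVars_of_ne hl)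
  rw [e, pd_mul isOpen_univ (by fun_prop) (by fun_prop) i (Set.mem_univ p), pd_exp_time, pd_coord,
    removing_newVars_of_ne hl]
  split_ifs <;> ring

theorem pd_pd_removing (ha₃ : a₃ ≠ 0) (l : Fin 4) {i : Fin 4} (hi : i ≠ 0) (p : Base) :
    pd i (pd i fun q => (removing a₁ a₃).newVars q l) p = 0 := by
  by_cases hl : l = 0
  · subst hl
    have e : (pd i fun q => (removing a₁ a₃).newVars q 0) = fun _ => 0 := funext fun q => by
      rw [pd_removing_zero ha₃, if_neg hi]
    rw [e, pd_const]
  · by_cases h : l = i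
    · have e : (pd i fun q => (removing a₁ a₃).newVars q l) =
          fun q => Real.exp (-2 * a₃ * q 0) := funext fun q => by
        rw [pd_removing_of_ne hl, if_neg hi, if_pos h, zero_add]
      rw [e, pd_exp_time, if_neg hi]
    · have e : (pd i fun q => (removing a₁ a₃).newVars q l) = fun _ => 0 := funext fun q => by
        rw [pd_removing_of_ne hl, if_neg hi, if_neg h, zero_add]
      rw [e, pd_const]

theorem removing_isRegularOn (ha₃ : a₃ ≠ 0) : (removing a₁ a₃).IsRegularOn Set.univ where
  smooth_X := removing_smooth 1
  smooth_Y := removing_smooth 2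
  smooth_Z := removing_smooth 3
  smooth_T := by simp only [removing]; fun_prop
  smooth_R := by simp only [removing]; fun_prop
  smooth_θ := (quad_smooth _ _ _ _).contDiffOn
  smooth_P := by simp only [removing]; fun_prop
  smooth_S := (quad_smooth _ _ _ _).contDiffOn
  time_direction := fun p _ => by rw [deriv_removing_T ha₃]; exact Real.exp_pos _
  R_ne_zero := fun p _ => (Real.exp_pos _).ne'
  P_ne_zero := fun p _ => (Real.exp_pos _).ne'
  injOn := fun p _ q _ h => by
    have h0 : p 0 = q 0 := by
      have := congrFun h 0
      simpa [Transformation.newVars, removing, ha₃] using this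
    funext l
    by_cases hl : l = 0
    · rw [hl, h0]
    · have := congrFun h l
      rw [removing_newVars_of_ne hl, removing_newVars_of_ne hl, h0] at this
      exact mul_left_cancel₀ (Real.exp_pos _).ne' this
  bijective_fderiv := fun p _ => by
    have hv : ∀ (v : Base) (l : Fin 4), fderiv ℝ (removing a₁ a₃).newVars p v l =
        ∑ i, v i * pd i (fun q => (removing a₁ a₃).newVars q l) p := fun v l => by
      conv_lhs => rw [pi_eq_sum_univ' v, map_sum]
      simp only [map_smul, Finset.sum_apply, Pi.smul_apply, smul_eq_mul,
        pd_apply isOpen_univ removing_smooth _ _ (Set.mem_univ p)]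
    have hinj : Function.Injective (fderiv ℝ (removing a₁ a₃).newVars p) := by
      refine (injective_iff_map_eq_zero _).2 fun v h => ?_
      have h0 : v 0 = 0 := by
        have := (hv v 0).symm.trans (congrFun h 0)
        simpa [Fin.sum_univ_four, pd_removing_zero ha₃] using this
      funext l
      by_cases hl : l = 0
      · rw [hl, h0]; rfl
      · have := (hv v l).symm.trans (congrFun h l)
        simp only [pd_removing_of_ne hl, mul_add, Finset.sum_add_distrib, mul_ite, mul_zero,
          Finset.sum_ite_eq', Finset.sum_ite_eq, Finset.mem_univ, if_true, h0, zero_mul,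
          zero_add, Pi.zero_apply] at this
        exact (mul_eq_zero.1 this).resolve_right (Real.exp_pos _).ne'
    exact ⟨hinj, (LinearMap.injective_iff_surjective
      (f := (fderiv ℝ (removing a₁ a₃).newVars p : Base →ₗ[ℝ] Base))).1 hinj⟩

theorem eq_iff_eq_of_sub_eq_mul {K : Type*} [Field K] {x y x' y' k : K} (hk : k ≠ 0)
    (h : x - y = k * (x' - y')) : x = y ↔ x' = y' := by
  rw [← sub_eq_zero, h, mul_eq_zero, or_iff_right hk, sub_eq_zero]

/-- The transformation `removing` multiplies the Schrödinger equation by `G R²`, where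
`G = R e^{iθ}`, and the equation for `w` by `R⁴`.  The condition `b₁ = -2 a₁` makes the contribution
of `S` to the latter vanish. -/
theorem removableOn_univ {a₂ b₂ : ℝ} (ha₁ : a₁ ≠ 0) (ha₃ : a₃ ≠ 0) :
    RemovableOn a₁ a₂ a₃ (-2 * a₁) b₂ Set.univ := by
  have hreg := removing_isRegularOn (a₁ := a₁) ha₃
  refine ⟨removing a₁ a₃, hreg, fun Ψ W hΨ hW p hp => ?_⟩
  rw [Transformation.satisfiesMDS_iff isOpen_univ hreg hp hΨ hW]
  unfold SatisfiesMDS Transformation.JetEquations Transformation.secondOrder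
  set r := Real.exp (-2 * a₃ * p 0) with hr
  have hr0 : r ≠ 0 := (Real.exp_pos _).ne'
  have hr2 : Real.exp (-4 * a₃ * p 0) = r ^ 2 := by
    rw [hr, ← Real.exp_nat_mul]; push_cast; ring_nf
  have n00 : ∀ i, pd i (fun q => (removing a₁ a₃).newVars q 0) p = if i = 0 then r ^ 2 else 0 :=
    fun i => by rw [pd_removing_zero ha₃, hr2]
  have nl : ∀ {l : Fin 4}, l ≠ 0 → ∀ i, pd i (fun q => (removing a₁ a₃).newVars q l) p =
      (if i = 0 then -2 * a₃ * (r * p l) else 0) + if l = i then r else 0 := fun hl i => by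
    rw [pd_removing_of_ne hl, removing_newVars_of_ne hl]
  have n1 := nl (l := 1) (by decide)
  have n2 := nl (l := 2) (by decide)
  have n3 := nl (l := 3) (by decide)
  have hh := fun (l : Fin 4) {i : Fin 4} (hi : i ≠ 0) => pd_pd_removing (a₁ := a₁) ha₃ l hi p
  have hRp : (removing a₁ a₃).R p = r := rfl
  have hR : ∀ i, pd i (removing a₁ a₃).R = fun q : Base =>
      if i = 0 then -2 * a₃ * Real.exp (-2 * a₃ * q 0) else 0 := fun i =>
    funext fun q => pd_exp_time _ i q
  have hR0 : pd 0 (removing a₁ a₃).R p = -2 * a₃ * r := by simp only [hR, hr, if_true]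
  have hR1 : ∀ {i : Fin 4}, i ≠ 0 → pd i (removing a₁ a₃).R p = 0 := fun hi => by
    rw [hR]; simp [hi]
  have hR' : ∀ {i : Fin 4}, i ≠ 0 → pd i (pd i (removing a₁ a₃).R) p = 0 := fun hi => by
    rw [hR]; simp only [if_neg hi]; exact pd_const _ _ _
  have hPp : (removing a₁ a₃).P p = r ^ 2 := hr2
  have hP : ∀ {i : Fin 4}, i ≠ 0 → pd i (removing a₁ a₃).P = fun _ => 0 := fun hi =>
    funext fun q => (pd_exp_time _ _ q).trans (if_neg hi)
  have hR2 : ∀ {i : Fin 4}, i ≠ 0 → (pd i fun q => (removing a₁ a₃).R q ^ 2) = fun _ => 0 :=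
    fun {i} hi => funext fun q => by
      simp only [pow_two]
      rw [pd_mul isOpen_univ hreg.smooth_R hreg.smooth_R i (Set.mem_univ q), hR]
      simp [hi]
  have hθ : ∀ i, pd i (removing a₁ a₃).θ p = a₃ * ![0, 1, 1 / a₁, 1] i * p i := fun i => by
    refine (congrFun (pd_quad _ _ _ (diagForm_symm a₁ (a₃ / 2)) i) p).trans ?_
    simp [diagForm]
    ring
  have hθ' : ∀ i, pd i (pd i (removing a₁ a₃).θ) p = a₃ * ![0, 1, 1 / a₁, 1] i := fun i => by
    refine (pd_pd_quad _ _ _ (diagForm_symm a₁ (a₃ / 2)) i i p).trans ?_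
    rw [diagForm, if_pos rfl]
    ring
  have hS : (removing a₁ a₃).S p = -a₃ ^ 2 * (p 1 ^ 2 + p 2 ^ 2 / a₁ + p 3 ^ 2) := by
    simp [removing, quad, diagForm, Fin.sum_univ_four]
    ring
  have hS' : ∀ i, pd i (pd i (removing a₁ a₃).S) p = -2 * a₃ ^ 2 * ![0, 1, 1 / a₁, 1] i :=
    fun i => by
      refine (pd_pd_quad _ _ _ (diagForm_symm a₁ (-a₃ ^ 2)) i i p).trans ?_
      rw [diagForm, if_pos rfl]
      ring
  have hg0 : pd 0 (removing a₁ a₃).gauge p = -2 * a₃ * (removing a₁ a₃).gauge p := by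
    rw [Transformation.pd_gauge isOpen_univ hreg 0 hp, hθ, Transformation.gauge, hR0, hRp]
    simp
    ring
  have hg1 : ∀ {i : Fin 4}, i ≠ 0 → pd i (removing a₁ a₃).gauge p =
      Complex.I * ((pd i (removing a₁ a₃).θ p : ℝ) : ℂ) * (removing a₁ a₃).gauge p := fun hi => by
    rw [Transformation.pd_gauge isOpen_univ hreg _ hp, Transformation.gauge, hR1 hi, hRp]
    simp
    ring
  have hg2 : ∀ {i : Fin 4}, i ≠ 0 → pd i (pd i (removing a₁ a₃).gauge) p =
      (Complex.I * ((pd i (pd i (removing a₁ a₃).θ) p : ℝ) : ℂ) -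
        ((pd i (removing a₁ a₃).θ p : ℝ) : ℂ) ^ 2) * (removing a₁ a₃).gauge p := fun hi => by
    rw [Transformation.pd_pd_gauge isOpen_univ hreg _ hp, Transformation.gauge, hR' hi, hR1 hi, hRp]
    simp
    ring
  have hgne := Transformation.gauge_ne_zero hreg hp
  set g := (removing a₁ a₃).gauge p with hg
  have i1 : (1 : Fin 4) ≠ 0 := by decide
  have i2 : (2 : Fin 4) ≠ 0 := by decide
  have i3 : (3 : Fin 4) ≠ 0 := by decide
  simp only [hP i1, hP i2, hP i3, hR2 i1, hR2 i3, hg0, hg1 i1, hg1 i2, hg1 i3, hg2 i1, hg2 i2,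
    hg2 i3, hθ, hθ', hS, hS', hRp, hPp, hh _ i1, hh _ i2, hh _ i3, pd_const, Fin.sum_univ_four,
    n00, n1, n2, n3, pd_pd_norm_sq hΨ]
  simp
  have hc : (a₁ : ℂ) * (a₁ : ℂ)⁻¹ = 1 := mul_inv_cancel₀ (Complex.ofReal_ne_zero.2 ha₁)
  have hc' : a₁ * a₁⁻¹ = 1 := mul_inv_cancel₀ ha₁
  refine and_congr (eq_iff_eq_of_sub_eq_mul (k := g * (r : ℂ) ^ 2)
    (mul_ne_zero hgne (pow_ne_zero 2 (Complex.ofReal_ne_zero.2 hr0))) ?_)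
    (eq_iff_eq_of_sub_eq_mul (k := r ^ 4) (pow_ne_zero 4 hr0) ?_)
  · linear_combination ((Complex.I * a₃ - (a₃ : ℂ) ^ 2 * (p 2 : ℂ) ^ 2 * (a₁ : ℂ)⁻¹) * g *
      Ψ ((removing a₁ a₃).newVars p) + 2 * Complex.I * a₃ * (p 2 : ℂ) * g * r *
      pd 2 Ψ ((removing a₁ a₃).newVars p)) * hc
  · linear_combination 4 * a₃ ^ 2 * hc'

end Removing

/-! ### Necessary conditions on a transformation that removes `a₃` -/

namespace Transformation

/-- The transformation `τ` turns the system with `a₃` over the open set `O` into the system with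
`a₃ = 0`. -/
structure Removes (τ : Transformation) (a₁ a₂ a₃ b₁ b₂ : ℝ) (O : Set Base) : Prop where
  isOpen : IsOpen O
  regular : τ.IsRegularOn O
  iff : ∀ (Ψ : Base → ℂ) (W : Base → ℝ), ContDiff ℝ ∞ Ψ → ContDiff ℝ ∞ W → ∀ p ∈ O,
    (SatisfiesMDS a₁ a₂ a₃ b₁ b₂ (τ.psi Ψ) (τ.w W) p ↔
      SatisfiesMDS a₁ a₂ 0 b₁ b₂ Ψ W (τ.newVars p))

namespace Removes

variable {τ : Transformation} {a₁ a₂ a₃ b₁ b₂ : ℝ} {O : Set Base} {p : Base}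

theorem pd_zero_of_ne (H : τ.Removes a₁ a₂ a₃ b₁ b₂ O) {i : Fin 4} (hi : i ≠ 0) (hp : p ∈ O) :
    pd i (fun q => τ.newVars q 0) p = 0 :=
  H.regular.pd_newVars_zero_of_ne H.isOpen hi hp

theorem pd_pd_zero_of_ne (H : τ.Removes a₁ a₂ a₃ b₁ b₂ O) {i : Fin 4} (hi : i ≠ 0) (hp : p ∈ O) :
    pd i (pd i fun q => τ.newVars q 0) p = 0 := by
  rw [pd_congr H.isOpen (g := fun _ => 0) (fun q hq => H.pd_zero_of_ne hi hq) i p hp, pd_const]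

theorem one_ne : (1 : Fin 4) ≠ 0 := by decide
theorem two_ne : (2 : Fin 4) ≠ 0 := by decide
theorem three_ne : (3 : Fin 4) ≠ 0 := by decide

/-- The condition on the jets of `Ψ = W = 0`.  In the following lemmas `ξ₀, …, ξ₃` are the
coordinates of the image space that vanish at the image point. -/
theorem lap_S (H : τ.Removes a₁ a₂ a₃ b₁ b₂ O) (hp : p ∈ O) :
    pd 1 (pd 1 τ.S) p + b₁ * pd 2 (pd 2 τ.S) p + pd 3 (pd 3 τ.S) p = 0 := by
  have h := (jetEquations_iff H.isOpen H.regular hp H.iff 0 (fun _ => 0) (κ := fun _ _ => 0)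
    (fun _ _ => rfl) 0 (fun _ => 0) (ν := fun _ _ => 0) (fun _ _ => rfl)).2 (by simp)
  have h2 := h.2
  simpa [secondOrder] using h2

/-- The condition on the jets of `W = s` and of `Ψ = r` plus a multiple of `ξ₀`, for real `r, s`. -/
theorem gauge_eq (H : τ.Removes a₁ a₂ a₃ b₁ b₂ O) (hp : p ∈ O) (r s : ℝ) :
    Complex.I * pd 0 τ.gauge p * r +
      τ.gauge p * ((pd 0 (fun q => τ.newVars q 0) p : ℝ) : ℂ) * (a₂ * r ^ 3 + r * s) +
      (pd 1 (pd 1 τ.gauge) p + a₁ * pd 2 (pd 2 τ.gauge) p + pd 3 (pd 3 τ.gauge) p) * r =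
    a₂ * ((τ.R p : ℝ) : ℂ) ^ 2 * r ^ 3 * τ.gauge p +
      τ.gauge p * r * (τ.P p * s + τ.S p) + Complex.I * a₃ * τ.gauge p * r := by
  have h := (jetEquations_iff H.isOpen H.regular hp H.iff (r : ℂ)
    (Pi.single 0 (-Complex.I * (a₂ * r ^ 3 + r * s))) (κ := fun _ _ => 0)
    (fun _ _ => rfl) s (fun _ => 0) (ν := fun _ _ => 0) (fun _ _ => rfl)).2 (by
      constructor
      · simp
        linear_combination (-(a₂ : ℂ) * r ^ 3 - r * s) * Complex.I_sq
      · simp)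
  have h1 := h.1
  simp [secondOrder, Fin.sum_univ_four, H.pd_zero_of_ne one_ne hp, H.pd_zero_of_ne two_ne hp,
    H.pd_zero_of_ne three_ne hp, H.pd_pd_zero_of_ne one_ne hp, H.pd_pd_zero_of_ne two_ne hp,
    H.pd_pd_zero_of_ne three_ne hp] at h1
  linear_combination h1 + τ.gauge p * ((pd 0 (fun q => τ.newVars q 0) p : ℝ) : ℂ) *
    (a₂ * r ^ 3 + r * s) * Complex.I_sq

/-- The condition on the jets of `Ψ = ξ_A`, `W = v ξ_A² / 2`. -/
theorem linear_eq (H : τ.Removes a₁ a₂ a₃ b₁ b₂ O) (hp : p ∈ O) {A : Fin 4} (hA : A ≠ 0) {v : ℝ}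
    (hv : v * (if A = 2 then b₁ else 1) = if A = 2 then 0 else 2 * b₂) :
    (Complex.I * (τ.gauge p * ((pd 0 (fun q => τ.newVars q A) p : ℝ) : ℂ)) +
      (2 * pd 1 τ.gauge p * ((pd 1 (fun q => τ.newVars q A) p : ℝ) : ℂ) +
        τ.gauge p * ((pd 1 (pd 1 fun q => τ.newVars q A) p : ℝ) : ℂ)) +
      a₁ * (2 * pd 2 τ.gauge p * ((pd 2 (fun q => τ.newVars q A) p : ℝ) : ℂ) +
        τ.gauge p * ((pd 2 (pd 2 fun q => τ.newVars q A) p : ℝ) : ℂ)) +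
      (2 * pd 3 τ.gauge p * ((pd 3 (fun q => τ.newVars q A) p : ℝ) : ℂ) +
        τ.gauge p * ((pd 3 (pd 3 fun q => τ.newVars q A) p : ℝ) : ℂ)) = 0) ∧
    τ.P p * v * (pd 1 (fun q => τ.newVars q A) p ^ 2 + b₁ * pd 2 (fun q => τ.newVars q A) p ^ 2 +
      pd 3 (fun q => τ.newVars q A) p ^ 2) =
    2 * b₂ * τ.R p ^ 2 * (pd 1 (fun q => τ.newVars q A) p ^ 2 +
      pd 3 (fun q => τ.newVars q A) p ^ 2) := by
  have hS := H.lap_S hp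
  have h := (jetEquations_iff H.isOpen H.regular hp H.iff 0
    (fun l => if l = A then 1 else 0) (κ := fun _ _ => 0)
    (fun _ _ => rfl) 0 (fun _ => 0) (ν := fun l m => if l = A ∧ m = A then v else 0)
    (fun l m => by simp only [and_comm])).2 (by
      fin_cases A
      · exact absurd rfl hA
      · simpa [mul_comm] using hv
      · simpa [mul_comm] using hv
      · simpa [mul_comm] using hv)
  have e1 := h.1
  have e2 := h.2
  fin_cases A
  · exact absurd rfl hA
  all_goals
    simp [secondOrder, Fin.sum_univ_four] at e1 e2 ⊢
    refine ⟨by linear_combination e1, by linear_combination e2 - hS⟩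

/-- The condition on the jets of `W = 0` and of a real quadratic form `Ψ` with Hessian `κ`, plus the
multiple of `ξ₀` that makes it a solution at the image point: the second-order operator of the
Schrödinger equation is preserved up to the factor `T'`. -/
theorem quadratic_eq (H : τ.Removes a₁ a₂ a₃ b₁ b₂ O) (hp : p ∈ O) {κ : Fin 4 → Fin 4 → ℝ}
    (hκ : ∀ l m, κ l m = κ m l) :
    pd 0 (fun q => τ.newVars q 0) p * (κ 1 1 + a₁ * κ 2 2 + κ 3 3) =
      (∑ l, ∑ m, pd 1 (fun q => τ.newVars q l) p * pd 1 (fun q => τ.newVars q m) p * κ l m) +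
      a₁ * (∑ l, ∑ m, pd 2 (fun q => τ.newVars q l) p * pd 2 (fun q => τ.newVars q m) p * κ l m) +
      ∑ l, ∑ m, pd 3 (fun q => τ.newVars q l) p * pd 3 (fun q => τ.newVars q m) p * κ l m := by
  have h := (jetEquations_iff H.isOpen H.regular hp H.iff 0
    (Pi.single 0 (Complex.I * (κ 1 1 + a₁ * κ 2 2 + κ 3 3))) (κ := fun l m => (κ l m : ℂ))
    (fun l m => by rw [hκ]) 0 (fun _ => 0) (ν := fun _ _ => 0)
    (fun _ _ => rfl)).2 (by
      constructor
      · simp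
        linear_combination ((κ 1 1 : ℂ) + a₁ * κ 2 2 + κ 3 3) * Complex.I_sq
      · simp)
  have e1 := h.1
  have hg := gauge_ne_zero H.regular hp
  simp [secondOrder, H.pd_zero_of_ne one_ne hp, H.pd_zero_of_ne two_ne hp,
    H.pd_zero_of_ne three_ne hp, Pi.single_apply] at e1
  simp only [Finset.sum_add_distrib, Finset.sum_ite_eq', Finset.mem_univ, if_true,
    H.pd_pd_zero_of_ne one_ne hp, H.pd_pd_zero_of_ne two_ne hp, H.pd_pd_zero_of_ne three_ne hp,
    Complex.ofReal_zero, zero_mul, zero_add] at e1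
  refine Complex.ofReal_injective (mul_left_cancel₀ hg ?_)
  push_cast
  simp only [Fin.sum_univ_four] at e1 ⊢
  linear_combination -e1 + τ.gauge p * ((pd 0 (fun q => τ.newVars q 0) p : ℝ) : ℂ) *
    ((κ 1 1 : ℂ) + a₁ * κ 2 2 + κ 3 3) * Complex.I_sq

theorem time_pos (H : τ.Removes a₁ a₂ a₃ b₁ b₂ O) (hp : p ∈ O) :
    0 < pd 0 (fun q => τ.newVars q 0) p := by
  rw [H.regular.pd_newVars_zero H.isOpen 0 hp, if_pos rfl]
  exact H.regular.time_direction p hp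

/-- Comparison of the powers of `r` and `s` in `gauge_eq`; the cubic term needs `a₂ ≠ 0`. -/
theorem gauge_consequences (H : τ.Removes a₁ a₂ a₃ b₁ b₂ O) (ha₂ : a₂ ≠ 0) (hp : p ∈ O) :
    τ.R p ^ 2 = pd 0 (fun q => τ.newVars q 0) p ∧ τ.P p = pd 0 (fun q => τ.newVars q 0) p ∧
      Complex.I * pd 0 τ.gauge p +
        (pd 1 (pd 1 τ.gauge) p + a₁ * pd 2 (pd 2 τ.gauge) p + pd 3 (pd 3 τ.gauge) p) =
        (τ.S p + Complex.I * a₃) * τ.gauge p := by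
  have hg := gauge_ne_zero H.regular hp
  have e1 := H.gauge_eq hp 1 0
  have e2 := H.gauge_eq hp 2 0
  have e3 := H.gauge_eq hp 1 1
  push_cast at e1 e2 e3
  have ha : (a₂ : ℂ) ≠ 0 := Complex.ofReal_ne_zero.2 ha₂
  have hR : ((τ.R p : ℝ) : ℂ) ^ 2 = ((pd 0 (fun q => τ.newVars q 0) p : ℝ) : ℂ) := by
    refine mul_left_cancel₀ hg (mul_left_cancel₀ ha ?_)
    linear_combination (1 / 3 : ℂ) * e1 - (1 / 6 : ℂ) * e2
  have hP : ((τ.P p : ℝ) : ℂ) = ((pd 0 (fun q => τ.newVars q 0) p : ℝ) : ℂ) := by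
    refine mul_left_cancel₀ hg ?_
    linear_combination e1 - e3
  refine ⟨by exact_mod_cast hR, by exact_mod_cast hP, ?_⟩
  linear_combination e1 + a₂ * τ.gauge p * hR

theorem pd_R (H : τ.Removes a₁ a₂ a₃ b₁ b₂ O) (ha₂ : a₂ ≠ 0) {i : Fin 4} (hi : i ≠ 0) (hp : p ∈ O) :
    pd i τ.R p = 0 := by
  have hR := H.regular.smooth_R
  have hN := H.regular.newVars_smooth 0
  have e := pd_congr H.isOpen (fun q hq => (H.gauge_consequences ha₂ hq).1) i p hp
  simp only [pow_two] at e
  rw [pd_mul H.isOpen hR hR i hp, pd_comm H.isOpen hN i 0 p hp,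
    pd_congr H.isOpen (g := fun _ => 0) (fun q hq => H.pd_zero_of_ne hi hq) 0 p hp, pd_const] at e
  have h0 := H.regular.R_ne_zero p hp
  have : τ.R p * pd i τ.R p = 0 := by linear_combination e / 2
  exact (mul_eq_zero.1 this).resolve_left h0

theorem pd_gauge_of_ne (H : τ.Removes a₁ a₂ a₃ b₁ b₂ O) (ha₂ : a₂ ≠ 0) {i : Fin 4} (hi : i ≠ 0)
    (hp : p ∈ O) : pd i τ.gauge p = τ.gauge p * (Complex.I * ((pd i τ.θ p : ℝ) : ℂ)) := by
  rw [pd_gauge H.isOpen H.regular i hp, H.pd_R ha₂ hi hp, gauge]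
  push_cast
  ring

/-- The imaginary and the real part of the condition on constants: the amplitude `R` obeys the
continuity equation with source term `a₃ R`, and `S` is minus the Hamilton--Jacobi expression of `θ`. -/
theorem phase_equations (H : τ.Removes a₁ a₂ a₃ b₁ b₂ O) (ha₂ : a₂ ≠ 0) (hp : p ∈ O) :
    pd 0 τ.R p + τ.R p * (pd 1 (pd 1 τ.θ) p + a₁ * pd 2 (pd 2 τ.θ) p + pd 3 (pd 3 τ.θ) p) =
      a₃ * τ.R p ∧
    τ.S p = -(pd 0 τ.θ p + pd 1 τ.θ p ^ 2 + a₁ * pd 2 τ.θ p ^ 2 + pd 3 τ.θ p ^ 2) := by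
  have e := (H.gauge_consequences ha₂ hp).2.2
  have hR := H.regular.R_ne_zero p hp
  have hRR : ∀ {i : Fin 4}, i ≠ 0 → pd i (pd i τ.R) p = 0 := fun {i} hi => by
    rw [pd_congr H.isOpen (g := fun _ => 0) (fun q hq => H.pd_R ha₂ hi hq) i p hp, pd_const]
  rw [pd_pd_gauge H.isOpen H.regular 1 hp, pd_pd_gauge H.isOpen H.regular 2 hp,
    pd_pd_gauge H.isOpen H.regular 3 hp, pd_gauge H.isOpen H.regular 0 hp, gauge,
    H.pd_R ha₂ one_ne hp, H.pd_R ha₂ two_ne hp, H.pd_R ha₂ three_ne hp,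
    hRR one_ne, hRR two_ne, hRR three_ne] at e
  have e' : ((-(τ.R p * pd 0 τ.θ p + τ.R p * (pd 1 τ.θ p ^ 2 + a₁ * pd 2 τ.θ p ^ 2 +
      pd 3 τ.θ p ^ 2)) - τ.S p * τ.R p : ℝ) : ℂ) + ((pd 0 τ.R p + τ.R p * (pd 1 (pd 1 τ.θ) p +
      a₁ * pd 2 (pd 2 τ.θ) p + pd 3 (pd 3 τ.θ) p) - a₃ * τ.R p : ℝ) : ℂ) * Complex.I = 0 := by
    refine mul_left_cancel₀ (Complex.exp_ne_zero (Complex.I * (τ.θ p : ℂ))) ?_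
    push_cast at e ⊢
    linear_combination e - Complex.exp (Complex.I * (τ.θ p : ℂ)) * ((τ.R p : ℝ) : ℂ) *
      ((pd 0 τ.θ p : ℝ) : ℂ) * Complex.I_sq
  have h1 := congrArg Complex.re e'
  have h2 := congrArg Complex.im e'
  simp only [Complex.add_re, Complex.add_im, Complex.ofReal_re, Complex.ofReal_im,
    Complex.re_ofReal_mul, Complex.im_ofReal_mul, Complex.I_re, Complex.I_im, Complex.zero_re,
    Complex.zero_im, mul_zero, mul_one, add_zero, zero_add] at h1 h2
  refine ⟨by linarith, mul_left_cancel₀ hR ?_⟩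
  linear_combination -h1

/-- The new variables are transported along the gradient of the phase, and the second-order operator
of the Schrödinger equation annihilates them. -/
theorem component_equations (H : τ.Removes a₁ a₂ a₃ b₁ b₂ O) (ha₂ : a₂ ≠ 0)
    (hp : p ∈ O) {A : Fin 4} (hA : A ≠ 0) :
    pd 0 (fun q => τ.newVars q A) p + 2 * (pd 1 τ.θ p * pd 1 (fun q => τ.newVars q A) p +
      a₁ * (pd 2 τ.θ p * pd 2 (fun q => τ.newVars q A) p) +
      pd 3 τ.θ p * pd 3 (fun q => τ.newVars q A) p) = 0 ∧
    pd 1 (pd 1 fun q => τ.newVars q A) p + a₁ * pd 2 (pd 2 fun q => τ.newVars q A) p +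
      pd 3 (pd 3 fun q => τ.newVars q A) p = 0 := by
  have e := (H.linear_eq hp hA (v := if A = 2 then 0 else 2 * b₂) (by split_ifs <;> simp)).1
  have hg := gauge_ne_zero H.regular hp
  rw [H.pd_gauge_of_ne ha₂ one_ne hp, H.pd_gauge_of_ne ha₂ two_ne hp,
    H.pd_gauge_of_ne ha₂ three_ne hp] at e
  have e' : ((pd 1 (pd 1 fun q => τ.newVars q A) p + a₁ * pd 2 (pd 2 fun q => τ.newVars q A) p +
      pd 3 (pd 3 fun q => τ.newVars q A) p : ℝ) : ℂ) + ((pd 0 (fun q => τ.newVars q A) p +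
      2 * (pd 1 τ.θ p * pd 1 (fun q => τ.newVars q A) p +
      a₁ * (pd 2 τ.θ p * pd 2 (fun q => τ.newVars q A) p) +
      pd 3 τ.θ p * pd 3 (fun q => τ.newVars q A) p) : ℝ) : ℂ) * Complex.I = 0 := by
    refine mul_left_cancel₀ hg ?_
    push_cast
    linear_combination e
  have h1 := congrArg Complex.re e'
  have h2 := congrArg Complex.im e'
  simp only [Complex.add_re, Complex.add_im, Complex.ofReal_re, Complex.ofReal_im,
    Complex.re_ofReal_mul, Complex.im_ofReal_mul, Complex.I_re, Complex.I_im, Complex.zero_re,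
    Complex.zero_im, mul_zero, mul_one, add_zero, zero_add] at h1 h2
  exact ⟨h2, h1⟩

/-- The variables `X` and `Z` do not depend on `y`, by the equation for `w` with
`W = b₂ ξ_A²`, since `P = R²`. -/
theorem pd_two_X (H : τ.Removes a₁ a₂ a₃ b₁ b₂ O) (ha₂ : a₂ ≠ 0) (hb₁ : b₁ ≠ 0) (hb₂ : b₂ ≠ 0)
    (hp : p ∈ O) {A : Fin 4} (hA : A ≠ 0) (hA2 : A ≠ 2) :
    pd 2 (fun q => τ.newVars q A) p = 0 := by
  have e := (H.linear_eq hp hA (v := 2 * b₂) (by simp [hA2])).2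
  obtain ⟨h1, h2, -⟩ := H.gauge_consequences ha₂ hp
  have h0 := H.time_pos hp
  rw [h1, h2] at e
  have : pd 0 (fun q => τ.newVars q 0) p * (b₂ * (b₁ * pd 2 (fun q => τ.newVars q A) p ^ 2)) = 0 := by
    linear_combination e / 2
  simpa [h0.ne', hb₁, hb₂] using this

/-- The variable `Y` depends on `t` and `y` only, by the equation for `w` with `W = 0`. -/
theorem pd_Y (H : τ.Removes a₁ a₂ a₃ b₁ b₂ O) (hb₂ : b₂ ≠ 0) (hp : p ∈ O) :
    pd 1 τ.Y p = 0 ∧ pd 3 τ.Y p = 0 := by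
  have e := (H.linear_eq hp two_ne (v := 0) (by simp)).2
  have hR := H.regular.R_ne_zero p hp
  change _ = 2 * b₂ * τ.R p ^ 2 * (pd 1 τ.Y p ^ 2 + pd 3 τ.Y p ^ 2) at e
  have h0 : pd 1 τ.Y p ^ 2 + pd 3 τ.Y p ^ 2 = 0 := by
    have : b₂ * τ.R p ^ 2 * (pd 1 τ.Y p ^ 2 + pd 3 τ.Y p ^ 2) = 0 := by linear_combination -e / 2
    simpa [hb₂, hR] using this
  constructor <;> nlinarith [sq_nonneg (pd 1 τ.Y p), sq_nonneg (pd 3 τ.Y p)]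

end Removes

end Transformation

/-! ### The Hessian of the phase -/

namespace Transformation

/-- A quadratic form in the plane which takes the value `m` at two vectors of square length `s`, and
for which these vectors are orthogonal as well as in the usual sense, is `m / s` times the identity.
-/
theorem form_eq_of_orthogonal {x₁ x₃ z₁ z₃ s m h₁ h₂ h₃ : ℝ} (hs : s ≠ 0)
    (hx : s = x₁ ^ 2 + x₃ ^ 2) (hz : s = z₁ ^ 2 + z₃ ^ 2) (hxz : x₁ * z₁ + x₃ * z₃ = 0)
    (qx : h₁ * x₁ ^ 2 + 2 * h₂ * x₁ * x₃ + h₃ * x₃ ^ 2 = m)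
    (qz : h₁ * z₁ ^ 2 + 2 * h₂ * z₁ * z₃ + h₃ * z₃ ^ 2 = m)
    (qxz : h₁ * x₁ * z₁ + h₂ * (x₁ * z₃ + x₃ * z₁) + h₃ * x₃ * z₃ = 0) :
    s * h₁ = m ∧ h₂ = 0 ∧ s * h₃ = m := by
  -- `z` is `x` turned by a right angle, up to the factor `d / s = ± 1`
  obtain ⟨d, hd⟩ : ∃ d, d = x₁ * z₃ - x₃ * z₁ := ⟨_, rfl⟩
  have e1 : s * z₁ = -(d * x₃) := by rw [hx, hd]; linear_combination x₁ * hxz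
  have e3 : s * z₃ = d * x₁ := by rw [hx, hd]; linear_combination x₃ * hxz
  have hd2 : d ^ 2 = s ^ 2 := by
    have : s * d ^ 2 = s * s ^ 2 := by
      linear_combination d ^ 2 * hx - (s * z₁ - d * x₃) * e1 - (s * z₃ + d * x₁) * e3 - s ^ 2 * hz
    exact mul_left_cancel₀ hs this
  have hd0 : d ≠ 0 := fun h => hs (by
    rw [h] at hd2
    exact pow_eq_zero_iff (two_ne_zero) |>.1 (by linear_combination -hd2))
  have q2 : h₁ * x₃ ^ 2 - 2 * h₂ * x₁ * x₃ + h₃ * x₁ ^ 2 = m := by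
    refine mul_left_cancel₀ (pow_ne_zero 2 hs) ?_
    linear_combination s ^ 2 * qz
      - (h₁ * x₃ ^ 2 - 2 * h₂ * x₁ * x₃ + h₃ * x₁ ^ 2) * hd2
      - h₁ * (s * z₁ - d * x₃) * e1 - h₃ * (s * z₃ + d * x₁) * e3
      - 2 * h₂ * (s * z₃ * e1 - d * x₃ * e3)
  have q3 : x₁ * x₃ * (h₃ - h₁) + (x₁ ^ 2 - x₃ ^ 2) * h₂ = 0 := by
    refine mul_left_cancel₀ hd0 ?_
    linear_combination s * qxz - (h₁ * x₁ + h₂ * x₃) * e1 - (h₂ * x₁ + h₃ * x₃) * e3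
  refine ⟨mul_left_cancel₀ hs ?_, mul_left_cancel₀ (pow_ne_zero 2 hs) ?_, mul_left_cancel₀ hs ?_⟩
  · rw [hx]; linear_combination x₁ ^ 2 * qx + x₃ ^ 2 * q2 - 2 * x₁ * x₃ * q3
  · rw [hx]; linear_combination x₁ * x₃ * qx - x₁ * x₃ * q2 + (x₁ ^ 2 - x₃ ^ 2) * q3
  · rw [hx]; linear_combination x₃ ^ 2 * qx + x₁ ^ 2 * q2 + 2 * x₁ * x₃ * q3

namespace Removes

variable {τ : Transformation} {a₁ a₂ a₃ b₁ b₂ : ℝ} {O : Set Base} {p : Base}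

/-- The spatial gradients of the new variables are orthogonal and have the square length `T'`. -/
theorem gradients (H : τ.Removes a₁ a₂ a₃ b₁ b₂ O) (ha₁ : a₁ ≠ 0) (ha₂ : a₂ ≠ 0) (hb₁ : b₁ ≠ 0)
    (hb₂ : b₂ ≠ 0) (hp : p ∈ O) :
    pd 0 (fun q => τ.newVars q 0) p = pd 1 τ.X p * pd 1 τ.X p + pd 3 τ.X p * pd 3 τ.X p ∧
    pd 0 (fun q => τ.newVars q 0) p = pd 1 τ.Z p * pd 1 τ.Z p + pd 3 τ.Z p * pd 3 τ.Z p ∧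
    pd 1 τ.X p * pd 1 τ.Z p + pd 3 τ.X p * pd 3 τ.Z p = 0 ∧
    pd 0 (fun q => τ.newVars q 0) p = pd 2 τ.Y p * pd 2 τ.Y p := by
  have hX2 : pd 2 (fun q => τ.newVars q 1) p = 0 := H.pd_two_X ha₂ hb₁ hb₂ hp one_ne (by decide)
  have hZ2 : pd 2 (fun q => τ.newVars q 3) p = 0 := H.pd_two_X ha₂ hb₁ hb₂ hp three_ne (by decide)
  obtain ⟨hY1, hY3⟩ := H.pd_Y hb₂ hp
  change pd 1 (fun q => τ.newVars q 2) p = 0 at hY1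
  change pd 3 (fun q => τ.newVars q 2) p = 0 at hY3
  have e1 := H.quadratic_eq hp (κ := fun l m => if l = 1 ∧ m = 1 then 1 else 0)
    (fun l m => by simp only [and_comm])
  have e2 := H.quadratic_eq hp (κ := fun l m => if l = 2 ∧ m = 2 then 1 else 0)
    (fun l m => by simp only [and_comm])
  have e3 := H.quadratic_eq hp (κ := fun l m => if l = 3 ∧ m = 3 then 1 else 0)
    (fun l m => by simp only [and_comm])
  have e4 := H.quadratic_eq hp
    (κ := fun l m => if (l = 1 ∧ m = 3) ∨ (l = 3 ∧ m = 1) then 1 else 0)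
    (fun l m => by simp only [and_comm, or_comm])
  simp [Fin.sum_univ_four, hX2, hZ2, hY1, hY3] at e1 e2 e3 e4
  refine ⟨e1, e3, ?_, ?_⟩
  · change pd 1 (fun q => τ.newVars q 1) p * pd 1 (fun q => τ.newVars q 3) p +
      pd 3 (fun q => τ.newVars q 1) p * pd 3 (fun q => τ.newVars q 3) p = 0
    linear_combination -e4 / 2
  · refine mul_left_cancel₀ ha₁ ?_
    change a₁ * _ = a₁ * (pd 2 (fun q => τ.newVars q 2) p * pd 2 (fun q => τ.newVars q 2) p)
    linear_combination e2

theorem pd_time_eq_zero (H : τ.Removes a₁ a₂ a₃ b₁ b₂ O) {i : Fin 4} (hi : i ≠ 0) (hp : p ∈ O) :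
    pd i (pd 0 fun q => τ.newVars q 0) p = 0 := by
  rw [pd_comm H.isOpen (H.regular.newVars_smooth 0) i 0 p hp,
    pd_congr H.isOpen (g := fun _ => 0) (fun q hq => H.pd_zero_of_ne hi hq) 0 p hp, pd_const]

/-- A harmonic function of `x, z` whose gradient has constant length is affine in `x, z`; here the
square length is `T'`, which depends on the time only. -/
theorem second_derivatives (H : τ.Removes a₁ a₂ a₃ b₁ b₂ O) {f : Base → ℝ}
    (hf : ContDiffOn ℝ ∞ f O)
    (hg : ∀ q ∈ O, pd 0 (fun q => τ.newVars q 0) q = pd 1 f q * pd 1 f q + pd 3 f q * pd 3 f q)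
    (hl : ∀ q ∈ O, pd 1 (pd 1 f) q + pd 3 (pd 3 f) q = 0) (hp : p ∈ O) :
    pd 1 (pd 1 f) p = 0 ∧ pd 3 (pd 1 f) p = 0 ∧ pd 3 (pd 3 f) p = 0 := by
  have h1 := pd_smoothOn H.isOpen hf 1
  have h3 := pd_smoothOn H.isOpen hf 3
  have key : ∀ {i : Fin 4}, i ≠ 0 → pd 1 f p * pd i (pd 1 f) p + pd 3 f p * pd i (pd 3 f) p = 0 :=
    fun {i} hi => by
      have e := pd_congr H.isOpen hg i p hp
      rw [H.pd_time_eq_zero hi hp, pd_add H.isOpen (h1.mul h1) (h3.mul h3) i hp,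
        pd_mul H.isOpen h1 h1 i hp, pd_mul H.isOpen h3 h3 i hp] at e
      linear_combination -e / 2
  have e1 := key one_ne
  have e3 := key three_ne
  have hT := H.time_pos hp
  have hgp := hg p hp
  have hlp := hl p hp
  rw [pd_comm H.isOpen hf 1 3 p hp] at e1
  have r1 : pd 1 (pd 1 f) p = 0 := by
    refine mul_left_cancel₀ hT.ne' ?_
    rw [hgp]
    linear_combination pd 1 f p * e1 - pd 3 f p * e3 + pd 3 f p ^ 2 * hlp
  have r2 : pd 3 (pd 1 f) p = 0 := by
    refine mul_left_cancel₀ hT.ne' ?_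
    rw [hgp]
    linear_combination pd 3 f p * e1 + pd 1 f p * e3 - pd 1 f p * pd 3 f p * hlp
  exact ⟨r1, r2, by linear_combination hlp - r1⟩

/-- If `f` is transported along the gradient of the phase and affine in `x, z`, then the Hessian of the
phase governs the change of its gradient in time. -/
theorem transport (H : τ.Removes a₁ a₂ a₃ b₁ b₂ O) {f : Base → ℝ}
    (hf : ContDiffOn ℝ ∞ f O)
    (ht : ∀ q ∈ O, pd 0 f q + 2 * (pd 1 τ.θ q * pd 1 f q + pd 3 τ.θ q * pd 3 f q) = 0)
    (h2 : ∀ q ∈ O, pd 1 (pd 1 f) q = 0 ∧ pd 3 (pd 1 f) q = 0 ∧ pd 3 (pd 3 f) q = 0) (hp : p ∈ O) :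
    pd 0 (pd 1 f) p = -2 * (pd 1 (pd 1 τ.θ) p * pd 1 f p + pd 3 (pd 1 τ.θ) p * pd 3 f p) ∧
    pd 0 (pd 3 f) p = -2 * (pd 3 (pd 1 τ.θ) p * pd 1 f p + pd 3 (pd 3 τ.θ) p * pd 3 f p) := by
  have hO := H.isOpen
  have hθ := H.regular.smooth_θ
  have s0 := pd_smoothOn hO hf 0
  have s1 := pd_smoothOn hO hf 1
  have s3 := pd_smoothOn hO hf 3
  have t1 := pd_smoothOn hO hθ 1
  have t3 := pd_smoothOn hO hθ 3
  obtain ⟨f11, f31, f33⟩ := h2 p hp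
  have f13 : pd 1 (pd 3 f) p = 0 := by rw [pd_comm hO hf 1 3 p hp, f31]
  have key : ∀ i, pd i (pd 0 f) p + 2 * (pd i (pd 1 τ.θ) p * pd 1 f p + pd 1 τ.θ p * pd i (pd 1 f) p
      + (pd i (pd 3 τ.θ) p * pd 3 f p + pd 3 τ.θ p * pd i (pd 3 f) p)) = 0 := fun i => by
    have e := pd_congr hO (g := fun _ => 0) ht i p hp
    rwa [pd_const, pd_add hO s0 (contDiffOn_const.mul ((t1.mul s1).add (t3.mul s3))) i hp,
      pd_const_mul hO _ ((t1.mul s1).add (t3.mul s3)) i hp,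
      pd_add hO (t1.mul s1) (t3.mul s3) i hp, pd_mul hO t1 s1 i hp, pd_mul hO t3 s3 i hp] at e
  have e1 := key 1
  have e3 := key 3
  rw [pd_comm hO hf 1 0 p hp, f11, f13, pd_comm hO hθ 1 3 p hp] at e1
  rw [pd_comm hO hf 3 0 p hp, f31, f33] at e3
  exact ⟨by linear_combination e1, by linear_combination e3⟩

/-- The Hessian of the phase in the spatial variables is `a₃ diag(1, 1/a₁, 1)`.  The gradients of the
new variables keep the square length `T'`, which makes the Hessian `-T''/(4 T') diag(1, 1/a₁, 1)`; the
factor is `a₃` by the continuity equation for `R`, where `R² = T'`. -/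
theorem hessian_phase (H : τ.Removes a₁ a₂ a₃ b₁ b₂ O) (ha₁ : a₁ ≠ 0) (ha₂ : a₂ ≠ 0)
    (hb₁ : b₁ ≠ 0) (hb₂ : b₂ ≠ 0) (hp : p ∈ O) :
    pd 1 (pd 1 τ.θ) p = a₃ ∧ a₁ * pd 2 (pd 2 τ.θ) p = a₃ ∧ pd 3 (pd 3 τ.θ) p = a₃ ∧
      pd 1 (pd 2 τ.θ) p = 0 ∧ pd 3 (pd 2 τ.θ) p = 0 ∧ pd 3 (pd 1 τ.θ) p = 0 := by
  have hO := H.isOpen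
  have hX := H.regular.smooth_X
  have hY := H.regular.smooth_Y
  have hZ := H.regular.smooth_Z
  have hθ := H.regular.smooth_θ
  have hT := H.time_pos hp
  have G := fun q (hq : q ∈ O) => H.gradients ha₁ ha₂ hb₁ hb₂ hq
  -- the components `X` and `Z`
  have plane : ∀ {A : Fin 4}, A ≠ 0 → A ≠ 2 → ∀ q ∈ O,
      pd 0 (fun q => τ.newVars q A) q + 2 * (pd 1 τ.θ q * pd 1 (fun q => τ.newVars q A) q +
        pd 3 τ.θ q * pd 3 (fun q => τ.newVars q A) q) = 0 ∧
      pd 1 (pd 1 fun q => τ.newVars q A) q + pd 3 (pd 3 fun q => τ.newVars q A) q = 0 := by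
    intro A hA hA2 q hq
    obtain ⟨e1, e2⟩ := H.component_equations ha₂ hq hA
    rw [pd_congr hO (g := fun _ => 0) (fun r hr => H.pd_two_X ha₂ hb₁ hb₂ hr hA hA2) 2 q hq,
      pd_const] at e2
    rw [H.pd_two_X ha₂ hb₁ hb₂ hq hA hA2] at e1
    exact ⟨by linear_combination e1, by linear_combination e2⟩
  have pX := plane one_ne (by decide)
  have pZ := plane three_ne (by decide)
  have dX := fun q (hq : q ∈ O) => H.second_derivatives hX (fun q hq => (G q hq).1)
    (fun q hq => (pX q hq).2) hq
  have dZ := fun q (hq : q ∈ O) => H.second_derivatives hZ (fun q hq => (G q hq).2.1)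
    (fun q hq => (pZ q hq).2) hq
  obtain ⟨tX1, tX3⟩ := H.transport hX (fun q hq => (pX q hq).1) dX hp
  obtain ⟨tZ1, tZ3⟩ := H.transport hZ (fun q hq => (pZ q hq).1) dZ hp
  have x1 := pd_smoothOn hO hX 1
  have x3 := pd_smoothOn hO hX 3
  have z1 := pd_smoothOn hO hZ 1
  have z3 := pd_smoothOn hO hZ 3
  have y2 := pd_smoothOn hO hY 2
  have t2 := pd_smoothOn hO hθ 2
  have gX := pd_congr hO (fun q hq => (G q hq).1) 0 p hp
  have gZ := pd_congr hO (fun q hq => (G q hq).2.1) 0 p hp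
  have gXZ := pd_congr hO (g := fun _ => 0) (fun q hq => (G q hq).2.2.1) 0 p hp
  have gY := pd_congr hO (fun q hq => (G q hq).2.2.2) 0 p hp
  rw [pd_add hO (x1.mul x1) (x3.mul x3) 0 hp, pd_mul hO x1 x1 0 hp, pd_mul hO x3 x3 0 hp,
    tX1, tX3] at gX
  rw [pd_add hO (z1.mul z1) (z3.mul z3) 0 hp, pd_mul hO z1 z1 0 hp, pd_mul hO z3 z3 0 hp,
    tZ1, tZ3] at gZ
  rw [pd_add hO (x1.mul z1) (x3.mul z3) 0 hp, pd_mul hO x1 z1 0 hp, pd_mul hO x3 z3 0 hp,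
    tX1, tX3, tZ1, tZ3, pd_const] at gXZ
  rw [pd_mul hO y2 y2 0 hp] at gY
  obtain ⟨g1, g2, g3, g4⟩ := G p hp
  obtain ⟨q1, q2, q3⟩ := form_eq_of_orthogonal (m := -pd 0 (pd 0 fun q => τ.newVars q 0) p / 4)
    (h₁ := pd 1 (pd 1 τ.θ) p) (h₂ := pd 3 (pd 1 τ.θ) p) (h₃ := pd 3 (pd 3 τ.θ) p) hT.ne'
    (by rw [g1]; ring) (by rw [g2]; ring) g3 (by rw [gX]; ring) (by rw [gZ]; ring)
    (by linear_combination -gXZ / 4)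
  -- the component `Y`
  have cY : ∀ q ∈ O, pd 0 τ.Y q + 2 * a₁ * (pd 2 τ.θ q * pd 2 τ.Y q) = 0 := fun q hq => by
    have e : pd 0 τ.Y q + 2 * (pd 1 τ.θ q * pd 1 τ.Y q + a₁ * (pd 2 τ.θ q * pd 2 τ.Y q) +
      pd 3 τ.θ q * pd 3 τ.Y q) = 0 := (H.component_equations ha₂ hq two_ne).1
    rw [(H.pd_Y hb₂ hq).1, (H.pd_Y hb₂ hq).2] at e
    linear_combination e
  have Y1 : ∀ j, pd j (pd 1 τ.Y) p = 0 := fun j => by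
    rw [pd_congr hO (g := fun _ => 0) (fun q hq => (H.pd_Y hb₂ hq).1) j p hp, pd_const]
  have Y3 : ∀ j, pd j (pd 3 τ.Y) p = 0 := fun j => by
    rw [pd_congr hO (g := fun _ => 0) (fun q hq => (H.pd_Y hb₂ hq).2) j p hp, pd_const]
  have Y22 : pd 2 (pd 2 τ.Y) p = 0 := by
    have e : pd 1 (pd 1 τ.Y) p + a₁ * pd 2 (pd 2 τ.Y) p + pd 3 (pd 3 τ.Y) p = 0 :=
      (H.component_equations ha₂ hp two_ne).2
    rw [Y1, Y3, zero_add, add_zero] at e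
    exact (mul_eq_zero.1 e).resolve_left ha₁
  have kY : ∀ i, pd i (pd 0 τ.Y) p + 2 * a₁ * (pd i (pd 2 τ.θ) p * pd 2 τ.Y p +
      pd 2 τ.θ p * pd i (pd 2 τ.Y) p) = 0 := fun i => by
    have e := pd_congr hO (g := fun _ => 0) cY i p hp
    rwa [pd_const, pd_add hO (pd_smoothOn hO hY 0) (contDiffOn_const.mul (t2.mul y2)) i hp,
      pd_const_mul hO _ (t2.mul y2) i hp, pd_mul hO t2 y2 i hp] at e
  have Y2ne : pd 2 τ.Y p ≠ 0 := fun h => by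
    rw [h, mul_zero] at g4
    exact hT.ne' g4
  have k1 := kY 1
  have k2 := kY 2
  have k3 := kY 3
  rw [pd_comm hO hY 1 0 p hp, Y1, pd_comm hO hY 1 2 p hp, Y1] at k1
  rw [pd_comm hO hY 3 0 p hp, Y3, pd_comm hO hY 3 2 p hp, Y3] at k3
  rw [pd_comm hO hY 2 0 p hp, Y22] at k2
  have r1 : pd 1 (pd 2 τ.θ) p = 0 := by simpa [ha₁, Y2ne] using k1
  have r3 : pd 3 (pd 2 τ.θ) p = 0 := by simpa [ha₁, Y2ne] using k3
  have r2 : pd 0 (fun q => τ.newVars q 0) p * (a₁ * pd 2 (pd 2 τ.θ) p) =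
      -pd 0 (pd 0 fun q => τ.newVars q 0) p / 4 := by
    rw [g4, gY]
    linear_combination pd 2 τ.Y p * k2 / 2
  -- the amplitude
  have hR := H.regular.smooth_R
  have eR := pd_congr hO (fun q hq => (H.gauge_consequences ha₂ hq).1) 0 p hp
  simp only [pow_two] at eR
  rw [pd_mul hO hR hR 0 hp] at eR
  have hR1 := (H.gauge_consequences ha₂ hp).1
  have eP := (H.phase_equations ha₂ hp).1
  have m : -pd 0 (pd 0 fun q => τ.newVars q 0) p / 4 = pd 0 (fun q => τ.newVars q 0) p * a₃ := by
    linear_combination τ.R p * eP - eR / 2 - q1 - r2 - q3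
      + (a₃ - (pd 1 (pd 1 τ.θ) p + a₁ * pd 2 (pd 2 τ.θ) p + pd 3 (pd 3 τ.θ) p)) * hR1
  rw [m] at q1 q3 r2
  exact ⟨mul_left_cancel₀ hT.ne' q1, mul_left_cancel₀ hT.ne' r2, mul_left_cancel₀ hT.ne' q3,
    r1, r3, q2⟩

/-- The spatial Hessian of `S = -(θ_t + θ_x² + a₁ θ_y² + θ_z²)` is `-2 a₃² diag(1, 1/a₁, 1)`, and
`S` is annihilated by `∂_x² + b₁ ∂_y² + ∂_z²`. -/
theorem b_eq (H : τ.Removes a₁ a₂ a₃ b₁ b₂ O) (hne : O.Nonempty) (ha₁ : a₁ ≠ 0) (ha₂ : a₂ ≠ 0)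
    (ha₃ : a₃ ≠ 0) (hb₁ : b₁ ≠ 0) (hb₂ : b₂ ≠ 0) : b₁ = -2 * a₁ := by
  obtain ⟨p, hp⟩ := hne
  have hO := H.isOpen
  have hθ := H.regular.smooth_θ
  have D := fun q (hq : q ∈ O) => H.hessian_phase ha₁ ha₂ hb₁ hb₂ hq
  have s := fun i => pd_smoothOn hO hθ i
  have hS : ∀ q ∈ O, τ.S q = (-1) * (pd 0 τ.θ q + pd 1 τ.θ q * pd 1 τ.θ q +
      a₁ * (pd 2 τ.θ q * pd 2 τ.θ q) + pd 3 τ.θ q * pd 3 τ.θ q) := fun q hq => by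
    rw [(H.phase_equations ha₂ hq).2]; ring
  have s12 := (s 1).mul (s 1)
  have s22 := contDiffOn_const (c := a₁).mul ((s 2).mul (s 2))
  have s32 := (s 3).mul (s 3)
  have first : ∀ i, ∀ q ∈ O, pd i τ.S q = (-1) * (pd i (pd 0 τ.θ) q +
      2 * (pd i (pd 1 τ.θ) q * pd 1 τ.θ q + a₁ * (pd i (pd 2 τ.θ) q * pd 2 τ.θ q) +
        pd i (pd 3 τ.θ) q * pd 3 τ.θ q)) := fun i q hq => by
    rw [pd_congr hO hS i q hq,
      pd_const_mul hO _ ((((s 0).add s12).add s22).add s32) i hq,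
      pd_add hO (((s 0).add s12).add s22) s32 i hq, pd_add hO ((s 0).add s12) s22 i hq,
      pd_add hO (s 0) s12 i hq, pd_const_mul hO _ ((s 2).mul (s 2)) i hq,
      pd_mul hO (s 1) (s 1) i hq, pd_mul hO (s 2) (s 2) i hq, pd_mul hO (s 3) (s 3) i hq]
    ring
  have second : ∀ i, (∀ q ∈ O, pd i τ.S q = (-1) * (pd i (pd 0 τ.θ) q + 2 * a₃ * pd i τ.θ q)) →
      (∃ c, ∀ q ∈ O, pd i (pd i τ.θ) q = c) →
      pd i (pd i τ.S) p = (-1) * (2 * a₃ * pd i (pd i τ.θ) p) := by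
    rintro i h ⟨c, hc⟩
    have s0 := pd_smoothOn hO (s 0) i
    have si := contDiffOn_const (c := 2 * a₃).mul (s i)
    have e0 : pd i (pd i (pd 0 τ.θ)) p = 0 := by
      rw [pd_congr hO (fun q hq => pd_comm hO hθ i 0 q hq) i p hp, pd_comm hO (s i) i 0 p hp,
        pd_congr hO (g := fun _ => c) hc 0 p hp, pd_const]
    rw [pd_congr hO h i p hp, pd_const_mul hO _ (s0.add si) i hp, pd_add hO s0 si i hp,
      pd_const_mul hO _ (s i) i hp, e0, zero_add]
  have e1 := second 1 (fun q hq => by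
    obtain ⟨d1, d2, d3, d4, d5, d6⟩ := D q hq
    rw [first 1 q hq, d1, d4, pd_comm hO hθ 1 3 q hq, d6]; ring) ⟨_, fun q hq => (D q hq).1⟩
  have e2 := second 2 (fun q hq => by
    obtain ⟨d1, d2, d3, d4, d5, d6⟩ := D q hq
    rw [first 2 q hq, pd_comm hO hθ 2 1 q hq, d4, pd_comm hO hθ 2 3 q hq, d5, ← mul_assoc, d2]
    ring) ⟨a₃ / a₁, fun q hq => by rw [← (D q hq).2.1]; field_simp⟩
  have e3 := second 3 (fun q hq => by
    obtain ⟨d1, d2, d3, d4, d5, d6⟩ := D q hq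
    rw [first 3 q hq, d3, d5, d6]; ring) ⟨_, fun q hq => (D q hq).2.2.1⟩
  have L := H.lap_S hp
  obtain ⟨d1, d2, d3, -, -, -⟩ := D p hp
  rw [e1, e2, e3, d1, d3] at L
  have : a₃ ^ 2 * (2 * a₁ + b₁) = 0 := by
    linear_combination -a₁ * L / 2 - b₁ * a₃ * d2
  have h0 := (mul_eq_zero.1 this).resolve_left (pow_ne_zero 2 ha₃)
  linear_combination h0

end Removes

end Transformation

end DaveyStewartson
end

open DaveyStewartson

theorem corollary2p1 (a₁ : ℝ) (ha₁ : a₁ ≠ 0) :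
    -- the structure of the three symmetry algebras
    (∀ U : TopologicalSpace.Opens Pt, (U : Set Pt).Nonempty → Convex ℝ (U : Set Pt) →
      ∀ a₂ b₂ : ℝ, a₂ ≠ 0 → b₂ ≠ 0 →
        (∀ b₁ : ℝ, b₁ ≠ 0 →
          HasSemidirectStructure (mdsSystem a₁ a₂ 0 b₁ b₂) U a₁ fieldX1 fieldX2 fieldX3) ∧
        (∀ a₃ : ℝ, a₃ ≠ 0 →
          HasSemidirectStructure (mdsSystem a₁ a₂ a₃ (-2 * a₁) b₂) U a₁
            fieldX1 (fieldX2' a₁ a₃) fieldX3) ∧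
        (∀ b₁ : ℝ, b₁ ≠ 0 →
          HasSemidirectStructure (dsSystem a₁ a₂ b₁ b₂) U a₁ fieldX1 fieldX2 fieldX3)) ∧
    -- the three symmetry algebras are isomorphic
    (∀ U U' U'' : TopologicalSpace.Opens Pt,
      (U : Set Pt).Nonempty → Convex ℝ (U : Set Pt) →
      (U' : Set Pt).Nonempty → Convex ℝ (U' : Set Pt) →
      (U'' : Set Pt).Nonempty → Convex ℝ (U'' : Set Pt) →
      ∀ a₂ b₁ b₂ a₂' a₃' b₂' a₂'' b₁'' b₂'' : ℝ, a₂ ≠ 0 → b₁ ≠ 0 → b₂ ≠ 0 →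
        a₂' ≠ 0 → a₃' ≠ 0 → b₂' ≠ 0 → a₂'' ≠ 0 → b₁'' ≠ 0 → b₂'' ≠ 0 →
      ∀ T₀ T₁ : ℝ, T₁ ≠ 0 →
        times U = (fun t => T₁ * Real.exp (-4 * a₃' * t) + T₀) '' times U' →
        times U'' = times U →
        Nonempty (symmetryAlgebra (mdsSystem a₁ a₂ 0 b₁ b₂) U ≃ₗ⁅ℝ⁆
          symmetryAlgebra (mdsSystem a₁ a₂' a₃' (-2 * a₁) b₂') U') ∧
        Nonempty (symmetryAlgebra (mdsSystem a₁ a₂ 0 b₁ b₂) U ≃ₗ⁅ℝ⁆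
          symmetryAlgebra (dsSystem a₁ a₂'' b₁'' b₂'') U'')) ∧
    -- transformability to the system with `a₃ = 0`
    (∀ a₂ a₃ b₁ b₂ : ℝ, a₂ ≠ 0 → a₃ ≠ 0 → b₁ ≠ 0 → b₂ ≠ 0 →
      (b₁ = -2 * a₁ → RemovableOn a₁ a₂ a₃ b₁ b₂ Set.univ) ∧
      (∀ O : Set Base, IsOpen O → O.Nonempty →
        RemovableOn a₁ a₂ a₃ b₁ b₂ O → b₁ = -2 * a₁)) := by
  have hm : -2 * a₁ ≠ 0 := mul_ne_zero (by norm_num) ha₁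
  have mds : ∀ {U : TopologicalSpace.Opens Pt} {a₂ a₃ b₁ b₂ : ℝ}, Convex ℝ (U : Set Pt) →
      b₁ ≠ 0 → b₂ ≠ 0 → (a₃ = 0 ∨ b₁ = -2 * a₁) →
      Classified (mdsSystem a₁ a₂ a₃ b₁ b₂) U a₁ a₃ := fun hU hb₁ hb₂ h => by
    rw [mdsSystem_eq]
    exact classified_genSystem hU ha₁ hb₁ (Or.inl ⟨hb₂, rfl⟩) h
  have ds : ∀ {U : TopologicalSpace.Opens Pt} {a₂ b₁ b₂ : ℝ}, Convex ℝ (U : Set Pt) →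
      b₁ ≠ 0 → b₂ ≠ 0 → Classified (dsSystem a₁ a₂ b₁ b₂) U a₁ 0 := fun hU hb₁ hb₂ => by
    rw [dsSystem_eq]
    exact classified_genSystem hU ha₁ hb₁ (Or.inr ⟨rfl, hb₂⟩) (Or.inl rfl)
  have scaling : ∀ t : ℝ, HasDerivAt (fun t => 2 * t) (2 + 4 * 0 * (2 * t)) t := fun t => by
    simpa using (hasDerivAt_id t).const_mul (2 : ℝ)
  refine ⟨fun U hne hU a₂ b₂ _ hb₂ => ⟨fun b₁ hb₁ => ?_, fun a₃ ha₃ => ?_, fun b₁ hb₁ => ?_⟩,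
    fun U U' U'' hne hU hne' hU' hne'' hU'' a₂ b₁ b₂ a₂' a₃' b₂' a₂'' b₁'' b₂'' _ hb₁ hb₂ _ ha₃ hb₂'
      _ hb₁'' hb₂'' T₀ T₁ hT₁ hI hI'' => ⟨?_, ?_⟩,
    fun a₂ a₃ b₁ b₂ ha₂ ha₃ hb₁ hb₂ => ⟨?_, fun O hO hne hrem => ?_⟩⟩
  · rw [fieldX2_eq (a₁ := a₁)]
    exact (mds hU hb₁ hb₂ (Or.inl rfl)).hasSemidirectStructure ha₁ hU hne scaling (by simp)
  · rw [fieldX2'_eq ha₃]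
    refine (mds hU hm hb₂ (Or.inr rfl)).hasSemidirectStructure (κ := 0) ha₁ hU hne (fun t => ?_)
      fun t => ?_
    · have h := (((hasDerivAt_id t).const_mul (4 * a₃)).exp).const_mul (1 / (2 * a₃))
      refine h.congr_deriv ?_
      simp only [id]
      ring
    · have := (Real.exp_pos (4 * a₃ * t)).ne'
      simp [ha₃]
  · rw [fieldX2_eq (a₁ := a₁)]
    exact (ds hU hb₁ hb₂).hasSemidirectStructure ha₁ hU hne scaling (by simp)
  · exact (TimeChange.exponential ha₃ hT₁ hI).nonempty_lieEquiv ha₁ hne hne'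
      (mds hU hb₁ hb₂ (Or.inl rfl)) (mds hU' hm hb₂' (Or.inr rfl))
  · have C : TimeChange 0 (times U) (times U'') := hI'' ▸ TimeChange.refl (times U)
    exact C.nonempty_lieEquiv ha₁ hne hne'' (mds hU hb₁ hb₂ (Or.inl rfl)) (ds hU'' hb₁'' hb₂'')
  · rintro rfl
    exact removableOn_univ ha₁ ha₃
  · obtain ⟨τ, hτ, h⟩ := hrem
    exact Transformation.Removes.b_eq ⟨hO, hτ, h⟩ hne ha₁ ha₂ ha₃ hb₁ hb₂
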